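/- Let $\Delta$ be a finite (geometric) simplicial complex. It is a normal $3$-pseudomanifold if all its maximal faces (facets) are $3$-simplices, every triangle lies in exactly two facets, and the link of every face of dimension at most $1$, including the empty face (whose link is $\Delta$ itself), is connected; it is balanced if its vertices can be coloured by $\kappa:V(\Delta)\to\{0,1,2,3\}$ so that no simplex has two vertices of the same colour. For a balanced normal $3$-pseudomanifold, the dual graph $\Lambda(\Delta)$ has the facets as vertices, two of them being joined by an edge when they share a triangle; this edge gets the colour $c$ that is missing from the triangle. For each cyclic ordering $\varepsilon=(\varepsilon_0,\varepsilon_1,\varepsilon_2,\varepsilon_3)$ of the four colours, $\Lambda(\Delta)$ embeds in a closed surface $F_\varepsilon$ whose cell structure has the vertices and edges of $\Lambda(\Delta)$, with the $2$-cells bounded exactly by the bi-coloured cycles of colours $\varepsilon_i,\varepsilon_{i+1}$, $i\in\mathbb Z_4$. Put $\rho_\varepsilon(\Delta)=1-\tfrac12\chi(F_\varepsilon)$ (the genus of $F_\varepsilon$ if it is orientable, half its genus otherwise), and $\mathcal G(\Delta)=\min_\varepsilon\rho_\varepsilon(\Delta)$. The balanced genus of a closed $3$-manifold $M$ is $$\mathcal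 G_M=\min\{\mathcal G(\Delta)\;:\;\Delta\text{ a balanced triangulation of }M\},$$ where a balanced triangulation of $M$ is a balanced normal $3$-pseudomanifold whose geometric carrier is homeomorphic to $M$. **Theorem.** Let $M$ be a closed (compact, without boundary) connected $3$-manifold that is not homeomorphic to the $3$-sphere. Then $$\mathcal G_M\;\ge\; m(M)+3,$$ where $m(M)$ is the rank of the fundamental group $\pi_1(M)$, i.e. its minimal number of generators. -/

import Mathlib

open Geometry

/-- The minimal number of generators of a group, with value `⊤` if the group is not finitely
generated. -/
noncomputable def groupRank (G : Type*) [Group G] : ℕ∞ :=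
  ⨅ S : {S : Set G // Subgroup.closure S = ⊤}, (S : Set G).encard

section Complexes

variable {E : Type*} [AddCommGroup E] [Module ℝ E]

open Classical in
/-- The nonempty faces of the link of `σ` in `K`. For `σ = ∅` (the face of dimension `-1` of
every complex, which `K.faces` does not list) these are all the faces of `K`. -/
def linkFaces (K : SimplicialComplex ℝ E) (σ : Finset E) : Set (Finset E) :=
  {τ | τ ∈ K.faces ∧ Disjoint τ σ ∧ τ ∪ σ ∈ K.faces}

open Classical in
/-- The graph (1-skeleton) of the link of `σ` in `K`. -/
def linkGraph (K : SimplicialComplex ℝ E) (σ : Finset E) :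
    SimpleGraph {v : E // {v} ∈ linkFaces K σ} where
  Adj u v := u ≠ v ∧ ({(u : E), (v : E)} : Finset E) ∈ linkFaces K σ
  symm := ⟨fun u v h => ⟨h.1.symm, by rw [Finset.pair_comm]; exact h.2⟩⟩
  loopless := ⟨fun _ h => h.1 rfl⟩

/-- A (closed, connected) normal `d`-pseudomanifold: a finite complex, pure of dimension `d`, in
which every `(d-1)`-face lies in exactly two facets and in which the link of every face of
codimension at least two, the empty face included, is connected. A face with `k` vertices has
dimension `k - 1`. A complex is connected when it has a vertex and its graph is connected. -/
structure IsNormalPseudomanifold (d : ℕ) (K : SimplicialComplex ℝ E) : Prop where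
  finite : K.faces.Finite
  pure : ∀ σ ∈ K.facets, σ.card = d + 1
  two_facets : ∀ σ ∈ K.faces, σ.card = d → {τ | τ ∈ K.facets ∧ σ ⊆ τ}.ncard = 2
  connected_link : ∀ σ : Finset E, σ = ∅ ∨ σ ∈ K.faces → σ.card + 1 ≤ d →
    (linkGraph K σ).Connected

/-- `κ` is a balanced colouring of `K` with the colours `0, …, d`: every face has at most one
vertex of each colour. Only the values of `κ` on the vertices of `K` matter. -/
def IsBalancedColoring (d : ℕ) (K : SimplicialComplex ℝ E) (κ : E → Fin (d + 1)) : Prop :=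
  ∀ σ ∈ K.faces, Set.InjOn κ (σ : Set E)

open Classical in
/-- The dual graph: its vertices are the facets, two of them adjacent when they share a
`(d-1)`-simplex. -/
def dualGraph (d : ℕ) (K : SimplicialComplex ℝ E) : SimpleGraph {σ : Finset E // σ ∈ K.facets} where
  Adj σ τ := σ ≠ τ ∧ ((σ : Finset E) ∩ (τ : Finset E)).card = d
  symm := ⟨fun σ τ h => ⟨h.1.symm, by rw [Finset.inter_comm]; exact h.2⟩⟩
  loopless := ⟨fun _ h => h.1 rfl⟩

open Classical in
/-- The edge `{σ, τ}` of the dual graph has colour `c` when the colours of the vertices of `σ ∩ τ`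
are exactly the colours other than `c`. This is the spanning subgraph of the dual graph that
consists of the edges whose colour is `a` or `b`. -/
def bicoloredGraph (d : ℕ) (K : SimplicialComplex ℝ E) (κ : E → Fin (d + 1)) (a b : Fin (d + 1)) :
    SimpleGraph {σ : Finset E // σ ∈ K.facets} where
  Adj σ τ := (dualGraph d K).Adj σ τ ∧ ∃ c : Fin (d + 1), (c = a ∨ c = b) ∧
    ((σ : Finset E) ∩ (τ : Finset E)).image κ = {c}ᶜ
  symm := ⟨fun σ τ h => ⟨h.1.symm, by rw [Finset.inter_comm]; exact h.2⟩⟩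
  loopless := ⟨fun _ h => h.1.1 rfl⟩

/-- The number of bi-coloured cycles with colours `a` and `b` in the dual graph. For a balanced
normal pseudomanifold the graph of these two colours is 2-regular, so these cycles are its
connected components. -/
noncomputable def bicoloredCycleCount (d : ℕ) (K : SimplicialComplex ℝ E) (κ : E → Fin (d + 1))
    (a b : Fin (d + 1)) : ℕ :=
  Nat.card (bicoloredGraph d K κ a b).ConnectedComponent

/-- The Euler characteristic `V - E + F` of the closed surface `F_ε` into which the dual graph
embeds regularly with respect to the cyclic order `(ε 0, ε 1, …, ε d)` of the colours. The vertices
and edges of its cell structure are those of the dual graph, and its 2-cells are discs glued in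
along the bi-coloured cycles with colours `ε i`, `ε (i + 1)`, where `i` runs over `ℤ/(d+1)`. -/
noncomputable def surfaceEulerChar (d : ℕ) (K : SimplicialComplex ℝ E) (κ : E → Fin (d + 1))
    (ε : Equiv.Perm (Fin (d + 1))) : ℤ :=
  (Nat.card {σ : Finset E // σ ∈ K.facets} : ℤ) - (dualGraph d K).edgeSet.ncard
    + ∑ i : Fin (d + 1), (bicoloredCycleCount d K κ (ε i) (ε (i + 1)) : ℤ)

/-- The balanced `ε`-genus `1 - χ(F_ε) / 2`: the genus of `F_ε` if this surface is orientable, and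
half of its (non-orientable) genus otherwise. -/
noncomputable def balancedGenusAt (d : ℕ) (K : SimplicialComplex ℝ E) (κ : E → Fin (d + 1))
    (ε : Equiv.Perm (Fin (d + 1))) : ℝ :=
  1 - (surfaceEulerChar d K κ ε : ℝ) / 2

/-- The balanced genus of a balanced complex: the smallest balanced `ε`-genus over the finitely
many cyclic orders `ε` of the colours. -/
noncomputable def complexBalancedGenus (d : ℕ) (K : SimplicialComplex ℝ E) (κ : E → Fin (d + 1)) :
    ℝ :=
  Finset.univ.inf' Finset.univ_nonempty (balancedGenusAt d K κ)

end Complexes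

/-- A balanced triangulation of a space `M` of dimension `d`: a balanced normal `d`-pseudomanifold
in some `ℝⁿ` whose geometric carrier is homeomorphic to `M`. -/
structure BalancedTriangulation (d : ℕ) (M : Type*) [TopologicalSpace M] where
  n : ℕ
  complex : SimplicialComplex ℝ (EuclideanSpace ℝ (Fin n))
  normal : IsNormalPseudomanifold d complex
  color : EuclideanSpace ℝ (Fin n) → Fin (d + 1)
  balanced : IsBalancedColoring d complex color
  homeo : complex.space ≃ₜ M

/-- The balanced genus of a `d`-dimensional space: the least balanced genus of its balanced
triangulations (`⊤` if it had none). -/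
noncomputable def balancedGenus (d : ℕ) (M : Type*) [TopologicalSpace M] : EReal :=
  ⨅ T : BalancedTriangulation d M, (complexBalancedGenus d T.complex T.color : EReal)

/-! Split the colours into the two pairs that are opposite in the cyclic order, `{ε 0, ε 2}` and `{ε
1, ε 3}`. Let A and B be the vertices with colours in these pairs, and G_A, G_B the graphs that they
span.

Counting. A bi-coloured cycle for consecutive colours runs around an edge joining A to B, and each
such edge carries only one, so χ(F_ε) is at most the number of A-B edges minus the number of facets.
The link of y ∈ B is a closed connected surface, cut into vertices in A, edges of G_A and one disc
per B-neighbour of y, so its Euler characteristic is at most 2 (`Normal.link_euler`). Summing over B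
bounds the cycle rank of G_B by ρ_ε; by symmetry the same holds for G_A
(`edges_add_one_le_balancedGenusAt`).

Generators. The fundamental group is generated by the edges of G_A modulo a spanning tree, because
the link of each y ∈ B meets G_A in a connected graph. An edge of G_A is redundant if its end points
are joined, inside the link of some y, by edges already accounted for. If three edges can be
recovered successively in this way from the remaining ones, m(M) is at most the cycle rank minus 3
(`Normal.groupRank_le`), which is the claim. Everything reduces to showing that M is the 3-sphere
when neither G_A nor G_B has three removable edges.

Rigidity. Removable edges come from the complement of a spanning tree in one link, and from
triangular systems of three edges against three edges of the other graph
(`HalfNormal.removable_of_triangular`). Their absence forces all degrees to be at most 3. Either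
every edge of G_A is joined to every edge of G_B, both graphs being cycles, or some vertex has
degree 3 and both graphs are theta graphs, with two edges spanning a facet exactly when they lie in
arcs of different labels (`Normal.nonempty_arcModel_of_not_forall`).

Recognition. A cycle or a theta graph is the suspension of its set of arcs. The complex is therefore
the double suspension of the graph of compatible pairs of arcs, a 4-cycle or a 6-cycle. Realising
this circle as a complete fan of rays in the plane and the two suspensions by height coordinates
gives a map to ℝ⁴ whose radial projection is a homeomorphism onto the sphere
(`ArcModel.nonempty_homeomorph_sphere`). -/

/-! ### Facet systems and removable edges -/

/-- The combinatorial data of a balanced `3`-complex whose four colours are split into two pairs: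
`Fac x x' y y'` says that `x, x', y, y'` span a facet, where `x, x'` have the two colours of the
first pair, in any order, and `y, y'` those of the second pair. -/
structure FacetSystem (A B : Type*) where
  Fac : A → A → B → B → Prop
  swapA : ∀ {x x' y y'}, Fac x x' y y' → Fac x' x y y'
  swapB : ∀ {x x' y y'}, Fac x x' y y' → Fac x x' y' y
  neA : ∀ {x x' y y'}, Fac x x' y y' → x ≠ x'
  neB : ∀ {x x' y y'}, Fac x x' y y' → y ≠ y'

namespace FacetSystem

variable {A B : Type*} (C : FacetSystem A B)

/-- The same facets with the roles of the two colour pairs exchanged. -/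
def swap : FacetSystem B A where
  Fac y y' x x' := C.Fac x x' y y'
  swapA h := C.swapB h
  swapB h := C.swapA h
  neA h := C.neB h
  neB h := C.neA h

/-- The graph spanned by the vertices of the first colour pair. -/
def graph : SimpleGraph A where
  Adj x x' := ∃ y y', C.Fac x x' y y'
  symm := ⟨fun _ _ ⟨y, y', h⟩ => ⟨y, y', C.swapA h⟩⟩
  loopless := ⟨fun _ ⟨_, _, h⟩ => C.neA h rfl⟩

/-- The part of `C.graph` that lies in the link of `y`. -/
def link (y : B) : SimpleGraph A where
  Adj x x' := ∃ y', C.Fac x x' y y'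
  symm := ⟨fun _ _ ⟨y', h⟩ => ⟨y', C.swapA h⟩⟩
  loopless := ⟨fun _ ⟨_, h⟩ => C.neA h rfl⟩

/-- The link of the edge `{y, y'}`. -/
def edgeLink (y y' : B) : SimpleGraph A where
  Adj x x' := C.Fac x x' y y'
  symm := ⟨fun _ _ h => C.swapA h⟩
  loopless := ⟨fun _ h => C.neA h rfl⟩

lemma edgeLink_le_link (y y' : B) : C.edgeLink y y' ≤ C.link y := fun _ _ h => ⟨y', h⟩

lemma link_le_graph (y : B) : C.link y ≤ C.graph := fun _ _ ⟨y', h⟩ => ⟨y, y', h⟩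

/-- The part of normality that concerns the subgraphs of `C.graph`. -/
structure HalfNormal : Prop where
  cycles : ∀ y y', (C.edgeLink y y').IsCycles
  cover : ∀ x, ∃ x', C.graph.Adj x x'
  connected : C.graph.Connected
  link_reachable : ∀ y x x', x ∈ (C.link y).support → x' ∈ (C.link y).support →
    (C.link y).Reachable x x'
  edgeLink_reachable : ∀ y y' x x', x ∈ (C.edgeLink y y').support →
    x' ∈ (C.edgeLink y y').support → (C.edgeLink y y').Reachable x x'
  dual_reachable : ∀ y w w', C.swap.graph.Adj y w → C.swap.graph.Adj y w' →
    Relation.ReflTransGen (fun u v => ∃ x x', C.Fac x x' y u ∧ C.Fac x x' y v) w w'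

/-- `C` comes from a normal pseudomanifold. -/
structure Normal : Prop where
  left : C.HalfNormal
  right : C.swap.HalfNormal

lemma Normal.swap {C : FacetSystem A B} (h : C.Normal) : C.swap.Normal := ⟨h.right, h.left⟩

/-- A set of edges, given as a graph, that contains each edge of a vertex link which is joined up
by edges of the set in that link. -/
def IsClosed (S : SimpleGraph A) : Prop :=
  ∀ y x x', (C.link y).Adj x x' → (C.link y ⊓ S).Reachable x x' → S.Adj x x'

/-- A set of edges of `C.graph` all of which are recovered from the other edges by closing up. -/
def Removable (R : Set (Sym2 A)) : Prop :=
  ∀ S, C.IsClosed S → C.graph.deleteEdges R ≤ S → C.graph ≤ S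

end FacetSystem

/-! ### Reachability and spanning trees -/

/-- The graph of pairs of distinct vertices that are joined by a walk. -/
def SimpleGraph.reachGraph {V : Type*} (G : SimpleGraph V) : SimpleGraph V where
  Adj x y := x ≠ y ∧ G.Reachable x y
  symm := ⟨fun _ _ h => ⟨h.1.symm, h.2.symm⟩⟩
  loopless := ⟨fun _ h => h.1 rfl⟩

lemma SimpleGraph.le_reachGraph {V : Type*} (G : SimpleGraph V) : G ≤ G.reachGraph :=
  fun _ _ h => ⟨h.ne, h.reachable⟩

lemma SimpleGraph.reachable_of_le_reachGraph {V : Type*} {G H : SimpleGraph V}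
    (h : H ≤ G.reachGraph) {x y : V} (hxy : H.Reachable x y) : G.Reachable x y := by
  obtain ⟨w⟩ := hxy
  induction w with
  | nil => rfl
  | cons hadj _ ih => exact (h hadj).2.trans ih

lemma SimpleGraph.dist_le_of_adj {V : Type*} {G : SimpleGraph V} {r u v : V}
    (hu : G.Reachable r u) (huv : G.Adj u v) : G.dist r v ≤ G.dist r u + 1 := by
  obtain ⟨q, hq⟩ := hu.exists_walk_length_eq_dist
  rw [← hq]
  simpa using SimpleGraph.dist_le (q.append (SimpleGraph.Walk.cons huv .nil))

lemma SimpleGraph.exists_parent {V : Type*} (G : SimpleGraph V) (r : V) :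
    ∃ par : V → V, ∀ v, G.Reachable r v → v ≠ r →
      G.Adj (par v) v ∧ G.dist r v = G.dist r (par v) + 1 ∧ G.Reachable r (par v) := by
  have key : ∀ v, ∃ u, G.Reachable r v → v ≠ r →
      G.Adj u v ∧ G.dist r v = G.dist r u + 1 ∧ G.Reachable r u := by
    intro v
    by_cases hv : G.Reachable r v ∧ v ≠ r
    · obtain ⟨w, hw⟩ := hv.1.symm.exists_walk_length_eq_dist
      cases w with
      | nil => exact absurd rfl hv.2
      | cons hadj p =>
        rename_i u
        refine ⟨u, fun _ _ => ⟨hadj.symm, ?_, p.reachable.symm⟩⟩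
        have h1 : G.dist r u ≤ p.length := by
          rw [SimpleGraph.dist_comm]; exact SimpleGraph.dist_le p
        have h2 := SimpleGraph.dist_le_of_adj p.reachable.symm hadj.symm
        rw [SimpleGraph.dist_comm (u := v)] at hw
        simp at hw
        omega
    · exact ⟨v, fun h1 h2 => absurd ⟨h1, h2⟩ hv⟩
  choose par hpar using key
  exact ⟨par, hpar⟩

/-- A spanning tree of the component of `r`, presented by a parent function. -/
lemma SimpleGraph.exists_spanningTree {V : Type*} [Finite V] (G : SimpleGraph V) (r : V) :
    ∃ (par : V → V) (d : V → ℕ) (T : Set (Sym2 V)), T ⊆ G.edgeSet ∧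
      T.ncard + 1 = {v | G.Reachable r v}.ncard ∧
      (∀ v, G.Reachable r v → v ≠ r → d v = d (par v) + 1 ∧ G.Reachable r (par v)) ∧
      T = (fun v => s(par v, v)) '' {v | G.Reachable r v ∧ v ≠ r} := by
  obtain ⟨par, h⟩ := G.exists_parent r
  refine ⟨par, fun v => G.dist r v, _, ?_, ?_, fun v h1 h2 => (h v h1 h2).2, rfl⟩
  · rintro _ ⟨v, ⟨h1, h2⟩, rfl⟩
    exact (h v h1 h2).1
  · rw [Set.InjOn.ncard_image]
    · have : {v | G.Reachable r v ∧ v ≠ r} = {v | G.Reachable r v} \ {r} := by ext; simp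
      rw [this, Set.ncard_sdiff_singleton_add_one]
      · exact SimpleGraph.Reachable.refl r
    · rintro v ⟨h1, h2⟩ w ⟨h3, h4⟩ hvw
      simp only [Sym2.eq_iff] at hvw
      rcases hvw with hvw | hvw
      · exact hvw.2
      · have := (h v h1 h2).2.1
        have h5 := (h w h3 h4).2.1
        rw [hvw.1] at this
        rw [← hvw.2] at h5
        omega

/-- Descend to the root by induction on the depth. `H` need not contain the tree: it is enough that
each parent is joined to its child somehow. -/
lemma SimpleGraph.reachable_of_spanningTree {V : Type*} {G H : SimpleGraph V} {r : V}
    {par : V → V} {d : V → ℕ}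
    (h : ∀ v, G.Reachable r v → v ≠ r → d v = d (par v) + 1 ∧ G.Reachable r (par v))
    (hH : ∀ v, G.Reachable r v → v ≠ r → H.Reachable (par v) v) {v : V} (hv : G.Reachable r v) :
    H.Reachable r v := by
  induction hn : d v using Nat.strong_induction_on generalizing v with
  | _ n ih =>
    by_cases hvr : v = r
    · rw [hvr]
    · have h1 := h v hv hvr
      exact (ih (d (par v)) (by omega) h1.2 rfl).trans (hH v hv hvr)

lemma SimpleGraph.ncard_reachable_le {V : Type*} [Finite V] (G : SimpleGraph V) (r : V) :
    {v | G.Reachable r v}.ncard ≤ G.edgeSet.ncard + 1 := by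
  obtain ⟨par, d, T, h1, h2, -, -⟩ := G.exists_spanningTree r
  rw [← h2]
  gcongr
  exact Set.toFinite _

/-! ### Recovering edges inside links, and the Euler characteristic of links -/

namespace FacetSystem
variable {A B : Type*} {C : FacetSystem A B}

/-- This is the closed set against which removability gets tested: with it, deleting a removable set
is seen not to change connectivity. -/
lemma isClosed_reachGraph (G : SimpleGraph A) : C.IsClosed G.reachGraph :=
  fun _ _ _ h h' => ⟨h.ne, SimpleGraph.reachable_of_le_reachGraph inf_le_right h'⟩

/-- A closed set that contains all edges but one of an edge link contains also the last one. -/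
lemma HalfNormal.adj_of_edgeLink [Finite A] (hC : C.HalfNormal) {S : SimpleGraph A}
    (hS : C.IsClosed S) {y y' : B} {x x' : A} (h : C.Fac x x' y y')
    (hle : (C.edgeLink y y').deleteEdges {s(x, x')} ≤ S) : S.Adj x x' := by
  refine hS y x x' ⟨y', h⟩ ?_
  have := (hC.cycles y y').reachable_deleteEdges (v := x) (w := x') h
  -- A cycle without one edge still joins the end points of that edge, and the whole cycle lies in
  -- the link of `y`.
  exact this.mono (le_inf ((SimpleGraph.deleteEdges_le _).trans (C.edgeLink_le_link y y')) hle)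

lemma HalfNormal.setOf_reachable_link (hC : C.HalfNormal) {y : B} {r : A}
    (hr : r ∈ (C.link y).support) : {v | (C.link y).Reachable r v} = (C.link y).support := by
  ext v
  refine ⟨fun h => ?_, fun h => hC.link_reachable y r v hr h⟩
  obtain ⟨w⟩ := (show (C.link y).Reachable r v from h).symm
  cases w with
  | nil => exact hr
  | cons hadj _ => exact (SimpleGraph.mem_support _).2 ⟨_, hadj⟩

/-- Each edge in the link of `y` lies in the links of exactly two edges at `y`. -/
lemma Normal.ncard_edgeLink (hC : C.Normal) {x x' : A} {y y' : B} (h : C.Fac x x' y y') :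
    {z | C.Fac x x' y z}.ncard = 2 :=
  hC.right.cycles x x' (v := y) ⟨y', h⟩

/-- There is a set of edges in the link of `y`, one less than the degree of `y` many, which are
recovered from the other edges in this link. -/
lemma Normal.exists_removable_link [Finite A] [Finite B] (hC : C.Normal) (y : B) :
    ∃ R ⊆ (C.link y).edgeSet, R.ncard + 1 = (C.swap.graph.neighborSet y).ncard ∧
      ∀ S, C.IsClosed S → (C.link y).deleteEdges R ≤ S → C.link y ≤ S := by
  obtain ⟨w₀, hw₀⟩ := hC.right.cover y
  -- The B-neighbours of `y` are the centres of discs that tile its link. `W` grows along a spanning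
  -- tree of the dual graph of this tiling, and `R` collects the edges crossed. The edges of `R`
  -- only bound discs in `W`, which keeps the next disc free of deleted edges until it is attached.
  have key : ∀ n, n + 1 ≤ (C.swap.graph.neighborSet y).ncard →
      ∃ W ⊆ C.swap.graph.neighborSet y, W.ncard = n + 1 ∧ w₀ ∈ W ∧
      ∃ R ⊆ (C.link y).edgeSet, R.ncard = n ∧
        (∀ x x' z, s(x, x') ∈ R → C.Fac x x' y z → z ∈ W) ∧
        ∀ S, C.IsClosed S → (C.link y).deleteEdges R ≤ S → C.link y ≤ S := by
    intro n
    induction n with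
    | zero =>
      intro _
      refine ⟨{w₀}, by simpa using hw₀, by simp, rfl, ∅, by simp, by simp, by simp, ?_⟩
      intro S _ h
      simpa using h
    | succ n ih =>
      intro hn
      obtain ⟨W, hWs, hWc, hw, R, hR, hRc, hRW, hcl⟩ := ih (by omega)
      have hex : ∃ w ∈ W, ∃ w' ∉ W, ∃ x x', C.Fac x x' y w ∧ C.Fac x x' y w' := by
        by_contra hcon
        have hall : C.swap.graph.neighborSet y ⊆ W := by
          intro w' hw'
          have := hC.left.dual_reachable y w₀ w' hw₀ hw'
          induction this with
          | refl => exact hw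
          | tail hab hbc ihb =>
            obtain ⟨x, x', h1, h2⟩ := hbc
            by_contra hc
            exact hcon ⟨_, ihb ⟨x, x', h1⟩, _, hc, x, x', h1, h2⟩
        have := Set.ncard_le_ncard hall (Set.toFinite _)
        omega
      obtain ⟨w, hwW, w', hw'W, x, x', h1, h2⟩ := hex
      have hxR : s(x, x') ∉ R := fun h => hw'W (hRW x x' w' h h2)
      refine ⟨insert w' W, Set.insert_subset ⟨x, x', h2⟩ hWs, ?_, Set.mem_insert_of_mem _ hw,
        insert s(x, x') R, Set.insert_subset ⟨w, h1⟩ hR, ?_, ?_, ?_⟩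
      · rw [Set.ncard_insert_of_notMem hw'W, hWc]
      · rw [Set.ncard_insert_of_notMem hxR, hRc]
      · intro u u' z hu hz
        rcases hu with hu | hu
        · have hz' : C.Fac x x' y z := by
            rcases Sym2.eq_iff.1 hu with ⟨rfl, rfl⟩ | ⟨rfl, rfl⟩
            · exact hz
            · exact C.swapA hz
          -- The crossed edge bounds only the two discs `w` and `w'`, and both now belong to the
          -- enlarged set.
          have h2c := hC.ncard_edgeLink h1
          have hsub : ({w, w'} : Set B) ⊆ {z | C.Fac x x' y z} := by
            rintro _ (rfl | rfl)
            exacts [h1, h2]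
          have hww : w ≠ w' := fun h => hw'W (h ▸ hwW)
          have := Set.eq_of_subset_of_ncard_le hsub (by rw [h2c, Set.ncard_pair hww])
            (Set.toFinite _)
          have hz'' : z ∈ ({w, w'} : Set B) := this ▸ hz'
          rcases hz'' with rfl | rfl
          · exact Set.mem_insert_of_mem _ hwW
          · exact Set.mem_insert _ _
        · exact Set.mem_insert_of_mem _ (hRW u u' z hu hz)
      · intro S hS hle
        apply hcl S hS
        -- The disc `w'` is outside `W`, so no other edge of its boundary is deleted: the crossed
        -- edge comes back from that boundary, and then `R` is handled by induction.
        have hxx : S.Adj x x' := by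
          apply hC.left.adj_of_edgeLink hS h2
          intro u u' hu
          rw [SimpleGraph.deleteEdges_adj] at hu
          apply hle
          rw [SimpleGraph.deleteEdges_adj]
          refine ⟨⟨_, hu.1⟩, ?_⟩
          rintro (h | h)
          · exact hu.2 h
          · exact hw'W (hRW u u' w' h hu.1)
        intro u u' hu
        rw [SimpleGraph.deleteEdges_adj] at hu
        by_cases h : s(u, u') = s(x, x')
        · rcases Sym2.eq_iff.1 h with ⟨rfl, rfl⟩ | ⟨rfl, rfl⟩
          · exact hxx
          · exact hxx.symm
        · apply hle
          rw [SimpleGraph.deleteEdges_adj]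
          exact ⟨hu.1, fun hc => hc.elim h hu.2⟩
  have hpos : 0 < (C.swap.graph.neighborSet y).ncard :=
    (Set.ncard_pos (Set.toFinite _)).2 ⟨w₀, hw₀⟩
  obtain ⟨W, hWs, hWc, -, R, hR, hRc, -, hcl⟩ :=
    key ((C.swap.graph.neighborSet y).ncard - 1) (by omega)
  exact ⟨R, hR, by omega, hcl⟩

lemma link_support_nonempty (hC : C.Normal) (y : B) : (C.link y).support.Nonempty := by
  obtain ⟨w, x, x', h⟩ := hC.right.cover y
  exact ⟨x, (SimpleGraph.mem_support _).2 ⟨x', w, h⟩⟩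

/-- The Euler characteristic of the link of `y` is at most two. -/
lemma Normal.link_euler [Finite A] [Finite B] (hC : C.Normal) (y : B) :
    (C.swap.graph.neighborSet y).ncard + (C.link y).support.ncard
      ≤ (C.link y).edgeSet.ncard + 2 := by
  obtain ⟨R, hR, hRc, hcl⟩ := hC.exists_removable_link y
  obtain ⟨r, hr⟩ := link_support_nonempty hC y
  have h1 := ((C.link y).deleteEdges R).ncard_reachable_le r
  -- What is left after deleting one edge for each disc but one still connects the vertices of the
  -- link, hence has at least as many edges as a spanning tree.
  have h2 := hcl ((C.link y).deleteEdges R).reachGraph (isClosed_reachGraph _)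
    (SimpleGraph.le_reachGraph _)
  have h3 : (C.link y).support ⊆ {v | ((C.link y).deleteEdges R).Reachable r v} := by
    rw [← hC.left.setOf_reachable_link hr]
    exact fun v hv => SimpleGraph.reachable_of_le_reachGraph h2 hv
  have h4 := Set.ncard_le_ncard h3 (Set.toFinite _)
  rw [SimpleGraph.edgeSet_deleteEdges] at h1
  have h5 := Set.ncard_sdiff_add_ncard_of_subset hR (Set.toFinite _)
  omega

/-- If the part of the graph in the link of `y` has cycle rank at least `k`, then `k` of its edges
are removable. -/
lemma Normal.exists_removable_of_rank [Finite A] (hC : C.Normal) (y : B) (k : ℕ)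
    (h : (C.link y).support.ncard + k ≤ (C.link y).edgeSet.ncard + 1) :
    ∃ R ⊆ C.graph.edgeSet, R.ncard = k ∧ C.Removable R := by
  obtain ⟨r, hr⟩ := link_support_nonempty hC y
  obtain ⟨par, d, T, hT, hTc, hpar, hTe⟩ := (C.link y).exists_spanningTree r
  rw [hC.left.setOf_reachable_link hr] at hTc
  have h1 := Set.ncard_sdiff_add_ncard_of_subset hT (Set.toFinite _)
  obtain ⟨R, hR, hRc⟩ := Set.exists_subset_card_eq (s := (C.link y).edgeSet \ T) (n := k) (by omega)
  have hmono := SimpleGraph.edgeSet_mono (C.link_le_graph y)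
  refine ⟨R, hR.trans (Set.sdiff_subset.trans hmono), hRc, ?_⟩
  intro S hS hle
  -- `R` avoids the tree `T`, so `S` contains `T`, which already connects the link of `y`;
  -- closedness returns all other edges of this link at once.
  have hTS : ∀ v, (C.link y).Reachable r v → (C.link y ⊓ S).Reachable r v := by
    intro v hv
    refine SimpleGraph.reachable_of_spanningTree hpar (fun u hu hur => ?_) hv
    have hmem : s(par u, u) ∈ T := hTe ▸ ⟨u, ⟨hu, hur⟩, rfl⟩
    apply SimpleGraph.Adj.reachable
    refine ⟨hT hmem, hle ?_⟩
    rw [SimpleGraph.deleteEdges_adj]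
    exact ⟨hmono (hT hmem), fun hc => (hR hc).2 hmem⟩
  intro u u' huu
  by_cases hc : s(u, u') ∈ R
  · have huy : (C.link y).Adj u u' := (hR hc).1
    have hu : (C.link y).Reachable r u :=
      hC.left.link_reachable y r u hr ((SimpleGraph.mem_support _).2 ⟨u', huy⟩)
    exact hS y u u' huy ((hTS u hu).symm.trans (hTS u' (hu.trans huy.reachable)))
  · exact hle (by rw [SimpleGraph.deleteEdges_adj]; exact ⟨huu, hc⟩)

/-- Three edges that form a triangular system with three edge links are removable. -/
lemma HalfNormal.removable_of_triangular [Finite A] (hC : C.HalfNormal) {x₁ x₁' x₂ x₂' x₃ x₃' : A}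
    {y₁ y₁' y₂ y₂' y₃ y₃' : B} (h₁ : C.Fac x₁ x₁' y₁ y₁') (h₂ : C.Fac x₂ x₂' y₂ y₂')
    (h₃ : C.Fac x₃ x₃' y₃ y₃') (h₁₂ : ¬ C.Fac x₁ x₁' y₂ y₂') (h₁₃ : ¬ C.Fac x₁ x₁' y₃ y₃')
    (h₂₃ : ¬ C.Fac x₂ x₂' y₃ y₃') :
    ∃ R ⊆ C.graph.edgeSet, R.ncard = 3 ∧ C.Removable R := by
  have hne : ∀ {x x' z z' : A} {y y' : B}, C.Fac x x' y y' → ¬ C.Fac z z' y y' →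
      s(z, z') ≠ s(x, x') := by
    intro x x' z z' y y' h h' he
    rcases Sym2.eq_iff.1 he with ⟨rfl, rfl⟩ | ⟨rfl, rfl⟩
    · exact h' h
    · exact h' (C.swapA h)
  refine ⟨{s(x₁, x₁'), s(x₂, x₂'), s(x₃, x₃')}, ?_, ?_, ?_⟩
  · rintro _ (rfl | rfl | rfl)
    exacts [⟨_, _, h₁⟩, ⟨_, _, h₂⟩, ⟨_, _, h₃⟩]
  · rw [Set.ncard_eq_three]
    exact ⟨_, _, _, hne h₂ h₁₂, hne h₃ h₁₃, hne h₃ h₂₃, rfl⟩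
  · intro S hS hle
    -- The edges are recovered in the order third, second, first: by the three non-incidences, each
    -- cycle contains among the deleted edges only its own and those already recovered.
    have step : ∀ {x x' : A} {y y' : B}, C.Fac x x' y y' →
        (∀ u u', C.Fac u u' y y' → s(u, u') ≠ s(x, x') →
          s(u, u') ∉ ({s(x₁, x₁'), s(x₂, x₂'), s(x₃, x₃')} : Set (Sym2 A)) ∨ S.Adj u u') →
        ∀ u u', s(u, u') = s(x, x') → S.Adj u u' := by
      intro x x' y y' h hh u u' hu
      have : S.Adj x x' := by
        apply hC.adj_of_edgeLink hS h
        intro v v' hv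
        rw [SimpleGraph.deleteEdges_adj] at hv
        rcases hh v v' hv.1 hv.2 with h4 | h4
        · exact hle (by rw [SimpleGraph.deleteEdges_adj]; exact ⟨⟨_, _, hv.1⟩, h4⟩)
        · exact h4
      rcases Sym2.eq_iff.1 hu with ⟨rfl, rfl⟩ | ⟨rfl, rfl⟩
      · exact this
      · exact this.symm
    have e3 := step h₃ (fun u u' hu hn => Or.inl (by
      rintro (h | h | h)
      · exact hne hu h₁₃ h.symm
      · exact hne hu h₂₃ h.symm
      · exact hn h))
    have e2 := step h₂ (fun u u' hu hn => by
      by_cases h : s(u, u') = s(x₃, x₃')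
      · exact Or.inr (e3 u u' h)
      · left
        rintro (h' | h' | h')
        · exact hne hu h₁₂ h'.symm
        · exact hn h'
        · exact h h')
    have e1 := step h₁ (fun u u' hu hn => by
      by_cases h : s(u, u') = s(x₃, x₃')
      · exact Or.inr (e3 u u' h)
      by_cases h'' : s(u, u') = s(x₂, x₂')
      · exact Or.inr (e2 u u' h'')
      left
      rintro (h' | h' | h')
      · exact hn h'
      · exact h'' h'
      · exact h h')
    intro u u' hu
    by_cases hc : s(u, u') ∈ ({s(x₁, x₁'), s(x₂, x₂'), s(x₃, x₃')} : Set (Sym2 A))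
    · rcases hc with h | h | h
      exacts [e1 u u' h, e2 u u' h, e3 u u' h]
    · exact hle (by rw [SimpleGraph.deleteEdges_adj]; exact ⟨hu, hc⟩)

end FacetSystem

lemma SimpleGraph.sum_ncard_neighborSet {V : Type*} [Fintype V] (G : SimpleGraph V) :
    ∑ v, (G.neighborSet v).ncard = 2 * G.edgeSet.ncard := by
  classical
  rw [← SimpleGraph.coe_edgeFinset, Set.ncard_coe_finset, ← G.sum_degrees_eq_twice_card_edges]
  refine Finset.sum_congr rfl fun v _ => ?_
  rw [← SimpleGraph.card_neighborSet_eq_degree, Set.ncard_eq_toFinset_card', Set.toFinset_card]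

namespace FacetSystem
variable {A B : Type*} {C : FacetSystem A B}

-- Each pair of an edge in A and a vertex of its link lies in two facets. Ordered facet tuples count
-- such a pair four times: two orders of the edge and two facets.
open Classical in
lemma Normal.four_mul_sum_link [Fintype A] [Fintype B] (hC : C.Normal) :
    4 * ∑ y, (C.link y).edgeSet.ncard =
      {t : A × A × B × B | C.Fac t.1 t.2.1 t.2.2.1 t.2.2.2}.ncard := by
  have h1 : ∀ y, 2 * (C.link y).edgeSet.ncard
      = ∑ x, ∑ x', if (C.link y).Adj x x' then 1 else 0 := by
    intro y
    rw [← SimpleGraph.sum_ncard_neighborSet]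
    refine Finset.sum_congr rfl fun x _ => ?_
    rw [← Finset.card_filter, ← Set.ncard_coe_finset]
    congr 1
    ext; simp
  have h2 : ∀ x x' y, (∑ y', if C.Fac x x' y y' then 1 else 0)
      = 2 * if (C.link y).Adj x x' then 1 else 0 := by
    intro x x' y
    rw [← Finset.card_filter, ← Set.ncard_coe_finset]
    split_ifs with h
    · obtain ⟨y', h⟩ := h
      rw [mul_one, ← hC.ncard_edgeLink h]
      congr 1
      ext; simp
    · have : Finset.univ.filter (fun y' => C.Fac x x' y y') = ∅ := by
        ext z; simp; exact fun hz => h ⟨z, hz⟩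
      simp [this]
  rw [Set.ncard_eq_toFinset_card', Set.toFinset_ofPred, Finset.card_filter]
  simp only [Fintype.sum_prod_type, h2]
  rw [show 4 = 2 * 2 from rfl, mul_assoc, Finset.mul_sum, Finset.sum_congr rfl (fun y _ => h1 y),
    Finset.sum_comm, Finset.mul_sum]
  refine Finset.sum_congr rfl fun x _ => ?_
  rw [Finset.sum_comm, Finset.mul_sum]
  exact Finset.sum_congr rfl fun x' _ => by rw [Finset.mul_sum]

open Classical in
/-- Summing up the Euler characteristics of the links of the vertices in `B`. -/
lemma Normal.edges_le [Fintype A] [Fintype B] (hC : C.Normal) {p : ℕ}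
    (hp : 4 * p = {t : A × A × B × B | C.Fac t.1 t.2.1 t.2.2.1 t.2.2.2}.ncard) :
    2 * C.swap.graph.edgeSet.ncard + {t : A × B | ∃ x' y', C.Fac t.1 x' t.2 y'}.ncard
      ≤ p + 2 * Fintype.card B := by
  have h1 := Finset.sum_le_sum fun y (_ : y ∈ Finset.univ) => hC.link_euler y
  have h2 : ∑ y, (C.link y).support.ncard = {t : A × B | ∃ x' y', C.Fac t.1 x' t.2 y'}.ncard := by
    rw [Set.ncard_eq_toFinset_card', Set.toFinset_ofPred, Finset.card_filter]
    simp only [Fintype.sum_prod_type]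
    rw [Finset.sum_comm]
    refine Finset.sum_congr rfl fun y _ => ?_
    rw [← Finset.card_filter, ← Set.ncard_coe_finset]
    congr 1
    ext x
    simp [SimpleGraph.mem_support, link]
  rw [Finset.sum_add_distrib, Finset.sum_add_distrib, h2, SimpleGraph.sum_ncard_neighborSet] at h1
  have h3 := hC.four_mul_sum_link
  simp at h1
  omega

/-! ### Generators of a group from a cocycle on the edges -/

/-- The sets of vertices of the facets. -/
def simplices [DecidableEq A] [DecidableEq B] (C : FacetSystem A B) : Set (Finset (A ⊕ B)) :=
  {s | ∃ x x' y y', C.Fac x x' y y' ∧ s = {.inl x, .inl x', .inr y, .inr y'}}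

/-- The group generated by a cocycle on the edges of `C` needs no more generators than the number
of edges outside a removable set which do not belong to a spanning tree. -/
lemma Normal.groupRank_le [Finite A] [DecidableEq A] [DecidableEq B] (hC : C.Normal) {G : Type*}
    [Group G] (r : A) (g : A ⊕ B → A ⊕ B → G)
    (hcoc : ∀ s ∈ C.simplices, ∀ u ∈ s, ∀ v ∈ s, ∀ w ∈ s, g u v * g v w = g u w)
    (hgen : ∀ τ : A ⊕ B → G, τ (.inl r) = 1 →
      Subgroup.closure {h | ∃ s ∈ C.simplices, ∃ u ∈ s, ∃ v ∈ s, h = τ u * g u v * (τ v)⁻¹} = ⊤)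
    {R : Set (Sym2 A)} (hRe : R ⊆ C.graph.edgeSet) (hR : C.Removable R) :
    groupRank G + R.ncard + Nat.card A ≤ C.graph.edgeSet.ncard + 1 := by
  classical
  have hself : ∀ s ∈ C.simplices, ∀ u ∈ s, g u u = 1 := by
    intro s hs u hu
    simpa using hcoc s hs u hu u hu u hu
  set Γ := C.graph.deleteEdges R with hΓ
  -- Removability is used here for connectivity: the graph without `R` is still connected and has a
  -- spanning tree on all of A.
  have hreach : ∀ v, Γ.Reachable r v := by
    have h1 := hR Γ.reachGraph (isClosed_reachGraph _) (SimpleGraph.le_reachGraph _)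
    exact fun v => SimpleGraph.reachable_of_le_reachGraph h1 (hC.left.connected r v)
  obtain ⟨par, d, T, hT, hTc, hpar, hTe⟩ := Γ.exists_spanningTree r
  have hall : {v | Γ.Reachable r v} = Set.univ := by ext v; simp [hreach v]
  rw [hall, Set.ncard_univ] at hTc
  -- the gauge that is trivial on the spanning tree
  let aux : ℕ → A → G := fun n => Nat.rec (fun _ => 1)
    (fun _ f v => if v = r then 1 else f (par v) * g (.inl (par v)) (.inl v)) n
  have haux : ∀ n v, d v ≤ n → aux (n + 1) v = aux n v := by
    intro n
    induction n with
    | zero =>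
      intro v hv
      have : v = r := by
        by_contra hc
        have := (hpar v (hreach v) hc).1
        omega
      simp [aux, this]
    | succ n ih =>
      intro v hv
      by_cases hvr : v = r
      · simp [aux, hvr]
      · have := (hpar v (hreach v) hvr).1
        have h2 := ih (par v) (by omega)
        change (if v = r then 1 else aux (n + 1) (par v) * _) =
          (if v = r then 1 else aux n (par v) * _)
        rw [h2]
  let τA : A → G := fun v => aux (d v + 1) v
  have hτr : τA r = 1 := by simp [τA, aux]
  have hτ : ∀ v, v ≠ r → τA v = τA (par v) * g (.inl (par v)) (.inl v) := by
    intro v hv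
    have := (hpar v (hreach v) hv).1
    have h2 : τA v = aux (d v) (par v) * g (.inl (par v)) (.inl v) := by
      simp [τA, aux, hv]
    rw [h2, this]
  -- Each vertex `y` gets a base vertex `β y` in its link, and `τ` is chosen to make the cocycle
  -- trivial on the edge from `β y` to `y`. No generators are spent on B.
  have hcB : ∀ y, ∃ x, x ∈ (C.link y).support := fun y => link_support_nonempty hC y
  choose β hβ using hcB
  let τ : A ⊕ B → G := Sum.elim τA fun y => τA (β y) * g (.inl (β y)) (.inr y)
  let γ : A ⊕ B → A ⊕ B → G := fun u v => τ u * g u v * (τ v)⁻¹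
  -- one generator per edge outside the tree
  let pick : Sym2 A → G := fun e => γ (.inl e.out.1) (.inl e.out.2)
  set Sgen : Set G := pick '' (Γ.edgeSet \ T) with hSgen
  let H := Subgroup.closure Sgen
  have hγcoc : ∀ s ∈ C.simplices, ∀ u ∈ s, ∀ v ∈ s, ∀ w ∈ s, γ u v * γ v w = γ u w := by
    intro s hs u hu v hv w hw
    simp only [γ]
    rw [← hcoc s hs u hu v hv w hw]
    group
  have hγself : ∀ s ∈ C.simplices, ∀ u ∈ s, γ u u = 1 := by
    intro s hs u hu
    simp [γ, hself s hs u hu]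
  have hmem : ∀ {x x' y y'}, C.Fac x x' y y' → ∃ s ∈ C.simplices, Sum.inl x ∈ s ∧
      Sum.inl x' ∈ s ∧ Sum.inr y ∈ s ∧ Sum.inr y' ∈ s := by
    intro x x' y y' h
    exact ⟨_, ⟨x, x', y, y', h, rfl⟩, by simp, by simp, by simp, by simp⟩
  have hsymm : ∀ s ∈ C.simplices, ∀ u ∈ s, ∀ v ∈ s, γ u v ∈ H → γ v u ∈ H := by
    intro s hs u hu v hv h
    have : γ v u = (γ u v)⁻¹ := by
      rw [eq_inv_iff_mul_eq_one, hγcoc s hs v hv u hu v hv, hγself s hs v hv]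
    rw [this]
    exact H.inv_mem h
  -- These are the edges whose value already lies in `H`. They form a closed set containing the
  -- graph without `R`, so removability puts every edge of the graph in it.
  let S : SimpleGraph A :=
    { Adj := fun u v => C.graph.Adj u v ∧ γ (.inl u) (.inl v) ∈ H
      symm := ⟨fun u v ⟨h, h'⟩ => ⟨h.symm, by
        obtain ⟨y, y', hf⟩ := h
        obtain ⟨s, hs, h1, h2, -, -⟩ := hmem hf
        exact hsymm s hs _ h1 _ h2 h'⟩⟩
      loopless := ⟨fun u h => h.1.ne rfl⟩ }
  -- transport through the link of a vertex in `B`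
  have hlink : ∀ y x x', (C.link y ⊓ S).Reachable x x' → x ∈ (C.link y).support →
      γ (.inl x) (.inr y) * γ (.inr y) (.inl x') ∈ H := by
    intro y x x' ⟨p⟩ hx
    induction p with
    | @nil u =>
      obtain ⟨x', y', hf⟩ := (SimpleGraph.mem_support _).1 hx
      obtain ⟨s, hs, h1, -, h2, -⟩ := hmem hf
      rw [hγcoc s hs _ h1 _ h2 _ h1, hγself s hs _ h1]
      exact H.one_mem
    | @cons u v w hadj q ih =>
      obtain ⟨⟨y', hf⟩, hS⟩ := hadj
      obtain ⟨s, hs, h1, h2, h3, -⟩ := hmem hf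
      have h4 := ih ((SimpleGraph.mem_support _).2 ⟨u, y', C.swapA hf⟩)
      have h5 : γ (.inl u) (.inr y) * γ (.inr y) (.inl w)
          = γ (.inl u) (.inl v) * (γ (.inl v) (.inr y) * γ (.inr y) (.inl w)) := by
        rw [← hγcoc s hs _ h1 _ h2 _ h3, mul_assoc]
      rw [h5]
      exact H.mul_mem hS.2 h4
  have hSclosed : C.IsClosed S := by
    intro y x x' hadj hre
    refine ⟨C.link_le_graph y hadj, ?_⟩
    have h1 := hlink y x x' hre ((SimpleGraph.mem_support _).2 ⟨x', hadj⟩)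
    obtain ⟨y', hf⟩ := hadj
    obtain ⟨s, hs, h2, h3, h4, -⟩ := hmem hf
    rwa [hγcoc s hs _ h2 _ h4 _ h3] at h1
  have hΓS : Γ ≤ S := by
    intro u v huv
    have hadj : C.graph.Adj u v := SimpleGraph.deleteEdges_le _ huv
    refine ⟨hadj, ?_⟩
    obtain ⟨y, y', hf⟩ := hadj
    obtain ⟨s, hs, h1, h2, -, -⟩ := hmem hf
    by_cases huvT : s(u, v) ∈ T
    · rw [hTe] at huvT
      obtain ⟨a, ⟨-, har⟩, hae⟩ := huvT
      have h3 : γ (.inl (par a)) (.inl a) = 1 := by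
        simp only [γ, τ, Sum.elim_inl]
        rw [hτ a har]
        group
      rcases Sym2.eq_iff.1 hae with ⟨rfl, rfl⟩ | ⟨rfl, rfl⟩
      · rw [h3]; exact H.one_mem
      · exact hsymm s hs _ h2 _ h1 (by rw [h3]; exact H.one_mem)
    · have h3 : pick s(u, v) ∈ H := Subgroup.subset_closure ⟨_, ⟨huv, huvT⟩, rfl⟩
      have h4 : s((s(u, v) : Sym2 A).out.1, (s(u, v) : Sym2 A).out.2) = s(u, v) := Quot.out_eq _
      rcases Sym2.eq_iff.1 h4 with ⟨h5, h6⟩ | ⟨h5, h6⟩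
      · simp only [pick, h5, h6] at h3; exact h3
      · simp only [pick, h5, h6] at h3; exact hsymm s hs _ h2 _ h1 h3
  have hall := hR S hSclosed hΓS
  have hAB : ∀ x y, x ∈ (C.link y).support → γ (.inl x) (.inr y) ∈ H := by
    intro x y hx
    have h1 : γ (.inl (β y)) (.inr y) = 1 := by simp [γ, τ]
    have h2 : (C.link y ⊓ S).Reachable x (β y) :=
      (hC.left.link_reachable y x (β y) hx (hβ y)).mono
        (le_inf le_rfl ((C.link_le_graph y).trans hall))
    have h3 := hlink y x (β y) h2 hx
    obtain ⟨x', y', hf⟩ := (SimpleGraph.mem_support _).1 (hβ y)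
    obtain ⟨s, hs, h4, -, h5, -⟩ := hmem hf
    have h6 : γ (.inr y) (.inl (β y)) = 1 := by
      have := hγcoc s hs _ h4 _ h5 _ h4
      rwa [h1, one_mul, hγself s hs _ h4] at this
    rwa [h6, mul_one] at h3
  have htop : H = ⊤ := by
    rw [eq_top_iff, ← hgen τ (by simp [τ, hτr]), Subgroup.closure_le]
    rintro _ ⟨s, hs, u, hu, v, hv, rfl⟩
    have hs' := hs
    obtain ⟨x, x', y, y', hf, rfl⟩ := hs
    have key : ∀ z ∈ ({.inl x, .inl x', .inr y, .inr y'} : Finset (A ⊕ B)),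
        γ (.inl x) z ∈ H := by
      intro z hz
      simp only [Finset.mem_insert, Finset.mem_singleton] at hz
      rcases hz with rfl | rfl | rfl | rfl
      · rw [hγself _ hs' _ (by simp)]; exact H.one_mem
      · exact (hall ⟨y, y', hf⟩).2
      · exact hAB x y ((SimpleGraph.mem_support _).2 ⟨x', y', hf⟩)
      · exact hAB x y' ((SimpleGraph.mem_support _).2 ⟨x', y, C.swapB hf⟩)
    change γ u v ∈ H
    rw [← hγcoc _ hs' u hu (.inl x) (by simp) v hv]
    exact H.mul_mem (hsymm _ hs' _ (by simp) _ hu (key u hu)) (key v hv)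
  have h1 : groupRank G ≤ Sgen.encard := iInf_le_of_le ⟨Sgen, htop⟩ le_rfl
  have hfin : Sgen.Finite := Set.toFinite _
  rw [← hfin.cast_ncard_eq] at h1
  have h2 : Sgen.ncard ≤ (Γ.edgeSet \ T).ncard := Set.ncard_image_le (Set.toFinite _)
  have h3 := Set.ncard_sdiff_add_ncard_of_subset hT (Set.toFinite _)
  have h4 := Set.ncard_sdiff_add_ncard_of_subset hRe (Set.toFinite _)
  rw [hΓ, SimpleGraph.edgeSet_deleteEdges] at h3
  have h5 : Sgen.ncard + R.ncard + Nat.card A ≤ C.graph.edgeSet.ncard + 1 := by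
    rw [hΓ, SimpleGraph.edgeSet_deleteEdges] at h2
    omega
  calc groupRank G + R.ncard + Nat.card A ≤ (Sgen.ncard : ℕ∞) + R.ncard + Nat.card A := by gcongr
    _ ≤ _ := by exact_mod_cast h5

end FacetSystem

/-! ### The fundamental group of a realization -/

section

open CategoryTheory unitInterval

lemma groupRank_le_of_mulEquiv {G H : Type*} [Group G] [Group H] (e : G ≃* H) :
    groupRank H ≤ groupRank G := by
  refine le_iInf fun S => ?_
  refine iInf_le_of_le ⟨e '' S, ?_⟩ (Set.encard_image_le _ _)
  have := (e.toMonoidHom.map_closure S.1).symm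
  rw [S.2, ← MonoidHom.range_eq_map, MonoidHom.range_eq_top.2 e.surjective] at this
  exact this

lemma groupRank_congr {G H : Type*} [Group G] [Group H] (e : G ≃* H) :
    groupRank G = groupRank H :=
  (groupRank_le_of_mulEquiv e.symm).antisymm (groupRank_le_of_mulEquiv e)

lemma groupRank_fundamentalGroup_congr {X Y : Type*} [TopologicalSpace X] [TopologicalSpace Y]
    [PathConnectedSpace X] (e : X ≃ₜ Y) (x : X) (y : Y) :
    groupRank (FundamentalGroup X x) = groupRank (FundamentalGroup Y y) := by
  have : PathConnectedSpace Y := e.surjective.pathConnectedSpace e.continuous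
  let E := FundamentalGroupoidFunctor.equivOfHomotopyEquiv e.toHomotopyEquiv
  let f : FundamentalGroup X x ≃* FundamentalGroup Y (E.functor.obj (FundamentalGroupoid.mk x)).as :=
    E.fullyFaithfulFunctor.mulEquivEnd (FundamentalGroupoid.mk x)
  exact groupRank_congr
    (f.trans (FundamentalGroup.fundamentalGroupMulEquivOfPathConnected _ _))

/-- Induction along a path that is cut into pieces subordinate to an open cover. -/
lemma Path.induction_of_openCover {X ι : Type*} [TopologicalSpace X] {U : ι → Set X}
    (hU : ∀ i, IsOpen (U i)) (hcov : ∀ x, ∃ i, x ∈ U i)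
    {P : ∀ x y : X, (FundamentalGroupoid.mk x ⟶ FundamentalGroupoid.mk y) → Prop}
    (hloc : ∀ i x y (γ : Path x y), (∀ t, γ t ∈ U i) → P x y (Path.Homotopic.Quotient.mk γ))
    (htrans : ∀ x y z p q, P x y p → P y z q → P x z (p ≫ q)) {x y : X} (γ : Path x y) :
    P x y (Path.Homotopic.Quotient.mk γ) := by
  obtain ⟨t, ht0, hmono, ⟨n, hn⟩, ht⟩ := exists_monotone_Icc_subset_open_cover_unitInterval
    (c := fun i => γ ⁻¹' U i) (fun i => (hU i).preimage γ.continuous)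
    (fun s _ => Set.mem_iUnion.2 (hcov (γ s)))
  -- The Lebesgue subdivision is traversed piece by piece; a subpath from `t 0` to `t (m + 1)` is
  -- homotopic to the concatenation at `t m`.
  have key : ∀ m, P _ _ (Path.Homotopic.Quotient.mk (γ.subpath (t 0) (t m))) := by
    intro m
    induction m with
    | zero =>
      obtain ⟨i, hi⟩ := hcov (γ (t 0))
      exact hloc i _ _ _ fun s => by simpa using hi
    | succ m ih =>
      obtain ⟨i, hi⟩ := ht m
      have h1 : P _ _ (Path.Homotopic.Quotient.mk (γ.subpath (t m) (t (m + 1)))) := by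
        refine hloc i _ _ _ fun s => ?_
        have : γ.subpath (t m) (t (m + 1)) s ∈ Set.range (γ.subpath (t m) (t (m + 1))) := ⟨s, rfl⟩
        rw [Path.range_subpath_of_le _ _ _ (hmono m.le_succ)] at this
        obtain ⟨s', hs', h⟩ := this
        rw [← h]
        exact hi hs'
      have h2 := htrans _ _ _ _ _ ih h1
      have h3 : Path.Homotopic.Quotient.mk (γ.subpath (t 0) (t (m + 1))) =
          (Path.Homotopic.Quotient.mk (γ.subpath (t 0) (t m))).trans
            (Path.Homotopic.Quotient.mk (γ.subpath (t m) (t (m + 1)))) := by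
        rw [← Path.Homotopic.Quotient.mk_trans, Path.Homotopic.Quotient.eq]
        exact ⟨(Path.Homotopy.subpathTransSubpath γ _ _ _).symm⟩
      rw [h3]
      exact h2
  have h1 := key n
  rw [ht0, hn n le_rfl, Path.subpath_zero_one] at h1
  have hcast : ∀ {a b a' b' : X} (δ : Path a b) (ha : a' = a) (hb : b' = b),
      P a' b' (Path.Homotopic.Quotient.mk (δ.cast ha hb)) →
        P a b (Path.Homotopic.Quotient.mk δ) := by
    rintro a b a' b' δ rfl rfl h
    exact h
  exact hcast γ γ.source γ.target h1

/-- Two paths in a star convex subset of `X` with the same endpoints are homotopic in `X`. -/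
lemma Path.homotopic_of_starConvex {E : Type*} [AddCommGroup E] [Module ℝ E] [TopologicalSpace E]
    [ContinuousAdd E] [ContinuousSMul ℝ E] {X S : Set E} (hSX : S ⊆ X) {c : E}
    (hS : StarConvex ℝ c S) {x y : X} (p q : Path x y) (hp : ∀ t, (p t : E) ∈ S)
    (hq : ∀ t, (q t : E) ∈ S) : p.Homotopic q := by
  have hx : (x : E) ∈ S := by simpa using hp 0
  have hy : (y : E) ∈ S := by simpa using hp 1
  have := hS.contractibleSpace ⟨x, hx⟩
  let lift : ∀ r : Path x y, (∀ t, (r t : E) ∈ S) → Path (⟨x, hx⟩ : S) ⟨y, hy⟩ := fun r hr =>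
    { toFun := fun t => ⟨r t, hr t⟩
      continuous_toFun := by fun_prop
      source' := by simp
      target' := by simp }
  have h1 := SimplyConnectedSpace.paths_homotopic (lift p hp) (lift q hq)
  exact h1.map ⟨Set.inclusion hSX, continuous_inclusion hSX⟩

section Realization

variable {V : Type*} [Fintype V]

/-- The standard simplex on the vertices in `s`. -/
def cell (s : Finset V) : Set (V → ℝ) :=
  {b | (∀ v, 0 ≤ b v) ∧ ∑ v, b v = 1 ∧ ∀ v, b v ≠ 0 → v ∈ s}

/-- The geometric realization of the complex whose facets are the sets in `F`. -/
def Realization (F : Set (Finset V)) : Set (V → ℝ) := ⋃ s ∈ F, cell s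

variable {F : Set (Finset V)}

lemma mem_realization {b : V → ℝ} : b ∈ Realization F ↔ ∃ s ∈ F, b ∈ cell s := by
  simp [Realization]

lemma cell_subset {s : Finset V} (hs : s ∈ F) : cell s ⊆ Realization F :=
  Set.subset_biUnion_of_mem hs

lemma convex_cell (s : Finset V) : Convex ℝ (cell s) := by
  rintro b ⟨h1, h2, h3⟩ c ⟨h4, h5, h6⟩ α β hα hβ hαβ
  refine ⟨fun v => ?_, ?_, fun v hv => ?_⟩
  · have := mul_nonneg hα (h1 v)
    have := mul_nonneg hβ (h4 v)
    simp; linarith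
  · simp [Finset.sum_add_distrib, ← Finset.mul_sum, h2, h5, hαβ]
  · by_contra hc
    have hb : b v = 0 := by by_contra h; exact hc (h3 v h)
    have hc' : c v = 0 := by by_contra h; exact hc (h6 v h)
    exact hv (by simp [hb, hc'])

lemma single_mem_cell [DecidableEq V] {s : Finset V} {v : V} (hv : v ∈ s) : (Pi.single v 1 : V → ℝ) ∈ cell s := by
  refine ⟨fun w => ?_, by simp, fun w hw => ?_⟩
  · by_cases h : w = v
    · subst h; simp
    · simp [h]
  · by_contra h
    exact hw (by rw [Pi.single_eq_of_ne]; rintro rfl; exact h hv)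

/-- The union of the simplices that contain `v`. -/
def closedStar (F : Set (Finset V)) (v : V) : Set (V → ℝ) := ⋃ s ∈ {s ∈ F | v ∈ s}, cell s

lemma starConvex_closedStar [DecidableEq V] (F : Set (Finset V)) (v : V) :
    StarConvex ℝ (Pi.single v 1) (closedStar F v) := by
  refine starConvex_iUnion fun s => starConvex_iUnion fun hs => ?_
  exact (convex_cell s).starConvex (single_mem_cell hs.2)

lemma closedStar_subset (F : Set (Finset V)) (v : V) : closedStar F v ⊆ Realization F := by
  refine Set.iUnion₂_subset fun s hs => cell_subset hs.1

/-- A path in a simplex of the realization. -/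
lemma exists_path_in_cell {s : Finset V} (hs : s ∈ F) {x y : Realization F}
    (hx : (x : V → ℝ) ∈ cell s) (hy : (y : V → ℝ) ∈ cell s) :
    ∃ p : Path x y, ∀ t, (p t : V → ℝ) ∈ cell s := by
  have h := convex_cell s
  have hmem : ∀ t : I, AffineMap.lineMap (x : V → ℝ) y (t : ℝ) ∈ cell s := fun t =>
    h.segment_subset hx hy (by rw [segment_eq_image_lineMap]; exact ⟨t, t.2, rfl⟩)
  refine ⟨{ toFun := fun t => ⟨AffineMap.lineMap (x : V → ℝ) y (t : ℝ), cell_subset hs (hmem t)⟩,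
            continuous_toFun := ?_, source' := by simp, target' := by simp }, hmem⟩
  refine Continuous.subtype_mk ?_ _
  simp only [AffineMap.lineMap_apply_module]
  fun_prop

/-- The fundamental group of a realization is generated by its edges, in the form of a cocycle
whose gauge transforms all generate. -/
lemma exists_generating_cocycle [DecidableEq V] (hcov : ∀ v, ∃ s ∈ F, v ∈ s) (v₀ : V)
    (h₀ : Pi.single v₀ 1 ∈ Realization F) [PathConnectedSpace (Realization F)] :
    ∃ g : V → V → FundamentalGroup (Realization F) ⟨Pi.single v₀ 1, h₀⟩,
      (∀ s ∈ F, ∀ u ∈ s, ∀ v ∈ s, ∀ w ∈ s, g u v * g v w = g u w) ∧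
      ∀ τ : V → FundamentalGroup (Realization F) ⟨Pi.single v₀ 1, h₀⟩, τ v₀ = 1 →
        Subgroup.closure {h | ∃ s ∈ F, ∃ u ∈ s, ∃ v ∈ s, h = τ u * g u v * (τ v)⁻¹} = ⊤ := by
  let X := Realization F
  have hpt : ∀ v, (Pi.single v 1 : V → ℝ) ∈ X := fun v => by
    obtain ⟨s, hs, hv⟩ := hcov v
    exact cell_subset hs (single_mem_cell hv)
  let o : V → FundamentalGroupoid X := fun v => ⟨⟨Pi.single v 1, hpt v⟩⟩
  let β' : ∀ v, o v₀ ⟶ o v := fun v =>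
    Path.Homotopic.Quotient.mk (PathConnectedSpace.somePath (o v₀).as (o v).as)
  -- The correction at `v₀` makes the connecting path of the base vertex trivial, matching the
  -- normalisation `τ v₀ = 1`.
  let β : ∀ v, o v₀ ⟶ o v := fun v => Groupoid.inv (β' v₀) ≫ β' v
  have hβ₀ : β v₀ = 𝟙 _ := by simp [β]
  -- Multiplication in the fundamental group reverses composition of arrows; the inverse restores
  -- the order.
  let Λ : ∀ {u v}, (o u ⟶ o v) → FundamentalGroup X (o v₀).as := fun {u v} c =>
    (show FundamentalGroup X (o v₀).as from β u ≫ c ≫ Groupoid.inv (β v))⁻¹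
  have hΛ : ∀ {u v w} (c : o u ⟶ o v) (c' : o v ⟶ o w), Λ (c ≫ c') = Λ c * Λ c' := by
    intro u v w c c'
    simp only [Λ]
    rw [← mul_inv_rev]
    congr 1
    change β u ≫ (c ≫ c') ≫ _ = (β u ≫ c ≫ _) ≫ (β v ≫ c' ≫ _)
    simp
  -- The path is taken in the simplex on `u` and `v` alone, so that one choice works in every facet
  -- containing both. For pairs in no common facet the value is immaterial.
  have hseg : ∀ u v, ∃ c : o u ⟶ o v, ∀ s ∈ F, u ∈ s → v ∈ s →
      ∃ p : Path (o u).as (o v).as, (∀ t, (p t : V → ℝ) ∈ cell s) ∧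
        c = Path.Homotopic.Quotient.mk p := by
    intro u v
    by_cases h : ∃ s ∈ F, u ∈ s ∧ v ∈ s
    · obtain ⟨s, hs, hu, hv⟩ := h
      have hs' : ({u, v} : Finset V) ⊆ s := by
        intro w hw
        simp only [Finset.mem_insert, Finset.mem_singleton] at hw
        rcases hw with rfl | rfl <;> assumption
      have hmono : ∀ {t t' : Finset V}, t ⊆ t' → cell t ⊆ cell t' :=
        fun h b hb => ⟨hb.1, hb.2.1, fun v hv => h (hb.2.2 v hv)⟩
      let X' := Realization ({{u, v}} : Set (Finset V))
      have hXX : X' ⊆ X := by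
        intro b hb
        obtain ⟨t, ht, hb⟩ := mem_realization.1 hb
        rw [Set.mem_singleton_iff] at ht
        subst ht
        exact cell_subset hs (hmono hs' hb)
      have hu' : (Pi.single u 1 : V → ℝ) ∈ cell {u, v} := single_mem_cell (by simp)
      have hv' : (Pi.single v 1 : V → ℝ) ∈ cell {u, v} := single_mem_cell (by simp)
      obtain ⟨p, hp⟩ := exists_path_in_cell (F := {{u, v}}) (s := {u, v}) rfl
        (x := ⟨Pi.single u 1, cell_subset (Set.mem_singleton _) hu'⟩)
        (y := ⟨Pi.single v 1, cell_subset (Set.mem_singleton _) hv'⟩) hu' hv'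
      refine ⟨Path.Homotopic.Quotient.mk (p.map (continuous_inclusion hXX)),
        fun t ht hut hvt => ⟨_, fun τ => ?_, rfl⟩⟩
      refine hmono ?_ (hp τ)
      intro w hw
      simp only [Finset.mem_insert, Finset.mem_singleton] at hw
      rcases hw with rfl | rfl <;> assumption
    · exact ⟨Groupoid.inv (β u) ≫ β v, fun s hs hu hv => absurd ⟨s, hs, hu, hv⟩ h⟩
  choose E hE using hseg
  -- paths in a simplex are determined by their endpoints
  have huniq : ∀ s ∈ F, ∀ {x y : X} (p q : Path x y), (∀ t, (p t : V → ℝ) ∈ cell s) →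
      (∀ t, (q t : V → ℝ) ∈ cell s) → p.Homotopic q := by
    intro s hs x y p q hp hq
    exact Path.homotopic_of_starConvex (cell_subset hs) ((convex_cell s).starConvex (hp 0)) p q hp hq
  have htr : ∀ {S : Set (V → ℝ)} {x y z : X} (p : Path x y) (q : Path y z),
      (∀ t, (p t : V → ℝ) ∈ S) → (∀ t, (q t : V → ℝ) ∈ S) → ∀ t, (p.trans q t : V → ℝ) ∈ S := by
    intro S x y z p q hp hq t
    have : p.trans q t ∈ Set.range (p.trans q) := ⟨t, rfl⟩
    rw [Path.trans_range] at this
    rcases this with ⟨t', h⟩ | ⟨t', h⟩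
    · rw [← h]; exact hp t'
    · rw [← h]; exact hq t'
  have hEcoc : ∀ s ∈ F, ∀ u ∈ s, ∀ v ∈ s, ∀ w ∈ s, E u v ≫ E v w = E u w := by
    intro s hs u hu v hv w hw
    obtain ⟨p, hp, h1⟩ := hE u v s hs hu hv
    obtain ⟨q, hq, h2⟩ := hE v w s hs hv hw
    obtain ⟨r, hr, h3⟩ := hE u w s hs hu hw
    rw [h1, h2, h3]
    exact Path.Homotopic.Quotient.eq.2 (huniq s hs _ _ (htr p q hp hq) hr)
  refine ⟨fun u v => Λ (E u v), fun s hs u hu v hv w hw => ?_, fun τ hτ => ?_⟩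
  · rw [← hΛ, hEcoc s hs u hu v hv w hw]
  set H := Subgroup.closure {h | ∃ s ∈ F, ∃ u ∈ s, ∃ v ∈ s, h = τ u * Λ (E u v) * (τ v)⁻¹} with hH
  have hgen : ∀ s ∈ F, ∀ u ∈ s, ∀ v ∈ s, τ u * Λ (E u v) * (τ v)⁻¹ ∈ H := fun s hs u hu v hv =>
    Subgroup.subset_closure ⟨s, hs, u, hu, v, hv, rfl⟩
  -- The intermediate points of a path need not be vertices. Quantifying over all tails inside a
  -- simplex, from a vertex to `x` and from `y` to a vertex, makes the property compatible with
  -- concatenation.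
  let P : ∀ x y : X, (FundamentalGroupoid.mk x ⟶ FundamentalGroupoid.mk y) → Prop :=
    fun x y c => ∀ u w, ∀ s ∈ F, ∀ s' ∈ F, u ∈ s → w ∈ s' →
      ∀ (α : Path (o u).as x) (δ : Path y (o w).as), (∀ t, (α t : V → ℝ) ∈ cell s) →
        (∀ t, (δ t : V → ℝ) ∈ cell s') →
        τ u * Λ (Path.Homotopic.Quotient.mk α ≫ c ≫ Path.Homotopic.Quotient.mk δ) * (τ w)⁻¹ ∈ H
  have hP : ∀ {x y : X} (γ : Path x y), P x y (Path.Homotopic.Quotient.mk γ) := by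
    intro x y γ
    refine Path.induction_of_openCover (U := fun v => {b : X | 0 < (b : V → ℝ) v})
      (fun v => ?_) (fun x => ?_) (fun v x y γ hγ => ?_) (fun x y z p q hp hq => ?_) γ
    · exact isOpen_lt continuous_const ((continuous_apply v).comp continuous_subtype_val)
    · obtain ⟨s, hs, h1, h2, h3⟩ := mem_realization.1 x.2
      by_contra hcon
      simp only [Set.mem_ofPred_eq, not_exists, not_lt] at hcon
      have : ∑ v, (x : V → ℝ) v ≤ 0 := Finset.sum_nonpos fun v _ => hcon v
      linarith
    · intro u w s hs s' hs' hu hw α δ hα hδ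
      have hxs : (x : V → ℝ) ∈ cell s := by simpa using hα 1
      have hys : (y : V → ℝ) ∈ cell s' := by simpa using hδ 0
      have hvs : v ∈ s := hxs.2.2 v (by have := hγ 0; simp at this; exact this.ne')
      have hvs' : v ∈ s' := hys.2.2 v (by have := hγ 1; simp at this; exact this.ne')
      -- The piece stays in the open star of `v`, and both tails lie in simplices containing `v`. As
      -- the closed star is star convex, the path can be replaced by the two edges `u v` and `v w`.
      have hγS : ∀ t, (γ t : V → ℝ) ∈ closedStar F v := by
        intro t
        obtain ⟨r, hr, h⟩ := mem_realization.1 (γ t).2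
        exact Set.mem_biUnion (show r ∈ {s ∈ F | v ∈ s} from ⟨hr, h.2.2 v (hγ t).ne'⟩) h
      have hcS : ∀ r ∈ F, v ∈ r → cell r ⊆ closedStar F v := fun r hr hv =>
        Set.subset_biUnion_of_mem (u := cell) (show r ∈ {s ∈ F | v ∈ s} from ⟨hr, hv⟩)
      obtain ⟨p, hp, h1⟩ := hE u v s hs hu hvs
      obtain ⟨q, hq, h2⟩ := hE v w s' hs' hvs' hw
      have h3 : Path.Homotopic.Quotient.mk (α.trans (γ.trans δ)) =
          Path.Homotopic.Quotient.mk (p.trans q) := by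
        refine Path.Homotopic.Quotient.eq.2 (Path.homotopic_of_starConvex
          (closedStar_subset F v) (starConvex_closedStar F v) _ _ ?_ ?_)
        · exact htr _ _ (fun t => hcS s hs hvs (hα t))
            (htr _ _ hγS (fun t => hcS s' hs' hvs' (hδ t)))
        · exact htr _ _ (fun t => hcS s hs hvs (hp t)) (fun t => hcS s' hs' hvs' (hq t))
      change τ u * Λ (u := u) (v := w) (Path.Homotopic.Quotient.mk (α.trans (γ.trans δ))) * _ ∈ H
      rw [h3]
      change τ u * Λ (u := u) (v := w) (Path.Homotopic.Quotient.mk p ≫ Path.Homotopic.Quotient.mk q) * _ ∈ H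
      rw [← h1, ← h2, hΛ]
      have := H.mul_mem (hgen s hs u hu v hvs) (hgen s' hs' v hvs' w hw)
      convert this using 1
      group
    · intro u w s hs s' hs' hu hw α δ hα hδ
      obtain ⟨r, hr, hyr⟩ := mem_realization.1 y.2
      obtain ⟨v, hv⟩ : ∃ v, (y : V → ℝ) v ≠ 0 := by
        by_contra hcon
        push Not at hcon
        have := hyr.2.1
        simp [hcon] at this
      have hvr := hyr.2.2 v hv
      -- A detour from the division point to a vertex of its simplex and back cancels in the
      -- product.
      obtain ⟨ε, hε⟩ := exists_path_in_cell hr (x := (o v).as) (y := y) (single_mem_cell hvr) hyr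
      have h1 := hp u v s hs r hr hu hvr α ε.symm hα (fun t => hε _)
      have h2 := hq v w r hr s' hs' hvr hw ε δ hε hδ
      have h3 := H.mul_mem h1 h2
      have h4 : Λ (u := u) (v := w) (Path.Homotopic.Quotient.mk α ≫ (p ≫ q) ≫ Path.Homotopic.Quotient.mk δ) =
          Λ (u := u) (v := v) (Path.Homotopic.Quotient.mk α ≫ p ≫ Path.Homotopic.Quotient.mk ε.symm) *
          Λ (u := v) (v := w) (Path.Homotopic.Quotient.mk ε ≫ q ≫ Path.Homotopic.Quotient.mk δ) := by
        rw [← hΛ]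
        congr 1
        have h5 : (show FundamentalGroupoid.mk y ⟶ o v from Path.Homotopic.Quotient.mk ε.symm) ≫
            (show o v ⟶ FundamentalGroupoid.mk y from Path.Homotopic.Quotient.mk ε) = 𝟙 _ :=
          Groupoid.inv_comp (show o v ⟶ FundamentalGroupoid.mk y from
            Path.Homotopic.Quotient.mk ε)
        simp only [Category.assoc]
        rw [reassoc_of% h5]
      rw [h4]
      convert h3 using 1
      group
  rw [eq_top_iff]
  rintro c -
  obtain ⟨s, hs, hv⟩ := hcov v₀
  obtain ⟨γ, hγ⟩ := Path.Homotopic.Quotient.mk_surjective (c⁻¹ : FundamentalGroup X (o v₀).as)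
  have h1 := hP γ v₀ v₀ s hs s hs hv hv (Path.refl _) (Path.refl _)
    (fun _ => single_mem_cell hv) (fun _ => single_mem_cell hv)
  have h2 : Λ (u := v₀) (v := v₀) (Path.Homotopic.Quotient.mk (Path.refl _) ≫
      Path.Homotopic.Quotient.mk γ ≫ Path.Homotopic.Quotient.mk (Path.refl _)) = c := by
    simp only [Λ]
    rw [inv_eq_iff_eq_inv, ← hγ, hβ₀]
    change 𝟙 (o v₀) ≫ (𝟙 (o v₀) ≫ (show o v₀ ⟶ o v₀ from Path.Homotopic.Quotient.mk γ) ≫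
      𝟙 (o v₀)) ≫ Groupoid.inv (𝟙 (o v₀)) = Path.Homotopic.Quotient.mk γ
    simp
  rwa [h2, hτ, inv_one, one_mul, mul_one] at h1

end Realization

end

/-! ### Geometric complexes as realizations -/

section Realization

variable {V : Type*} [Fintype V]

lemma isCompact_cell (s : Finset V) : IsCompact (cell s) := by
  have : cell s = stdSimplex ℝ V ∩ {b | ∀ v, v ∉ s → b v = 0} := by
    ext b
    constructor
    · rintro ⟨h1, h2, h3⟩
      exact ⟨⟨h1, h2⟩, fun v hv => by by_contra hc; exact hv (h3 v hc)⟩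
    · rintro ⟨⟨h1, h2⟩, h3⟩
      exact ⟨h1, h2, fun v hv => by by_contra hc; exact hv (h3 v hc)⟩
  rw [this]
  refine (isCompact_stdSimplex ℝ V).inter_right ?_
  simp only [Set.ofPred_forall]
  exact isClosed_iInter fun v => isClosed_iInter fun _ =>
    isClosed_eq (continuous_apply v) continuous_const

lemma isCompact_realization (F : Set (Finset V)) : IsCompact (Realization F) :=
  (Set.toFinite F).isCompact_biUnion fun s _ => isCompact_cell s

variable {E : Type*} [AddCommGroup E] [Module ℝ E]

lemma sum_smul_mem_convexHull [DecidableEq E] (pos : V → E) {s : Finset V} {b : V → ℝ}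
    (hb : b ∈ cell s) : ∑ v, b v • pos v ∈ convexHull ℝ (s.image pos : Set E) := by
  obtain ⟨h1, h2, h3⟩ := hb
  have hsub : ∑ v ∈ s, b v = ∑ v, b v :=
    Finset.sum_subset (Finset.subset_univ s) fun v _ hv => by
      by_contra hc; exact hv (h3 v hc)
  have hsub' : ∑ v ∈ s, b v • pos v = ∑ v, b v • pos v :=
    Finset.sum_subset (Finset.subset_univ s) fun v _ hv => by
      have : b v = 0 := by by_contra hc; exact hv (h3 v hc)
      simp [this]
  rw [← hsub']
  refine (convex_convexHull ℝ _).sum_mem (fun v _ => h1 v) (hsub.trans h2) fun v hv => ?_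
  exact subset_convexHull ℝ _ (by simpa using ⟨v, hv, rfl⟩)

lemma exists_mem_cell_of_mem_convexHull [DecidableEq E] (pos : V → E) {s : Finset V} {x : E}
    (hx : x ∈ convexHull ℝ (s.image pos : Set E)) : ∃ b ∈ cell s, ∑ v, b v • pos v = x := by
  classical
  let L : (V → ℝ) →ₗ[ℝ] E := Fintype.linearCombination ℝ pos
  have h1 : convexHull ℝ (s.image pos : Set E) ⊆ L '' cell s := by
    refine convexHull_min ?_ ((convex_cell s).linear_image L)
    intro y hy
    simp only [Finset.coe_image, Set.mem_image, Finset.mem_coe] at hy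
    obtain ⟨v, hv, rfl⟩ := hy
    exact ⟨_, single_mem_cell hv, by simp [L]⟩
  obtain ⟨b, hb, rfl⟩ := h1 hx
  exact ⟨b, hb, by simp [L, Fintype.linearCombination_apply]⟩

lemma eq_of_sum_smul_eq [DecidableEq E] {pos : V → E} (hpos : Function.Injective pos)
    {s : Finset V} (hs : AffineIndependent ℝ ((↑) : s.image pos → E)) {b c : V → ℝ}
    (hb : b ∈ cell s) (hc : c ∈ cell s) (h : ∑ v, b v • pos v = ∑ v, c v • pos v) : b = c := by
  let ι : s ↪ s.image pos := ⟨fun v => ⟨pos v, Finset.mem_image_of_mem pos v.2⟩, fun v w hvw =>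
    Subtype.ext (hpos (congrArg Subtype.val hvw))⟩
  have h1 : AffineIndependent ℝ (fun v : s => pos v) := hs.comp_embedding ι
  have hz : ∀ v ∉ s, b v - c v = 0 := by
    intro v hv
    have h1 : b v = 0 := by by_contra h; exact hv (hb.2.2 v h)
    have h2 : c v = 0 := by by_contra h; exact hv (hc.2.2 v h)
    rw [h1, h2, sub_zero]
  have h2 : ∑ v : s, (b v - c v) = 0 := by
    rw [Finset.sum_coe_sort s (fun v => b v - c v),
      Finset.sum_subset (Finset.subset_univ s) fun v _ hv => hz v hv, Finset.sum_sub_distrib,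
      hb.2.1, hc.2.1, sub_self]
  have h3 : ∑ v : s, (b v - c v) • pos v = 0 := by
    rw [Finset.sum_coe_sort s (fun v => (b v - c v) • pos v),
      Finset.sum_subset (Finset.subset_univ s) fun v _ hv => by rw [hz v hv, zero_smul]]
    simp only [sub_smul]
    rw [Finset.sum_sub_distrib, h, sub_self]
  funext v
  by_cases hv : v ∈ s
  · exact sub_eq_zero.1 (affineIndependent_iff.1 h1 Finset.univ (fun v => b v - c v) h2 h3 ⟨v, hv⟩
      (Finset.mem_univ _))
  · exact sub_eq_zero.1 (hz v hv)

/-- The carrier of a finite geometric complex is the realization of its abstract complex. -/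
lemma nonempty_realization_homeomorph_space [TopologicalSpace E] [T2Space E] [ContinuousAdd E]
    [ContinuousSMul ℝ E] [DecidableEq E] (K : SimplicialComplex ℝ E) {F : Set (Finset V)}
    {pos : V → E} (hpos : Function.Injective pos) (hF : ∀ s ∈ F, s.image pos ∈ K.faces)
    (hK : ∀ t ∈ K.faces, ∃ s ∈ F, t ⊆ s.image pos) :
    Nonempty (Realization F ≃ₜ K.space) := by
  classical
  let f : Realization F → K.space := fun b => ⟨∑ v, (b : V → ℝ) v • pos v, by
    obtain ⟨s, hs, hb⟩ := mem_realization.1 b.2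
    exact SimplicialComplex.mem_space_iff.2 ⟨_, hF s hs, sum_smul_mem_convexHull pos hb⟩⟩
  have hf : Continuous f := by
    refine Continuous.subtype_mk (continuous_finsetSum _ fun v _ => ?_) _
    exact ((continuous_apply v).comp continuous_subtype_val).smul continuous_const
  have hinj : Function.Injective f := by
    intro b c hbc
    have heq : ∑ v, (b : V → ℝ) v • pos v = ∑ v, (c : V → ℝ) v • pos v := congrArg Subtype.val hbc
    obtain ⟨s, hs, hb⟩ := mem_realization.1 b.2
    obtain ⟨t, ht, hc⟩ := mem_realization.1 c.2
    -- A common image point lies in the common face, so it has coordinates `d` supported there;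
    -- affine independence in each of the two facets identifies `d` with `b` and with `c`.
    have h1 := K.inter_subset_convexHull (hF s hs) (hF t ht)
      ⟨sum_smul_mem_convexHull pos hb, heq ▸ sum_smul_mem_convexHull pos hc⟩
    rw [← Finset.coe_inter, ← Finset.image_inter _ _ hpos] at h1
    obtain ⟨d, hd, hdx⟩ := exists_mem_cell_of_mem_convexHull pos h1
    have hds : d ∈ cell s := ⟨hd.1, hd.2.1, fun v hv => Finset.inter_subset_left (hd.2.2 v hv)⟩
    have hdt : d ∈ cell t := ⟨hd.1, hd.2.1, fun v hv => Finset.inter_subset_right (hd.2.2 v hv)⟩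
    have h2 := eq_of_sum_smul_eq hpos (K.indep (hF s hs)) hb hds hdx.symm
    have h3 := eq_of_sum_smul_eq hpos (K.indep (hF t ht)) hc hdt (heq.symm.trans hdx.symm)
    exact Subtype.ext (h2.trans h3.symm)
  have hsurj : Function.Surjective f := by
    rintro ⟨x, hx⟩
    obtain ⟨t, ht, hxt⟩ := SimplicialComplex.mem_space_iff.1 hx
    obtain ⟨s, hs, hts⟩ := hK t ht
    obtain ⟨b, hb, hbx⟩ := exists_mem_cell_of_mem_convexHull pos
      (convexHull_mono (Finset.coe_subset.2 hts) hxt)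
    exact ⟨⟨b, cell_subset hs hb⟩, Subtype.ext hbx⟩
  have := isCompact_iff_compactSpace.1 (isCompact_realization F)
  exact ⟨Continuous.homeoOfEquivCompactToT2 (f := Equiv.ofBijective f ⟨hinj, hsurj⟩) hf⟩

end Realization

/-! ### The rank bound for the fundamental group -/

namespace FacetSystem
variable {A B : Type*} {C : FacetSystem A B}

/-- A removable set of three edges makes the fundamental group three generators smaller than the
cycle rank of the graph. -/
lemma Normal.groupRank_fundamentalGroup_le [Fintype A] [Fintype B] [DecidableEq A] [DecidableEq B]
    (hC : C.Normal) {M : Type*} [TopologicalSpace M] [PathConnectedSpace M]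
    (e : Realization C.simplices ≃ₜ M) (x : M) {R : Set (Sym2 A)} (hRe : R ⊆ C.graph.edgeSet)
    (hR : C.Removable R) :
    groupRank (FundamentalGroup M x) + R.ncard + Nat.card A ≤ C.graph.edgeSet.ncard + 1 := by
  have : PathConnectedSpace (Realization C.simplices) :=
    e.symm.surjective.pathConnectedSpace e.symm.continuous
  obtain ⟨r⟩ := hC.left.connected.nonempty
  have hcov : ∀ v, ∃ s ∈ C.simplices, v ∈ s := by
    rintro (a | b)
    · obtain ⟨x', y, y', h⟩ := hC.left.cover a
      exact ⟨_, ⟨_, _, _, _, h, rfl⟩, by simp⟩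
    · obtain ⟨y', x, x', h⟩ := hC.right.cover b
      exact ⟨_, ⟨_, _, _, _, h, rfl⟩, by simp⟩
  obtain ⟨s, hs, hrs⟩ := hcov (.inl r)
  obtain ⟨g, hg, hgen⟩ := exists_generating_cocycle hcov (.inl r)
    (cell_subset hs (single_mem_cell hrs))
  rw [← groupRank_fundamentalGroup_congr e ⟨Pi.single (.inl r) 1, _⟩ x]
  exact hC.groupRank_le r g hg hgen hRe hR

end FacetSystem

/-! ### Arcs and height functions -/

namespace SimpleGraph
variable {V : Type*}

/-- The only edges of `G` form a path from `p` to `q`. -/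
structure IsArc (G : SimpleGraph V) (p q : V) : Prop where
  ne : p ≠ q
  left : (G.neighborSet p).ncard = 1
  right : (G.neighborSet q).ncard = 1
  interior : ∀ v, v ≠ p → v ≠ q → (G.neighborSet v).Nonempty → (G.neighborSet v).ncard = 2
  reachable : ∀ v, (G.neighborSet v).Nonempty → G.Reachable p v ∨ G.Reachable q v

/-- The position of the vertices along an arc. -/
lemma IsArc.exists_position [Finite V] {G : SimpleGraph V} {p q : V} (h : G.IsArc p q) :
    ∃ (d : V → ℕ) (L : ℕ), 0 < L ∧ d p = 0 ∧ d q = L ∧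
      (∀ v, (G.neighborSet v).Nonempty → d v ≤ L) ∧
      (∀ v w, (G.neighborSet v).Nonempty → (G.neighborSet w).Nonempty → d v = d w → v = w) ∧
      (∀ v w, G.Adj v w → d v = d w + 1 ∨ d w = d v + 1) ∧
      ∀ k < L, ∃ v w, G.Adj v w ∧ d v = k ∧ d w = k + 1 := by
  obtain ⟨par, hpar⟩ := G.exists_parent p
  have hncard : ∀ v, (G.neighborSet v).ncard ≤ 2 := by
    intro v
    by_cases h1 : v = p
    · rw [h1, h.left]; omega
    by_cases h2 : v = q
    · rw [h2, h.right]; omega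
    by_cases h3 : (G.neighborSet v).Nonempty
    · exact (h.interior v h1 h2 h3).le
    · rw [Set.not_nonempty_iff_eq_empty.1 h3]; simp
  have hzero : ∀ v, G.Reachable p v → G.dist p v = 0 → v = p := by
    intro v hv h0
    exact (hv.dist_eq_zero_iff.1 h0).symm
  -- By induction two vertices at the same distance have the same parent. If they were different,
  -- this parent would have two children and, unless it is `p`, a parent of its own: one neighbour
  -- too many.
  have huniq : ∀ k v w, G.Reachable p v → G.Reachable p w → G.dist p v = k → G.dist p w = k →
      v = w := by
    intro k
    induction k with
    | zero => intro v w hv hw h1 h2; rw [hzero v hv h1, hzero w hw h2]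
    | succ k ih =>
      intro v w hv hw h1 h2
      have hvp : v ≠ p := by rintro rfl; simp at h1
      have hwp : w ≠ p := by rintro rfl; simp at h2
      obtain ⟨a1, a2, a3⟩ := hpar v hv hvp
      obtain ⟨b1, b2, b3⟩ := hpar w hw hwp
      have hvw : par v = par w := ih _ _ a3 b3 (by omega) (by omega)
      rw [← hvw] at b1 b2 b3
      by_cases hup : par v = p
      · obtain ⟨z, hz⟩ := Set.ncard_eq_one.1 h.left
        have h3 : v ∈ G.neighborSet p := hup ▸ a1
        have h4 : w ∈ G.neighborSet p := hup ▸ b1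
        rw [hz] at h3 h4
        rw [h3, h4]
      · obtain ⟨c1, c2, c3⟩ := hpar _ a3 hup
        by_contra hne
        have h5 : ({v, w, par (par v)} : Set V) ⊆ G.neighborSet (par v) := by
          rintro _ (rfl | rfl | rfl)
          exacts [a1, b1, c1.symm]
        have h6 := Set.ncard_le_ncard h5 (Set.toFinite _)
        have h7 : ({v, w, par (par v)} : Set V).ncard = 3 := by
          rw [Set.ncard_eq_three]
          refine ⟨v, w, par (par v), hne, ?_, ?_, rfl⟩
          · intro h8; rw [← h8] at c2; omega
          · intro h8; rw [← h8] at c2; omega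
        have := hncard (par v)
        omega
  have hadj : ∀ v w, G.Reachable p v → G.Adj v w →
      G.dist p v = G.dist p w + 1 ∨ G.dist p w = G.dist p v + 1 := by
    intro v w hv hvw
    have h1 := dist_le_of_adj hv hvw
    have h2 := dist_le_of_adj (hv.trans hvw.reachable) hvw.symm
    have h3 : G.dist p v ≠ G.dist p w := fun h4 =>
      hvw.ne (huniq _ v w hv (hv.trans hvw.reachable) h4 rfl)
    omega
  obtain ⟨z, hz, hmax'⟩ := Set.exists_max_image {v | G.Reachable p v} (fun v => G.dist p v)
    (Set.toFinite _) ⟨p, Reachable.refl p⟩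
  have hzr : G.Reachable p z := hz
  have hmax : ∀ v, G.Reachable p v → G.dist p v ≤ G.dist p z := hmax'
  have hpn : (G.neighborSet p).Nonempty := by
    rw [← Set.ncard_pos (Set.toFinite _), h.left]; omega
  -- A farthest vertex cannot be interior: its neighbour other than the parent would be farther
  -- still, since distances determine vertices.
  have hzq : z = q := by
    by_contra hzq
    by_cases hzp : z = p
    · obtain ⟨w, hw⟩ := hpn
      have h1 := hmax w (Adj.reachable hw)
      rw [hzp] at h1
      have h2 := hadj p w (Reachable.refl p) hw
      simp only [SimpleGraph.dist_self] at h1 h2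
      omega
    · obtain ⟨a1, a2, a3⟩ := hpar z hzr hzp
      have h1 := h.interior z hzp hzq ⟨_, a1.symm⟩
      obtain ⟨w, hw, hwne⟩ := Set.exists_ne_of_one_lt_ncard
        (s := G.neighborSet z) (by omega) (par z)
      have hwr : G.Reachable p w := hzr.trans (Adj.reachable hw)
      have h2 := hmax w hwr
      rcases hadj z w hzr hw with h3 | h3
      · exact hwne (huniq _ w (par z) hwr a3 rfl (by omega))
      · omega
  rw [hzq] at hzr hmax
  have hreach : ∀ v, (G.neighborSet v).Nonempty → G.Reachable p v := fun v hv =>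
    (h.reachable v hv).elim id fun h1 => hzr.trans h1
  have hLpos : 0 < G.dist p q := by
    rcases Nat.eq_zero_or_pos (G.dist p q) with h0 | h0
    · exact absurd (hzero q hzr h0) h.ne.symm
    · exact h0
  refine ⟨fun v => G.dist p v, G.dist p q, hLpos, by simp, rfl, fun v hv => hmax v (hreach v hv),
    fun v w hv hw hvw => huniq _ v w (hreach v hv) (hreach w hw) hvw rfl,
    fun v w hvw => hadj v w (hreach v ⟨w, hvw⟩) hvw, ?_⟩
  have hdown : ∀ n, n < G.dist p q → ∃ v w, G.Reachable p w ∧ G.Adj w v ∧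
      G.dist p v = G.dist p q - n ∧ G.dist p w + 1 = G.dist p q - n := by
    intro n
    induction n with
    | zero =>
      intro _
      obtain ⟨a1, a2, a3⟩ := hpar q hzr h.ne.symm
      exact ⟨q, par q, a3, a1, by simp, by omega⟩
    | succ n ih =>
      intro hn
      obtain ⟨v, w, hw, -, -, h2⟩ := ih (by omega)
      have hwp : w ≠ p := by rintro rfl; simp at h2; omega
      obtain ⟨a1, a2, a3⟩ := hpar w hw hwp
      exact ⟨w, par w, a3, a1, by omega, by omega⟩
  intro k hk
  obtain ⟨v, w, -, h1, h2, h3⟩ := hdown (G.dist p q - 1 - k) (by omega)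
  exact ⟨w, v, h1, by dsimp only; omega, by dsimp only; omega⟩

/-- The edges of `G` with the label `i`. -/
def labelGraph {ι : Type*} (G : SimpleGraph V) (l : Sym2 V → ι) (i : ι) : SimpleGraph V where
  Adj v w := G.Adj v w ∧ l s(v, w) = i
  symm := ⟨fun _ _ h => ⟨h.1.symm, by rw [Sym2.eq_swap]; exact h.2⟩⟩
  loopless := ⟨fun _ h => h.1.ne rfl⟩

/-- `h` is a height function on a graph whose edges with a given label form an arc from the vertex
of height `1` to the vertex of height `-1`. -/
structure IsHeight {ι : Type*} (G : SimpleGraph V) (l : Sym2 V → ι) (h : V → ℝ) : Prop where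
  abs_le : ∀ v, |h v| ≤ 1
  eq_of_abs : ∀ v w, |h v| = 1 → h v = h w → v = w
  abs_eq : ∀ v w w', G.Adj v w → G.Adj v w' → l s(v, w) ≠ l s(v, w') → |h v| = 1
  surj : ∀ i s, |s| ≤ 1 → ∃ v w r, G.Adj v w ∧ l s(v, w) = i ∧ 0 ≤ r ∧ r ≤ 1 ∧
    s = (1 - r) * h v + r * h w
  inj : ∀ v w v' w' α β α' β', G.Adj v w → G.Adj v' w' → l s(v, w) = l s(v', w') → 0 ≤ α → 0 ≤ β →
    0 ≤ α' → 0 ≤ β' → α + β = α' + β' → α * h v + β * h w = α' * h v' + β' * h w' →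
    ∀ f : V → ℝ, α * f v + β * f w = α' * f v' + β' * f w'

/-- Parametrise each arc from `p` to `q` affinely, by height `1 - 2 * d / L` at position `d`.
Interior vertices see only one label, so any incident edge, here the one to `nb v`, tells which arc
to use. -/
lemma exists_isHeight [Finite V] {ι : Type*} {G : SimpleGraph V} {l : Sym2 V → ι} {p q : V}
    (harc : ∀ i, (G.labelGraph l i).IsArc p q) (hnon : ∀ v, (G.neighborSet v).Nonempty)
    (hlab : ∀ v w w', v ≠ p → v ≠ q → G.Adj v w → G.Adj v w' → l s(v, w) = l s(v, w')) :
    ∃ h : V → ℝ, G.IsHeight l h := by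
  classical
  choose d L hL hdp hdq hdL hdinj hdadj hdex using fun i => (harc i).exists_position
  have hpq : p ≠ q := (harc (l s(p, q))).ne
  choose nb hnb using hnon
  let h : V → ℝ := fun v => if v = p then 1 else if v = q then -1 else
    1 - 2 * (d (l s(v, nb v)) v : ℝ) / L (l s(v, nb v))
  have hp : h p = 1 := by simp [h]
  have hq : h q = -1 := by simp [h, hpq.symm]
  have hL' : ∀ i, (0 : ℝ) < L i := fun i => by exact_mod_cast hL i
  -- on each arc the height is affine in the position
  have hpos : ∀ v w, G.Adj v w → h v = 1 - 2 * (d (l s(v, w)) v : ℝ) / L (l s(v, w)) := by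
    intro v w hvw
    by_cases h1 : v = p
    · subst h1; simp [hp, hdp]
    by_cases h2 : v = q
    · subst h2
      rw [hq, hdq, mul_div_assoc, div_self (hL' _).ne']; norm_num
    · simp only [h, h1, h2, if_false]
      rw [hlab v (nb v) w h1 h2 (hnb v) hvw]
  have hdl : ∀ v w, G.Adj v w → ((G.labelGraph l (l s(v, w))).neighborSet v).Nonempty :=
    fun v w hvw => ⟨w, hvw, rfl⟩
  have hpn : ∀ i, ((G.labelGraph l i).neighborSet p).Nonempty := fun i => by
    rw [← Set.ncard_pos (Set.toFinite _), (harc i).left]; omega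
  have hqn : ∀ i, ((G.labelGraph l i).neighborSet q).Nonempty := fun i => by
    rw [← Set.ncard_pos (Set.toFinite _), (harc i).right]; omega
  have hint : ∀ v, v ≠ p → v ≠ q → |h v| < 1 := by
    intro v h1 h2
    have h3 := hdl v (nb v) (hnb v)
    rw [hpos v (nb v) (hnb v)]
    set i := l s(v, nb v)
    have h4 : d i v ≠ 0 := fun h0 => h1 (hdinj i v p h3 (hpn i) (by rw [h0, hdp]))
    have h5 : d i v ≠ L i := fun h0 => h2 (hdinj i v q h3 (hqn i) (by rw [h0, hdq]))
    have h6 := hdL i v h3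
    have h7 : (0 : ℝ) < d i v := by exact_mod_cast Nat.pos_of_ne_zero h4
    have h8 : (d i v : ℝ) < L i := by exact_mod_cast lt_of_le_of_ne h6 h5
    have h9 : (d i v : ℝ) / L i < 1 := (div_lt_one (hL' i)).2 h8
    have h10 : 0 < (d i v : ℝ) / L i := div_pos h7 (hL' i)
    rw [abs_lt, mul_div_assoc]
    constructor <;> linarith
  refine ⟨h, ⟨fun v => ?_, fun v w h1 h2 => ?_, fun v w w' h1 h2 h3 => ?_, fun i s hs => ?_, ?_⟩⟩
  · by_cases h1 : v = p
    · simp [h1, hp]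
    by_cases h2 : v = q
    · simp [h2, hq]
    exact (hint v h1 h2).le
  · have key : ∀ u, |h u| = 1 → u = p ∨ u = q := by
      intro u hu
      by_contra hc
      push Not at hc
      exact (hint u hc.1 hc.2).ne hu
    rcases key v h1 with rfl | rfl <;> rcases key w (h2 ▸ h1) with rfl | rfl
    · rfl
    · rw [hp, hq] at h2; norm_num at h2
    · rw [hp, hq] at h2; norm_num at h2
    · rfl
  · by_cases h4 : v = p
    · simp [h4, hp]
    by_cases h5 : v = q
    · simp [h5, hq]
    exact absurd (hlab v w w' h4 h5 h1 h2) h3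
  · -- the position of the point of height `s`
    rw [abs_le] at hs
    set t : ℝ := (1 - s) / 2 * L i with ht
    have ht0 : 0 ≤ t := mul_nonneg (by linarith) (hL' i).le
    have htL : t ≤ L i := by nlinarith [hL' i]
    obtain ⟨k, hk, hkt, hkt'⟩ : ∃ k < L i, (k : ℝ) ≤ t ∧ t ≤ k + 1 := by
      by_cases htL' : t = L i
      · refine ⟨L i - 1, by have := hL i; omega, ?_, ?_⟩
        · rw [htL']; exact_mod_cast Nat.sub_le _ _
        · rw [htL', Nat.cast_sub (hL i)]; simp
      · refine ⟨⌊t⌋₊, ?_, Nat.floor_le ht0, (Nat.lt_floor_add_one t).le⟩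
        rw [Nat.floor_lt ht0]
        exact lt_of_le_of_ne htL htL'
    obtain ⟨v, w, ⟨hvw, hl⟩, hdv, hdw⟩ := hdex i k hk
    refine ⟨v, w, t - k, hvw, hl, by linarith, by linarith, ?_⟩
    have h1 := hpos v w hvw
    have h2 := hpos w v hvw.symm
    rw [Sym2.eq_swap, hl] at h2
    rw [hl] at h1
    rw [h1, h2, hdv, hdw]
    have hLne := (hL' i).ne'
    push_cast
    field_simp
    rw [ht]
    ring
  · have main : ∀ v w v' w' α β α' β', G.Adj v w → G.Adj v' w' → l s(v, w) = l s(v', w') →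
        0 ≤ α → 0 ≤ β → 0 ≤ α' → 0 ≤ β' → α + β = α' + β' →
        α * h v + β * h w = α' * h v' + β' * h w' →
        d (l s(v, w)) w = d (l s(v, w)) v + 1 → d (l s(v, w)) w' = d (l s(v, w)) v' + 1 →
        d (l s(v, w)) v ≤ d (l s(v, w)) v' →
        ∀ f : V → ℝ, α * f v + β * f w = α' * f v' + β' * f w' := by
      intro v w v' w' α β α' β' hvw hvw' hl hα hβ hα' hβ' hm hh hd hd' hle f
      have a1 := hpos v w hvw
      have a2 := hpos w v hvw.symm
      have a3 := hpos v' w' hvw'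
      have a4 := hpos w' v' hvw'.symm
      rw [Sym2.eq_swap] at a2 a4
      rw [← hl] at a3 a4
      have n1 := hdl v w hvw
      have n2 := hdl w v hvw.symm
      have n3 := hdl v' w' hvw'
      have n4 := hdl w' v' hvw'.symm
      rw [Sym2.eq_swap] at n2 n4
      rw [← hl] at n3 n4
      set i := l s(v, w)
      have hLne := (hL' i).ne'
      rw [a1, a2, a3, a4, hd, hd'] at hh
      push_cast at hh
      field_simp at hh
      -- Equal heights on one arc mean equal centres of mass of the positions.
      have hh' : (α + β) * (d i v : ℝ) + β = (α + β) * (d i v' : ℝ) + β' := by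
        rw [hm]
        have e1 : (α + β) * (L i : ℝ) = (α' + β') * L i := by rw [hm]
        have e2 : (α + β) * (d i v : ℝ) = (α' + β') * d i v := by rw [hm]
        nlinarith [hh, e1, e2]
      rcases hle.eq_or_lt with heq | hlt
      · have e1 : v = v' := hdinj i v v' n1 n3 heq
        have e2 : w = w' := hdinj i w w' n2 n4 (by omega)
        rw [heq] at hh'
        have e3 : β = β' := by linarith
        have e4 : α = α' := by linarith
        rw [e1, e2, e3, e4]
      -- Two different edges can only carry the same point when they are consecutive, the point
      -- being their common vertex `w = v'`. Zero mass is treated apart.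
      · have e1 : (d i v : ℝ) + 1 ≤ d i v' := by exact_mod_cast hlt
        rcases (add_nonneg hα hβ).eq_or_lt with h0 | h0
        · have b1 : α = 0 := by linarith
          have b2 : β = 0 := by linarith
          have b3 : α' = 0 := by linarith
          have b4 : β' = 0 := by linarith
          simp [b1, b2, b3, b4]
        · have e2 : (α + β) * ((d i v' : ℝ) - d i v) = β - β' := by linarith
          have e3 : (α + β) * 1 ≤ (α + β) * ((d i v' : ℝ) - d i v) :=
            mul_le_mul_of_nonneg_left (by linarith) h0.le
          have b1 : α = 0 := by linarith
          have b2 : β' = 0 := by linarith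
          have b3 : α' = β := by linarith
          have e4 : (d i v' : ℝ) - d i v = 1 := by
            have e5 : (α + β) * ((d i v' : ℝ) - d i v - 1) = 0 := by
              rw [mul_sub, e2]; linarith
            rcases mul_eq_zero.1 e5 with h6 | h6
            · linarith
            · linarith
          have e5 : d i v' = d i v + 1 := by
            have : (d i v' : ℝ) = ((d i v + 1 : ℕ) : ℝ) := by push_cast; linarith
            exact_mod_cast this
          have e6 : w = v' := hdinj i w v' n2 n3 (by omega)
          rw [b1, b2, b3, e6]
          ring
    have main2 : ∀ v w v' w' α β α' β', G.Adj v w → G.Adj v' w' → l s(v, w) = l s(v', w') →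
        0 ≤ α → 0 ≤ β → 0 ≤ α' → 0 ≤ β' → α + β = α' + β' →
        α * h v + β * h w = α' * h v' + β' * h w' →
        d (l s(v, w)) w = d (l s(v, w)) v + 1 → d (l s(v, w)) w' = d (l s(v, w)) v' + 1 →
        ∀ f : V → ℝ, α * f v + β * f w = α' * f v' + β' * f w' := by
      intro v w v' w' α β α' β' hvw hvw' hl hα hβ hα' hβ' hm hh hd hd' f
      rcases le_total (d (l s(v, w)) v) (d (l s(v, w)) v') with hle | hle
      · exact main v w v' w' α β α' β' hvw hvw' hl hα hβ hα' hβ' hm hh hd hd' hle f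
      · rw [hl] at hd hd' hle
        exact (main v' w' v w α' β' α β hvw' hvw hl.symm hα' hβ' hα hβ hm.symm hh.symm hd' hd hle
          f).symm
    intro v w v' w' α β α' β' hvw hvw' hl hα hβ hα' hβ' hm hh f
    have hd := hdadj (l s(v, w)) v w ⟨hvw, rfl⟩
    have hd' := hdadj (l s(v, w)) v' w' ⟨hvw', hl.symm⟩
    have sw : l s(w, v) = l s(v, w) := by rw [Sym2.eq_swap]
    have sw' : l s(w', v') = l s(v', w') := by rw [Sym2.eq_swap]
    rcases hd with hd | hd <;> rcases hd' with hd' | hd'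
    · have := main2 w v w' v' β α β' α' hvw.symm hvw'.symm (by rw [sw, sw', hl]) hβ hα hβ' hα'
        (by linarith) (by linarith) (by rw [sw]; exact hd) (by rw [sw]; exact hd') f
      linarith
    · have := main2 w v v' w' β α α' β' hvw.symm hvw' (by rw [sw, hl]) hβ hα hα' hβ'
        (by linarith) (by linarith) (by rw [sw]; exact hd) (by rw [sw]; exact hd') f
      linarith
    · have := main2 v w w' v' α β β' α' hvw hvw'.symm (by rw [sw', hl]) hα hβ hβ' hα'
        (by linarith) (by linarith) hd hd' f
      linarith
    · exact main2 v w v' w' α β α' β' hvw hvw' hl hα hβ hα' hβ' hm hh hd hd' f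

end SimpleGraph

/-! ### Theta graphs and cycles -/

namespace SimpleGraph
variable {V : Type*}

/-- Three labels, such that the edges outside each of them form a cycle, and cycle rank two: the
graph consists of three arcs with common end points. -/
lemma exists_isArc_of_theta [Finite V] {G : SimpleGraph V} {l : Sym2 V → Fin 3}
    (hnon : ∀ v, (G.neighborSet v).Nonempty) (hcard : G.edgeSet.ncard = Nat.card V + 1)
    {Z : Fin 3 → SimpleGraph V} (hZ : ∀ i v w, (Z i).Adj v w ↔ G.Adj v w ∧ l s(v, w) ≠ i)
    (hcyc : ∀ i, (Z i).IsCycles)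
    (hconn : ∀ i v w, v ∈ (Z i).support → w ∈ (Z i).support → (Z i).Reachable v w)
    (hocc : ∀ i, ∃ v w, G.Adj v w ∧ l s(v, w) = i) :
    ∃ p q, (∀ i, (G.labelGraph l i).IsArc p q) ∧
      ∀ v w w', v ≠ p → v ≠ q → G.Adj v w → G.Adj v w' → l s(v, w) = l s(v, w') := by
  classical
  have := Fintype.ofFinite V
  let D : Fin 3 → V → ℕ := fun i v => ((G.labelGraph l i).neighborSet v).ncard
  have hdeg : ∀ v, (G.neighborSet v).ncard = D 0 v + D 1 v + D 2 v := by
    intro v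
    have h1 : G.neighborSet v = ((G.labelGraph l 0).neighborSet v ∪
        (G.labelGraph l 1).neighborSet v) ∪ (G.labelGraph l 2).neighborSet v := by
      ext w
      simp only [mem_neighborSet, labelGraph, Set.mem_union]
      have : l s(v, w) = 0 ∨ l s(v, w) = 1 ∨ l s(v, w) = 2 := by
        generalize l s(v, w) = i
        fin_cases i <;> simp
      tauto
    rw [h1, Set.ncard_union_eq _ (Set.toFinite _) (Set.toFinite _),
      Set.ncard_union_eq _ (Set.toFinite _) (Set.toFinite _)]
    · rw [Set.disjoint_left]
      rintro w ⟨-, h2⟩ ⟨-, h3⟩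
      rw [h2] at h3
      exact absurd h3 (by decide)
    · rw [Set.disjoint_left]
      rintro w (⟨-, h2⟩ | ⟨-, h2⟩) ⟨-, h3⟩ <;>
      · rw [h2] at h3
        exact absurd h3 (by decide)
  have hZdeg : ∀ i v, ((Z i).neighborSet v).ncard + D i v = (G.neighborSet v).ncard := by
    intro i v
    have h1 : G.neighborSet v = (Z i).neighborSet v ∪ (G.labelGraph l i).neighborSet v := by
      ext w
      simp only [mem_neighborSet, labelGraph, Set.mem_union, hZ]
      tauto
    rw [h1, Set.ncard_union_eq _ (Set.toFinite _) (Set.toFinite _)]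
    rw [Set.disjoint_left]
    rintro w hw ⟨-, h2⟩
    exact ((hZ i v w).1 hw).2 h2
  have hZ02 : ∀ i v, ((Z i).neighborSet v).ncard = 0 ∨ ((Z i).neighborSet v).ncard = 2 := by
    intro i v
    by_cases h : ((Z i).neighborSet v).Nonempty
    · exact Or.inr (hcyc i h)
    · left
      rw [Set.not_nonempty_iff_eq_empty.1 h, Set.ncard_empty]
  -- Omitting any one label leaves degree 0 or 2. Thus a vertex is a branch point, with one edge of
  -- each label, or has two edges of a single label.
  have hD : ∀ v, (D 0 v = 1 ∧ D 1 v = 1 ∧ D 2 v = 1) ∨ (D 0 v = 2 ∧ D 1 v = 0 ∧ D 2 v = 0) ∨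
      (D 0 v = 0 ∧ D 1 v = 2 ∧ D 2 v = 0) ∨ (D 0 v = 0 ∧ D 1 v = 0 ∧ D 2 v = 2) := by
    intro v
    have h1 : 0 < (G.neighborSet v).ncard := (Set.ncard_pos (Set.toFinite _)).2 (hnon v)
    have h2 := hdeg v
    have h3 := hZdeg 0 v
    have h4 := hZdeg 1 v
    have h5 := hZdeg 2 v
    have h6 := hZ02 0 v
    have h7 := hZ02 1 v
    have h8 := hZ02 2 v
    omega
  have hall : ∀ v, D 0 v = 1 → ∀ i, D i v = 1 := by
    intro v hv i
    have := hD v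
    fin_cases i <;> simp only [Fin.zero_eta, Fin.mk_one, Fin.reduceFinMk] <;> omega
  have hnb : ∀ v, D 0 v ≠ 1 → ∀ i j, D i v ≠ 0 → D j v ≠ 0 → i = j ∧ D i v = 2 := by
    intro v hv i j hi hj
    have := hD v
    fin_cases i <;> fin_cases j <;>
      simp only [Fin.zero_eta, Fin.mk_one, Fin.reduceFinMk] at hi hj ⊢ <;>
      first
      | (exfalso; omega)
      | (refine ⟨trivial, ?_⟩; omega)
  -- The degrees are 2 or 3 and add up to twice the number of vertices plus 2, so exactly two of
  -- them are 3.
  have hbranch : (Finset.univ.filter fun v => D 0 v = 1).card = 2 := by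
    have h1 := G.sum_ncard_neighborSet
    rw [hcard, Nat.card_eq_fintype_card] at h1
    have h2 : ∀ v, (G.neighborSet v).ncard = 2 + if D 0 v = 1 then 1 else 0 := by
      intro v
      rw [hdeg v]
      have := hD v
      split_ifs <;> omega
    rw [Finset.sum_congr rfl fun v _ => h2 v, Finset.sum_add_distrib, ← Finset.card_filter] at h1
    simp at h1
    omega
  obtain ⟨p, q, hpq, hpqe⟩ := Finset.card_eq_two.1 hbranch
  have hbr : ∀ v, D 0 v = 1 ↔ v = p ∨ v = q := by
    intro v
    have : v ∈ Finset.univ.filter (fun v => D 0 v = 1) ↔ v ∈ ({p, q} : Finset V) := by rw [hpqe]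
    simpa using this
  have hDpos : ∀ {i v w}, G.Adj v w → l s(v, w) = i → D i v ≠ 0 := by
    intro i v w h1 h2
    have h3 : ((G.labelGraph l i).neighborSet v).Nonempty := ⟨w, h1, h2⟩
    exact ((Set.ncard_pos (Set.toFinite _)).2 h3).ne'
  refine ⟨p, q, fun i => ⟨hpq, hall p ((hbr p).2 (Or.inl rfl)) i, hall q ((hbr q).2 (Or.inr rfl)) i,
    fun v h1 h2 h3 => ?_, fun v hv => ?_⟩, fun v w w' h1 h2 h3 h4 => ?_⟩
  · have h4 : D 0 v ≠ 1 := fun h => by rcases (hbr v).1 h with h | h; exacts [h1 h, h2 h]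
    have h5 : D i v ≠ 0 := ((Set.ncard_pos (Set.toFinite _)).2 h3).ne'
    exact (hnb v h4 i i h5 h5).2
  -- A piece of label `i` that misses both branch points cannot be left by a walk avoiding label
  -- `j`. Yet such a walk leads to an edge of the third label `k`.
  · by_contra hcon
    push Not at hcon
    obtain ⟨j, hj⟩ : ∃ j, j ≠ i := ⟨i + 1, by simp⟩
    obtain ⟨k, hki, hkj⟩ :=
      (show ∀ i j : Fin 3, j ≠ i → ∃ k, k ≠ i ∧ k ≠ j by decide) i j hj
    obtain ⟨z, z', hz, hzl⟩ := hocc k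
    obtain ⟨w, hw, hwl⟩ := hv
    have hvZ : v ∈ (Z j).support := (mem_support _).2 ⟨w, (hZ j v w).2 ⟨hw, by rw [hwl]; exact hj.symm⟩⟩
    have hzZ : z ∈ (Z j).support := (mem_support _).2 ⟨z', (hZ j z z').2 ⟨hz, by rw [hzl]; exact hkj⟩⟩
    obtain ⟨W⟩ := hconn j v z hvZ hzZ
    have key : ∀ {a b : V}, (Z j).Walk a b → (G.labelGraph l i).Reachable v a → D i a ≠ 0 →
        (G.labelGraph l i).Reachable v b ∧ D i b ≠ 0 := by
      intro a b W
      induction W with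
      | nil => exact fun h1 h2 => ⟨h1, h2⟩
      | @cons a c b hac _ ih =>
        intro h1 h2
        have h3 : D 0 a ≠ 1 := by
          intro h
          rcases (hbr a).1 h with rfl | rfl
          · exact hcon.1 h1.symm
          · exact hcon.2 h1.symm
        have hacG := (hZ j a c).1 hac
        have h4 := (hnb a h3 _ _ h2 (hDpos hacG.1 rfl)).1
        have h5 : (G.labelGraph l i).Adj a c := ⟨hacG.1, h4.symm⟩
        exact ih (h1.trans h5.reachable) (hDpos hacG.1.symm (by rw [Sym2.eq_swap]; exact h4.symm))
    obtain ⟨h1, h2⟩ := key W (Reachable.refl _) (hDpos hw hwl)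
    have h3 : D 0 z ≠ 1 := by
      intro h
      rcases (hbr z).1 h with rfl | rfl
      · exact hcon.1 h1.symm
      · exact hcon.2 h1.symm
    exact hki (hnb z h3 _ _ h2 (hDpos hz hzl)).1.symm
  · have h5 : D 0 v ≠ 1 := fun h => by rcases (hbr v).1 h with h | h; exacts [h1 h, h2 h]
    exact (hnb v h5 _ _ (hDpos h3 rfl) (hDpos h4 rfl)).1

/-- A cycle is the union of an edge and another arc with the same end points. -/
lemma exists_isHeight_of_isCycles [Finite V] {G : SimpleGraph V} (hG : G.IsCycles)
    (hconn : G.Connected) (hnon : ∀ v, (G.neighborSet v).Nonempty) :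
    ∃ (l : Sym2 V → Fin 2) (h : V → ℝ), G.IsHeight l h := by
  classical
  obtain ⟨p⟩ := hconn.nonempty
  obtain ⟨q, hpq⟩ := hnon p
  have hpq' : G.Adj p q := hpq
  let l : Sym2 V → Fin 2 := fun e => if e = s(p, q) then 0 else 1
  have hl0 : ∀ e, l e = 0 ↔ e = s(p, q) := by
    intro e
    by_cases h : e = s(p, q) <;> simp [l, h]
  have hl1 : ∀ e, l e = 1 ↔ e ≠ s(p, q) := by
    intro e
    by_cases h : e = s(p, q) <;> simp [l, h]
  have hl1G : G.labelGraph l 1 = G.deleteEdges {s(p, q)} := by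
    ext v w
    simp [labelGraph, hl1]
  have hreach : ∀ v w, (G.labelGraph l 1).Reachable v w := by
    have h1 := hG.reachable_deleteEdges hpq'
    rw [← hl1G] at h1
    intro v w
    refine reachable_of_le_reachGraph (H := G) (fun a b hab => ⟨hab.ne, ?_⟩) (hconn v w)
    by_cases h : s(a, b) = s(p, q)
    · rcases Sym2.eq_iff.1 h with ⟨rfl, rfl⟩ | ⟨rfl, rfl⟩
      exacts [h1, h1.symm]
    · exact Adj.reachable (G := G.labelGraph l 1) ⟨hab, (hl1 _).2 h⟩
  have h0p : (G.labelGraph l 0).neighborSet p = {q} := by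
    ext w
    simp only [mem_neighborSet, labelGraph, hl0, Set.mem_singleton_iff]
    constructor
    · rintro ⟨-, h⟩
      rcases Sym2.eq_iff.1 h with ⟨-, h⟩ | ⟨h, h'⟩
      exacts [h, h'.trans h]
    · rintro rfl; exact ⟨hpq', rfl⟩
  have h0q : (G.labelGraph l 0).neighborSet q = {p} := by
    ext w
    simp only [mem_neighborSet, labelGraph, hl0, Set.mem_singleton_iff]
    constructor
    · rintro ⟨-, h⟩
      rcases Sym2.eq_iff.1 h with ⟨h, h'⟩ | ⟨h, h'⟩
      exacts [h'.trans h, h']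
    · rintro rfl; exact ⟨hpq'.symm, Sym2.eq_swap⟩
  have h1v : ∀ v, v ≠ p → v ≠ q → (G.labelGraph l 1).neighborSet v = G.neighborSet v := by
    intro v h1 h2
    ext w
    simp only [mem_neighborSet, labelGraph, hl1, and_iff_left_iff_imp]
    intro _ h
    rcases Sym2.eq_iff.1 h with ⟨h, -⟩ | ⟨h, -⟩
    exacts [h1 h, h2 h]
  have h1p : (G.labelGraph l 1).neighborSet p = G.neighborSet p \ {q} := by
    ext w
    simp only [mem_neighborSet, labelGraph, hl1, Set.mem_sdiff, Set.mem_singleton_iff]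
    constructor
    · rintro ⟨h, h'⟩
      exact ⟨h, by rintro rfl; exact h' rfl⟩
    · rintro ⟨h, h'⟩
      refine ⟨h, fun h2 => ?_⟩
      rcases Sym2.eq_iff.1 h2 with ⟨-, h3⟩ | ⟨h3, h4⟩
      exacts [h' h3, h' (h4.trans h3)]
  have h1q : (G.labelGraph l 1).neighborSet q = G.neighborSet q \ {p} := by
    ext w
    simp only [mem_neighborSet, labelGraph, hl1, Set.mem_sdiff, Set.mem_singleton_iff]
    constructor
    · rintro ⟨h, h'⟩
      exact ⟨h, by rintro rfl; exact h' Sym2.eq_swap⟩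
    · rintro ⟨h, h'⟩
      refine ⟨h, fun h2 => ?_⟩
      rcases Sym2.eq_iff.1 h2 with ⟨h3, h4⟩ | ⟨-, h4⟩
      exacts [h' (h4.trans h3), h' h4]
  have harc : ∀ i, (G.labelGraph l i).IsArc p q := by
    intro i
    have hi : i = 0 ∨ i = 1 := by fin_cases i <;> simp
    rcases hi with rfl | rfl
    · refine ⟨hpq'.ne, by simp [h0p], by simp [h0q], ?_, ?_⟩
      · rintro v h1 h2 ⟨w, -, hw⟩
        rcases Sym2.eq_iff.1 ((hl0 _).1 hw) with ⟨h, -⟩ | ⟨h, -⟩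
        exacts [absurd h h1, absurd h h2]
      · rintro v ⟨w, -, hw⟩
        rcases Sym2.eq_iff.1 ((hl0 _).1 hw) with ⟨rfl, -⟩ | ⟨rfl, -⟩
        exacts [Or.inl (Reachable.refl _), Or.inr (Reachable.refl _)]
    · refine ⟨hpq'.ne, ?_, ?_, ?_, fun v _ => Or.inl (hreach _ _)⟩
      · have := Set.ncard_sdiff_singleton_add_one hpq (Set.toFinite _)
        rw [hG (hnon p)] at this
        rw [h1p]; omega
      · have := Set.ncard_sdiff_singleton_add_one (s := G.neighborSet q) hpq'.symm (Set.toFinite _)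
        rw [hG (hnon q)] at this
        rw [h1q]; omega
      · intro v h1 h2 _
        rw [h1v v h1 h2, hG (hnon v)]
  refine ⟨l, exists_isHeight harc hnon fun v w w' h1 h2 _ _ => ?_⟩
  have : ∀ u, l s(v, u) = 1 := by
    intro u
    rw [hl1]
    intro h
    rcases Sym2.eq_iff.1 h with ⟨h, -⟩ | ⟨h, -⟩
    exacts [h1 h, h2 h]
  rw [this, this]

/-- A cycle has no proper subgraph that is a cycle. -/
lemma IsCycles.eq_of_le [Finite V] {G H : SimpleGraph V} (hG : G.IsCycles) (hH : H.IsCycles)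
    (hle : G ≤ H) (hconn : ∀ v w, v ∈ H.support → w ∈ H.support → H.Reachable v w)
    {a b : V} (hab : G.Adj a b) : G = H := by
  have hnb : ∀ v, v ∈ G.support → G.neighborSet v = H.neighborSet v := by
    intro v hv
    obtain ⟨w, hw⟩ := (mem_support _).1 hv
    refine Set.eq_of_subset_of_ncard_le (fun u hu => hle hu) ?_ (Set.toFinite _)
    rw [hG ⟨w, hw⟩, hH ⟨w, hle hw⟩]
  have key : ∀ {u v : V}, H.Walk u v → u ∈ G.support → v ∈ G.support := by
    intro u v W
    induction W with
    | nil => exact id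
    | @cons u c v huc _ ih =>
      intro hu
      have : c ∈ G.neighborSet u := by rw [hnb u hu]; exact huc
      exact ih ((mem_support _).2 ⟨u, (show G.Adj u c from this).symm⟩)
  refine le_antisymm hle fun v w hvw => ?_
  have ha : a ∈ G.support := (mem_support _).2 ⟨b, hab⟩
  obtain ⟨W⟩ := hconn a v ((mem_support _).2 ⟨b, hle hab⟩) ((mem_support _).2 ⟨w, hvw⟩)
  have : w ∈ G.neighborSet v := by rw [hnb v (key W ha)]; exact hvw
  exact this

end SimpleGraph

/-! ### Rigidity in the absence of three removable edges -/

namespace FacetSystem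
variable {A B : Type*} {C : FacetSystem A B}

lemma edgeLink_symm (y y' : B) : C.edgeLink y y' = C.edgeLink y' y := by
  ext x x'
  exact ⟨C.swapB, C.swapB⟩

lemma HalfNormal.edgeLink_eq_of_le [Finite A] (hC : C.HalfNormal) {y y' z z' : B}
    (hle : C.edgeLink y y' ≤ C.edgeLink z z') {x x' : A} (h : C.Fac x x' y y') :
    C.edgeLink y y' = C.edgeLink z z' :=
  (hC.cycles y y').eq_of_le (hC.cycles z z') hle (hC.edgeLink_reachable z z') h

/-- There are no three edges in the first graph that are removable. -/
def NoRemovable (C : FacetSystem A B) : Prop :=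
  ¬ ∃ R ⊆ C.graph.edgeSet, R.ncard = 3 ∧ C.Removable R

lemma Normal.link_edges_le [Finite A] (hC : C.Normal) (hA : C.NoRemovable) (y : B) :
    (C.link y).edgeSet.ncard ≤ (C.link y).support.ncard + 1 := by
  by_contra hcon
  exact hA (hC.exists_removable_of_rank y 3 (by omega))

/-- The number of discs in the link of `y` is bounded by its Euler characteristic, as its graph has
cycle rank at most two. -/
lemma Normal.degree_le [Finite A] [Finite B] (hC : C.Normal) (hA : C.NoRemovable) (y : B) :
    (C.swap.graph.neighborSet y).ncard ≤ 3 := by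
  have h1 := hC.link_edges_le hA y
  have h2 := hC.link_euler y
  omega

/-- If the link of a vertex of degree three contains all edges, then the graph has cycle rank
two. -/
lemma Normal.edges_eq [Finite A] [Finite B] (hC : C.Normal) (hA : C.NoRemovable) {y : B}
    (hy : (C.swap.graph.neighborSet y).ncard = 3) (hall : C.graph ≤ C.link y) :
    C.graph.edgeSet.ncard = Nat.card A + 1 := by
  have h1 := hC.link_edges_le hA y
  have h2 := hC.link_euler y
  have h3 : C.link y = C.graph := le_antisymm (C.link_le_graph y) hall
  have h4 : C.graph.support = Set.univ := by
    ext x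
    simp only [Set.mem_univ, iff_true]
    exact (SimpleGraph.mem_support _).2 (hC.left.cover x)
  rw [h3, h4, Set.ncard_univ] at h1 h2
  omega

/-- The facets are the pairs of edges whose labels satisfy `J`, and the edges with a given label
form arcs. -/
structure ArcModel (C : FacetSystem A B) {ι : Type*} (J : ι → ι → Prop) where
  labA : Sym2 A → ι
  labB : Sym2 B → ι
  htA : A → ℝ
  htB : B → ℝ
  isHeightA : C.graph.IsHeight labA htA
  isHeightB : C.swap.graph.IsHeight labB htB
  fac_iff : ∀ x x' y y', C.Fac x x' y y' ↔
    C.graph.Adj x x' ∧ C.swap.graph.Adj y y' ∧ J (labA s(x, x')) (labB s(y, y'))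

/-- When all pairs of edges are joined, the whole graph is the link of a single edge, hence a cycle.
-/
lemma Normal.exists_isHeight_of_forall [Finite A] (hC : C.Normal)
    (hall : ∀ x x' y y', C.graph.Adj x x' → C.swap.graph.Adj y y' → C.Fac x x' y y') :
    ∃ (l : Sym2 A → Fin 2) (h : A → ℝ), C.graph.IsHeight l h := by
  obtain ⟨x⟩ := hC.left.connected.nonempty
  obtain ⟨x', y, y', h⟩ := hC.left.cover x
  have h1 : C.graph = C.edgeLink y y' :=
    le_antisymm (fun u v huv => hall u v y y' huv ⟨x, x', h⟩) (fun u v huv => ⟨y, y', huv⟩)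
  refine SimpleGraph.exists_isHeight_of_isCycles ?_ hC.left.connected fun v => hC.left.cover v
  rw [h1]
  exact hC.left.cycles y y'

lemma Normal.nonempty_arcModel_of_forall [Finite A] [Finite B] (hC : C.Normal)
    (hall : ∀ x x' y y', C.graph.Adj x x' → C.swap.graph.Adj y y' → C.Fac x x' y y') :
    Nonempty (C.ArcModel fun _ _ : Fin 2 => True) := by
  obtain ⟨la, ha, h1⟩ := hC.exists_isHeight_of_forall hall
  obtain ⟨lb, hb, h2⟩ := hC.swap.exists_isHeight_of_forall fun y y' x x' h h' =>
    hall x x' y y' h' h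
  exact ⟨⟨la, lb, ha, hb, h1, h2, fun x x' y y' =>
    ⟨fun h => ⟨⟨y, y', h⟩, ⟨x, x', h⟩, trivial⟩, fun h => hall x x' y y' h.1 h.2.1⟩⟩⟩

/-- If some edge of one graph is not joined to some edge of the other graph, then there is a
vertex `y` of degree three. -/
lemma Normal.exists_degree_three [Finite A] [Finite B] (hC : C.Normal) (hA : C.NoRemovable)
    (hall : ¬ ∀ x x' y y', C.graph.Adj x x' → C.swap.graph.Adj y y' → C.Fac x x' y y') :
    ∃ y, (C.swap.graph.neighborSet y).ncard = 3 := by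
  by_contra hcon
  apply hall
  -- With at most two edges at `y`, the two that an edge of its link meets are all of them. Hence
  -- edges at a common vertex have the same link, and connectedness spreads this to the whole graph.
  have heq : ∀ y z z', C.swap.graph.Adj y z → C.swap.graph.Adj y z' →
      C.edgeLink y z ≤ C.edgeLink y z' := by
    intro y z z' hz hz' x x' h
    have h1 := hC.ncard_edgeLink h
    have h2 : {w | C.Fac x x' y w} ⊆ C.swap.graph.neighborSet y := fun w hw => ⟨x, x', hw⟩
    have h3 := hC.degree_le hA y
    have h4 : (C.swap.graph.neighborSet y).ncard ≠ 3 := fun h => hcon ⟨y, h⟩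
    have h5 := Set.eq_of_subset_of_ncard_le h2 (by omega) (Set.toFinite _)
    have h6 : z' ∈ {w | C.Fac x x' y w} := by rw [h5]; exact hz'
    exact h6
  intro x x' y y' hx hy
  obtain ⟨z, z', hz⟩ := hx
  have key : ∀ {u v : B}, C.swap.graph.Walk u v → ∀ u' v', C.swap.graph.Adj u u' →
      C.swap.graph.Adj v v' → C.edgeLink u u' ≤ C.edgeLink v v' := by
    intro u v W
    induction W with
    | nil => exact fun u' v' hu hv => heq _ _ _ hu hv
    | @cons u c v huc _ ih =>
      intro u' v' hu hv
      refine (heq u u' c hu huc).trans ?_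
      rw [edgeLink_symm]
      exact ih u v' huc.symm hv
  obtain ⟨W⟩ := hC.right.connected z y
  exact key W z' y' ⟨x, x', hz⟩ hy hz

/-- Turns "exactly one index fails" into a label on unordered edges. For three indices this encodes
incidence as inequality of labels. -/
lemma exists_label_of_iff {ι V : Type*} [Nonempty ι] (G : SimpleGraph V) {P : ι → V → V → Prop}
    (hsymm : ∀ i v w, P i v w → P i w v)
    (hP : ∀ v w, G.Adj v w → ∃ i, ∀ j, j = i ↔ ¬ P j v w) :
    ∃ l : Sym2 V → ι, ∀ v w, G.Adj v w → ∀ i, P i v w ↔ l s(v, w) ≠ i := by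
  have key : ∀ e : Sym2 V, ∃ i : ι, ∀ v w, s(v, w) = e → G.Adj v w → ∀ j, j = i ↔ ¬ P j v w := by
    intro e
    induction e using Sym2.ind with
    | _ a b =>
      by_cases hab : G.Adj a b
      · obtain ⟨i, hi⟩ := hP a b hab
        refine ⟨i, fun v w hvw _ j => ?_⟩
        rcases Sym2.eq_iff.1 hvw with ⟨rfl, rfl⟩ | ⟨rfl, rfl⟩
        · exact hi j
        · rw [hi j, not_iff_not]
          exact ⟨hsymm _ _ _, hsymm _ _ _⟩
      · refine ⟨Classical.arbitrary ι, fun v w hvw h => absurd ?_ hab⟩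
        rcases Sym2.eq_iff.1 hvw with ⟨rfl, rfl⟩ | ⟨rfl, rfl⟩
        exacts [h, h.symm]
  choose l hl using key
  refine ⟨l, fun v w hvw i => ?_⟩
  have := hl s(v, w) v w rfl hvw i
  rw [ne_comm, Ne, this, not_not]

/-- If there are no removable triples of edges on either side, but some edge of one graph is not
joined to some edge of the other one, then both graphs are theta graphs, and facets are the pairs
of edges in arcs with different labels. -/
lemma Normal.nonempty_arcModel_of_not_forall [Finite A] [Finite B] (hC : C.Normal)
    (hA : C.NoRemovable) (hB : C.swap.NoRemovable)
    (hall : ¬ ∀ x x' y y', C.graph.Adj x x' → C.swap.graph.Adj y y' → C.Fac x x' y y') :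
    Nonempty (C.ArcModel fun i j : Fin 3 => i ≠ j) := by
  classical
  obtain ⟨y, hy⟩ := hC.exists_degree_three hA hall
  obtain ⟨e⟩ : Nonempty (Fin 3 ≃ C.swap.graph.neighborSet y) := by
    have : Nat.card (C.swap.graph.neighborSet y) = 3 := hy
    exact ⟨(Finite.equivFinOfCardEq this).symm⟩
  let z : Fin 3 → B := fun i => e i
  have hz : ∀ i, C.swap.graph.Adj y (z i) := fun i => (e i).2
  have hzinj : Function.Injective z := fun i j h => e.injective (Subtype.ext h)
  have hzsurj : ∀ w, C.swap.graph.Adj y w → ∃ i, z i = w := fun w hw =>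
    ⟨e.symm ⟨w, hw⟩, by simp [z]⟩
  -- every edge in the link of `y` misses exactly one `z i`
  have hmiss : ∀ x x', (C.link y).Adj x x' → ∃ i, ∀ j, j = i ↔ ¬ C.Fac x x' y (z j) := by
    rintro x x' ⟨w, h⟩
    have h1 := hC.ncard_edgeLink h
    have h2 : (Finset.univ.filter fun i => C.Fac x x' y (z i)).card = 2 := by
      have h3 : {w | C.Fac x x' y w} = ((Finset.univ.filter fun i => C.Fac x x' y (z i)).image z :
          Set B) := by
        ext w
        simp only [Finset.coe_image, Finset.coe_filter, Finset.mem_univ, true_and]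
        constructor
        · intro hw
          obtain ⟨i, rfl⟩ := hzsurj w ⟨x, x', hw⟩
          exact ⟨i, hw, rfl⟩
        · rintro ⟨i, hi, rfl⟩
          exact hi
      rw [h3, Set.ncard_coe_finset, Finset.card_image_of_injective _ hzinj] at h1
      exact h1
    have h4 : (Finset.univ.filter fun i => ¬ C.Fac x x' y (z i)).card = 1 := by
      have := Finset.card_filter_add_card_filter_not (s := (Finset.univ : Finset (Fin 3)))
        (fun i => C.Fac x x' y (z i))
      simp only [Finset.card_univ, Fintype.card_fin] at this
      omega
    obtain ⟨i, hi⟩ := Finset.card_eq_one.1 h4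
    refine ⟨i, fun j => ?_⟩
    have : j ∈ Finset.univ.filter (fun i => ¬ C.Fac x x' y (z i)) ↔ j ∈ ({i} : Finset (Fin 3)) := by
      rw [hi]
    simpa using this.symm
  have hthird : ∀ i j : Fin 3, ∃ k, k ≠ i ∧ k ≠ j := by decide
  -- every label occurs
  have hocc : ∀ i, ∃ x x', (C.link y).Adj x x' ∧ ∀ j, j = i ↔ ¬ C.Fac x x' y (z j) := by
    intro i
    by_contra hcon
    -- If no edge missed `z i`, the cycle around `{y, z i}` would contain those around the other
    -- edges at `y`. As cycles have no proper subcycles all three would coincide, and their edges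
    -- would miss none of the `z j`.
    have hfull : ∀ x x', (C.link y).Adj x x' → C.Fac x x' y (z i) := by
      intro x x' h
      obtain ⟨k, hk⟩ := hmiss x x' h
      by_contra hc
      have := (hk i).2 hc
      subst this
      exact hcon ⟨x, x', h, hk⟩
    obtain ⟨j, hj, -⟩ := hthird i i
    obtain ⟨k, hki, hkj⟩ := hthird i j
    have heq : ∀ m, C.edgeLink y (z m) = C.edgeLink y (z i) := by
      intro m
      obtain ⟨x, x', h⟩ := hz m
      exact hC.left.edgeLink_eq_of_le (fun u u' hu => hfull u u' ⟨_, hu⟩) h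
    obtain ⟨x, x', h⟩ := hz i
    have h' : (C.edgeLink y (z i)).Adj x x' := h
    obtain ⟨m, hm⟩ := hmiss x x' ⟨_, h⟩
    have h2 : ∀ n, C.Fac x x' y (z n) := fun n => by
      have : (C.edgeLink y (z n)).Adj x x' := by rw [heq n]; exact h'
      exact this
    exact (hm m).1 rfl (h2 m)
  choose a a' haa ha using hocc
  have haF : ∀ i j, C.Fac (a i) (a' i) y (z j) ↔ j ≠ i := fun i j => by
    rw [Ne, ha i j, not_not]
  -- The ban on triangular systems becomes an exchange rule that forces an incidence.
  have htri : ∀ {x₁ x₁' x₂ x₂' x₃ x₃' : A} {y₁ y₁' y₂ y₂' y₃ y₃' : B}, C.Fac x₁ x₁' y₁ y₁' →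
      C.Fac x₂ x₂' y₂ y₂' → C.Fac x₃ x₃' y₃ y₃' → ¬ C.Fac x₁ x₁' y₂ y₂' →
      ¬ C.Fac x₁ x₁' y₃ y₃' → C.Fac x₂ x₂' y₃ y₃' := by
    intro x₁ x₁' x₂ x₂' x₃ x₃' y₁ y₁' y₂ y₂' y₃ y₃' h1 h2 h3 h4 h5
    by_contra h6
    exact hA (hC.left.removable_of_triangular h1 h2 h3 h4 h5 h6)
  -- the link of `y` contains all edges
  have hlink : C.graph ≤ C.link y := by
    rintro x x' ⟨c, d, h⟩
    by_contra hcon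
    -- An edge outside the link of `y` is joined neither to `{y, z 0}` nor to `{y, z 1}`. The
    -- exchange rule then joins `a 1` to the very `z 1` that it misses.
    have h1 : C.Fac (a 1) (a' 1) y (z 1) := htri h ((haF 1 0).2 (by decide))
      ((haF 0 1).2 (by decide)) (fun h => hcon ⟨_, h⟩) (fun h => hcon ⟨_, h⟩)
    exact (haF 1 1).1 h1 rfl
  obtain ⟨la, hla⟩ := exists_label_of_iff C.graph (P := fun i x x' => C.Fac x x' y (z i))
    (fun _ _ _ h => C.swapA h) (fun x x' h => hmiss x x' (hlink h))
  have hlaa : ∀ i, la s(a i, a' i) = i := by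
    intro i
    by_contra hc
    have := (hla _ _ (C.link_le_graph y (haa i)) i).2 hc
    exact (haF i i).1 this rfl
  -- whether an edge is joined to an edge of the other graph depends only on the label
  have hdep : ∀ {x x' u u' : A} {c d : B}, C.Fac x x' c d → C.graph.Adj u u' →
      la s(u, u') = la s(x, x') → C.Fac u u' c d := by
    intro x x' u u' c d h hu hl
    by_contra hcon
    have hx : C.graph.Adj x x' := ⟨c, d, h⟩
    obtain ⟨j, hj, -⟩ := hthird (la s(x, x')) (la s(x, x'))
    -- The exchange rule is applied to the pairs (u, `{y, z j}`), (x, `{c, d}`) and (`a j`, `{y, z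
    -- i}`), where `i` is the common label of the edges of `u` and `x` and `j ≠ i`. It joins `x` to
    -- the `z i` that `x` misses.
    have h1 : C.Fac u u' y (z j) := (hla u u' hu j).2 (by rw [hl]; exact hj.symm)
    have h2 : C.Fac (a j) (a' j) y (z (la s(x, x'))) := (haF _ _).2 hj.symm
    have h3 : ¬ C.Fac u u' y (z (la s(x, x'))) := fun h' => (hla u u' hu _).1 h' hl
    exact (hla x x' hx _).1 (htri h1 h h2 hcon h3) rfl
  -- every edge of the other graph misses exactly one label
  have hmissB : ∀ c d, C.swap.graph.Adj c d → ∃ i, ∀ j, j = i ↔ ¬ C.Fac (a j) (a' j) c d := by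
    rintro c d ⟨x, x', h⟩
    have hx : C.graph.Adj x x' := ⟨c, d, h⟩
    set i := la s(x, x') with hi
    have hai : C.Fac (a i) (a' i) c d :=
      hdep h (C.link_le_graph y (haa i)) (by rw [hlaa])
    -- If no label were missed, the link of `{c, d}` would properly contain the cycle around `{y, z
    -- 0}`.
    have hsome : ∃ m, ¬ C.Fac (a m) (a' m) c d := by
      by_contra hcon
      push Not at hcon
      obtain ⟨x₀, x₀', h₀⟩ := hz 0
      have hle : C.edgeLink y (z 0) ≤ C.edgeLink c d := fun u u' hu =>
        hdep (hcon (la s(u, u'))) ⟨_, _, hu⟩ (by rw [hlaa])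
      have heq := hC.left.edgeLink_eq_of_le hle h₀
      have h1 : (C.edgeLink c d).Adj (a 0) (a' 0) := hcon 0
      rw [← heq] at h1
      exact (haF 0 0).1 h1 rfl
    obtain ⟨m, hm⟩ := hsome
    have hmi : m ≠ i := by rintro rfl; exact hm hai
    obtain ⟨k, hki, hkm⟩ := hthird i m
    -- If two labels were missed, the link of `{c, d}` would be properly contained in a cycle around
    -- some `{y, z m}`.
    have hk : C.Fac (a k) (a' k) c d := by
      by_contra hk
      have hle : C.edgeLink c d ≤ C.edgeLink y (z m) := by
        intro u u' hu
        have hu' : C.graph.Adj u u' := ⟨c, d, hu⟩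
        refine (hla u u' hu' m).2 fun hum => hm ?_
        exact hdep hu (C.link_le_graph y (haa m)) (by rw [hlaa, hum])
      have heq := hC.left.edgeLink_eq_of_le hle h
      have h1 : (C.edgeLink y (z m)).Adj (a k) (a' k) := (haF k m).2 hkm.symm
      rw [← heq] at h1
      exact hk h1
    refine ⟨m, fun j => ⟨by rintro rfl; exact hm, fun hj => ?_⟩⟩
    by_contra hjm
    have : j = i ∨ j = k := by omega
    rcases this with rfl | rfl
    exacts [hj hai, hj hk]
  obtain ⟨lb, hlb⟩ := exists_label_of_iff C.swap.graph
    (P := fun i c d => C.Fac (a i) (a' i) c d) (fun _ _ _ h => C.swapB h) hmissB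
  have hfac : ∀ x x' c d, C.Fac x x' c d ↔
      C.graph.Adj x x' ∧ C.swap.graph.Adj c d ∧ la s(x, x') ≠ lb s(c, d) := by
    intro x x' c d
    constructor
    · intro h
      have hx : C.graph.Adj x x' := ⟨c, d, h⟩
      have hc : C.swap.graph.Adj c d := ⟨x, x', h⟩
      refine ⟨hx, hc, ?_⟩
      have := hdep (u := a (la s(x, x'))) (u' := a' (la s(x, x'))) h
        (C.link_le_graph y (haa _)) (by rw [hlaa])
      exact ((hlb c d hc _).1 this).symm
    · rintro ⟨hx, hc, hne⟩
      exact hdep ((hlb c d hc (la s(x, x'))).2 hne.symm) hx (by rw [hlaa])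
  have hgA : ∀ i, C.graph.Adj (a i) (a' i) := fun i => C.link_le_graph y (haa i)
  have hlbz : ∀ i, lb s(y, z i) = i := by
    intro i
    by_contra hc
    have := (hlb y (z i) (hz i) i).2 hc
    exact (haF i i).1 this rfl
  -- the arcs of the first graph
  obtain ⟨p, q, harcA, hlabA⟩ := SimpleGraph.exists_isArc_of_theta (G := C.graph) (l := la)
    (fun v => hC.left.cover v) (hC.edges_eq hA hy hlink) (Z := fun i => C.edgeLink y (z i))
    (fun i v w => by
      rw [show (C.edgeLink y (z i)).Adj v w ↔ C.Fac v w y (z i) from Iff.rfl, hfac, hlbz]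
      exact ⟨fun h => ⟨h.1, h.2.2⟩, fun h => ⟨h.1, hz i, h.2⟩⟩)
    (fun i => hC.left.cycles _ _) (fun i => hC.left.edgeLink_reachable _ _)
    (fun i => ⟨_, _, hgA i, hlaa i⟩)
  -- the link of the branch point `p` in the other graph is everything
  have hpex : ∀ i, ∃ p', C.graph.Adj p p' ∧ la s(p, p') = i := by
    intro i
    have : ((C.graph.labelGraph la i).neighborSet p).Nonempty := by
      rw [← Set.ncard_pos (Set.toFinite _), (harcA i).left]; omega
    exact this
  choose p' hp' hp'l using hpex
  have hlinkB : C.swap.graph ≤ C.swap.link p := by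
    intro c d hcd
    obtain ⟨k, hk, -⟩ := hthird (lb s(c, d)) (lb s(c, d))
    exact ⟨p' k, (hfac _ _ _ _).2 ⟨hp' k, hcd, by rw [hp'l]; exact hk⟩⟩
  -- The branch point takes over the role of `y` for the other graph: its three arcs give degree at
  -- least 3, and the absence of removable triples on that side gives at most 3.
  have hpdeg : (C.swap.swap.graph.neighborSet p).ncard = 3 := by
    refine le_antisymm (hC.swap.degree_le hB p) ?_
    have h1 : ((Finset.univ.image p' : Finset A) : Set A) ⊆ C.swap.swap.graph.neighborSet p := by
      intro w hw
      simp only [Finset.coe_image, Finset.coe_univ, Set.image_univ, Set.mem_range] at hw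
      obtain ⟨i, rfl⟩ := hw
      exact hp' i
    have h2 := Set.ncard_le_ncard h1 (Set.toFinite _)
    rw [Set.ncard_coe_finset, Finset.card_image_of_injective _ fun i j hij => by
      rw [← hp'l i, ← hp'l j, hij]] at h2
    simpa using h2
  obtain ⟨p₂, q₂, harcB, hlabB⟩ := SimpleGraph.exists_isArc_of_theta (G := C.swap.graph) (l := lb)
    (fun v => hC.right.cover v) (hC.swap.edges_eq hB hpdeg hlinkB)
    (Z := fun i => C.swap.edgeLink (a i) (a' i))
    (fun i v w => by
      rw [show (C.swap.edgeLink (a i) (a' i)).Adj v w ↔ C.Fac (a i) (a' i) v w from Iff.rfl, hfac,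
        hlaa]
      exact ⟨fun h => ⟨h.2.1, h.2.2.symm⟩, fun h => ⟨hgA i, h.1, h.2.symm⟩⟩)
    (fun i => hC.right.cycles _ _) (fun i => hC.right.edgeLink_reachable _ _)
    (fun i => ⟨_, _, hz i, hlbz i⟩)
  obtain ⟨ha, hha⟩ := SimpleGraph.exists_isHeight harcA (fun v => hC.left.cover v) hlabA
  obtain ⟨hb, hhb⟩ := SimpleGraph.exists_isHeight harcB (fun v => hC.right.cover v) hlabB
  exact ⟨⟨la, lb, ha, hb, hha, hhb, hfac⟩⟩

end FacetSystem

/-! ### Planar fans and the homeomorphism with the 3-sphere -/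

/-- Every vector of the plane has a unique expression `s • U i + t • U' j` with `J i j` and
nonnegative coefficients. -/
structure IsFan {ι : Type*} (J : ι → ι → Prop) (U U' : ι → ℝ × ℝ) : Prop where
  exists_rep : ∀ w, ∃ i j, ∃ s t : ℝ, J i j ∧ 0 ≤ s ∧ 0 ≤ t ∧ w = s • U i + t • U' j
  unique : ∀ (i j : ι) (s t : ℝ) (i' j' : ι) (s' t' : ℝ), J i j → J i' j' → 0 ≤ s → 0 ≤ t → 0 ≤ s' → 0 ≤ t' →
    s • U i + t • U' j = s' • U i' + t' • U' j' →
    s = s' ∧ t = t' ∧ (0 < s → i = i') ∧ (0 < t → j = j')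

lemma isFan_quadrants : IsFan (fun _ _ : Fin 2 => True) ![(1, 0), (-1, 0)] ![(0, 1), (0, -1)] where
  exists_rep := by
    rintro ⟨a, b⟩
    rcases le_total 0 a with ha | ha <;> rcases le_total 0 b with hb | hb
    · exact ⟨0, 0, a, b, trivial, ha, hb, by simp⟩
    · exact ⟨0, 1, a, -b, trivial, ha, by linarith, by simp⟩
    · exact ⟨1, 0, -a, b, trivial, by linarith, hb, by simp⟩
    · exact ⟨1, 1, -a, -b, trivial, by linarith, by linarith, by simp⟩
  unique := by
    intro i j s t i' j' s' t' _ _ hs ht hs' ht' h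
    have h1 := congrArg Prod.fst h
    have h2 := congrArg Prod.snd h
    refine ⟨?_, ?_, fun h0 => ?_, fun h0 => ?_⟩
    · fin_cases i <;> fin_cases i' <;> simp at h1 <;> fin_cases j <;> fin_cases j' <;>
        simp at h1 <;> linarith
    · fin_cases j <;> fin_cases j' <;> fin_cases i <;> fin_cases i' <;> simp at h2 <;> linarith
    · by_contra hne
      fin_cases i <;> fin_cases i' <;> simp at hne <;> fin_cases j <;> fin_cases j' <;>
        simp at h1 <;> linarith
    · by_contra hne
      fin_cases j <;> fin_cases j' <;> simp at hne <;> fin_cases i <;> fin_cases i' <;>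
        simp at h2 <;> linarith

/-- The rays `U` and `U'` alternate around the origin, with `U' j = -U j`; the six sectors between
neighbouring rays are exactly the pairs of different labels. -/
lemma isFan_hexagon : IsFan (fun i j : Fin 3 => i ≠ j) ![(1, 0), (0, 1), (-1, -1)]
    ![(-1, 0), (0, -1), (1, 1)] where
  exists_rep := by
    rintro ⟨a, b⟩
    rcases le_total 0 a with ha | ha <;> rcases le_total 0 b with hb | hb
    · rcases le_total a b with hab | hab
      · exact ⟨1, 2, b - a, a, by decide, by linarith, ha, by simp⟩
      · exact ⟨0, 2, a - b, b, by decide, by linarith, hb, by simp⟩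
    · exact ⟨0, 1, a, -b, by decide, ha, by linarith, by simp⟩
    · exact ⟨1, 0, b, -a, by decide, hb, by linarith, by simp⟩
    · rcases le_total a b with hab | hab
      · exact ⟨2, 0, -b, b - a, by decide, by linarith, by linarith, by simp⟩
      · exact ⟨2, 1, -a, a - b, by decide, by linarith, by linarith, by simp⟩
  unique := by
    intro i j s t i' j' s' t' hij hij' hs ht hs' ht' h
    have h1 := congrArg Prod.fst h
    have h2 := congrArg Prod.snd h
    have key : s = s' ∧ t = t' ∧ (i ≠ i' → s = 0) ∧ (j ≠ j' → t = 0) := by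
      fin_cases i <;> fin_cases j <;> first | (exfalso; exact hij rfl) | skip
      all_goals fin_cases i' <;> fin_cases j' <;> first | (exfalso; exact hij' rfl) | skip
      all_goals
        simp at h1 h2
        refine ⟨by linarith, by linarith, ?_, ?_⟩ <;> intro hne <;>
          first | exact absurd rfl hne | linarith
    obtain ⟨e1, e2, e3, e4⟩ := key
    refine ⟨e1, e2, fun h0 => ?_, fun h0 => ?_⟩
    · by_contra hne; exact h0.ne' (e3 hne)
    · by_contra hne; exact h0.ne' (e4 hne)

namespace SimpleGraph.IsHeight
variable {V ι : Type*} {G : SimpleGraph V} {l : Sym2 V → ι} {h : V → ℝ}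

lemma abs_add_le (hh : G.IsHeight l h) {x x' : V} {α β : ℝ} (hα : 0 ≤ α) (hβ : 0 ≤ β) :
    |α * h x + β * h x'| ≤ α + β := by
  have h1 := hh.abs_le x
  have h2 := hh.abs_le x'
  calc |α * h x + β * h x'| ≤ |α * h x| + |β * h x'| := _root_.abs_add_le _ _
    _ = α * |h x| + β * |h x'| := by rw [abs_mul, abs_mul, abs_of_nonneg hα, abs_of_nonneg hβ]
    _ ≤ α + β := by nlinarith

/-- A point of an edge of extremal height is an end point of all arcs. -/
lemma exists_vertex (hh : G.IsHeight l h) {x x' : V} (hx : G.Adj x x') {α β : ℝ} (hα : 0 ≤ α)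
    (hβ : 0 ≤ β) (heq : α + β = |α * h x + β * h x'|) :
    ∃ v, (α + β = 0 ∨ |h v| = 1) ∧ ∀ f : V → ℝ, α * f x + β * f x' = (α + β) * f v := by
  have h1 := hh.abs_le x
  have h2 := hh.abs_le x'
  have h3 : |α * h x + β * h x'| ≤ α * |h x| + β * |h x'| := by
    calc |α * h x + β * h x'| ≤ |α * h x| + |β * h x'| := _root_.abs_add_le _ _
      _ = α * |h x| + β * |h x'| := by rw [abs_mul, abs_mul, abs_of_nonneg hα, abs_of_nonneg hβ]
  have h4 : 0 ≤ α * (1 - |h x|) := mul_nonneg hα (by linarith)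
  have h5 : 0 ≤ β * (1 - |h x'|) := mul_nonneg hβ (by linarith)
  have h6 : α * (1 - |h x|) = 0 := by linarith
  have h7 : β * (1 - |h x'|) = 0 := by linarith
  rcases mul_eq_zero.1 h6 with h8 | h8
  · rcases mul_eq_zero.1 h7 with h9 | h9
    · exact ⟨x, Or.inl (by linarith), fun f => by rw [h8, h9]; ring⟩
    · exact ⟨x', Or.inr (by linarith), fun f => by rw [h8]; ring⟩
  · rcases mul_eq_zero.1 h7 with h9 | h9
    · exact ⟨x, Or.inr (by linarith), fun f => by rw [h9]; ring⟩
    · have e1 : |h x| = 1 := by linarith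
      have e2 : |h x'| = 1 := by linarith
      have hne : h x ≠ h x' := fun e => hx.ne (hh.eq_of_abs x x' e1 e)
      have hopp : h x' = -h x := by
        rcases abs_eq_abs.1 (e1.trans e2.symm) with e | e
        · exact absurd e hne
        · linarith
      have e3 : |α * h x + β * h x'| = |α - β| := by
        rw [hopp, show α * h x + β * -h x = (α - β) * h x by ring, abs_mul, e1, mul_one]
      rw [e3] at heq
      rcases le_total 0 (α - β) with e | e
      · rw [abs_of_nonneg e] at heq
        exact ⟨x, Or.inr e1, fun f => by rw [show β = 0 by linarith]; ring⟩
      · rw [abs_of_nonpos e] at heq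
        exact ⟨x', Or.inr e2, fun f => by rw [show α = 0 by linarith]; ring⟩

/-- Mass and weighted height determine a point of the cone over one arc. When the mass equals the
absolute height, the point is an end point common to all arcs, or has mass zero, so the label is not
needed. -/
lemma eq_of_mass_height (hh : G.IsHeight l h) {x x' z z' : V} (hx : G.Adj x x') (hz : G.Adj z z')
    {α β γ δ : ℝ} (hα : 0 ≤ α) (hβ : 0 ≤ β) (hγ : 0 ≤ γ) (hδ : 0 ≤ δ) (hm : α + β = γ + δ)
    (hht : α * h x + β * h x' = γ * h z + δ * h z')
    (hl : 0 < α + β - |α * h x + β * h x'| → l s(x, x') = l s(z, z')) (f : V → ℝ) :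
    α * f x + β * f x' = γ * f z + δ * f z' := by
  rcases (sub_nonneg.2 (hh.abs_add_le (x := x) (x' := x') hα hβ)).eq_or_lt with h0 | h0
  · obtain ⟨v, hv, hvf⟩ := hh.exists_vertex hx hα hβ (by linarith)
    obtain ⟨w, hw, hwf⟩ := hh.exists_vertex hz hγ hδ (by rw [← hm, ← hht]; linarith)
    rw [hvf, hwf, ← hm]
    rcases hv with hv | hv
    · simp [hv]
    · by_cases hmz : α + β = 0
      · simp [hmz]
      · rw [hvf, hwf, ← hm] at hht
        rw [hh.eq_of_abs v w hv (mul_left_cancel₀ hmz hht)]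
  · exact hh.inj x x' z z' α β γ δ hx hz (hl h0) hα hβ hγ hδ hm hht f

variable [Fintype V]

open Classical in
/-- The map to the plane that stretches the arc with label `i` along the ray spanned by `U i`. -/
noncomputable def arcMap (G : SimpleGraph V) (l : Sym2 V → ι) (h : V → ℝ) (U : ι → ℝ × ℝ)
    (nb : V → V) (b : V → ℝ) : ℝ × ℝ :=
  ∑ v, ((1 - |h v|) * b v) • U (l s(v, nb v)) + (1 / 2 : ℝ) • ∑ v, ∑ w,
    if G.Adj v w then (|h v| * b v + |h w| * b w - |h v * b v + h w * b w|) • U (l s(v, w)) else 0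

/-- The reason for a single formula valid on all of `V → ℝ`: continuity needs no gluing of facets.
-/
lemma continuous_arcMap (U : ι → ℝ × ℝ) (nb : V → V) : Continuous (arcMap G l h U nb) := by
  unfold arcMap
  refine Continuous.add (continuous_finsetSum _ fun v _ => by fun_prop) (Continuous.fun_const_smul
    (continuous_finsetSum _ fun v _ => continuous_finsetSum _ fun w _ => ?_) _)
  split_ifs <;> fun_prop

lemma sum_eq_of_support {M : Type*} [AddCommMonoid M] {x x' : V} (hne : x ≠ x') {b : V → ℝ}
    (hb : ∀ v, b v ≠ 0 → v = x ∨ v = x') (F : V → M) (hF : ∀ v, b v = 0 → F v = 0) :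
    ∑ v, F v = F x + F x' := by
  refine Fintype.sum_eq_add x x' hne fun v hv => hF v ?_
  by_contra hc
  rcases hb v hc with h | h
  exacts [hv.1 h, hv.2 h]

-- On one edge only that edge contributes to the double sum, twice, which the factor 1/2 undoes; its
-- term corrects for end points with heights of opposite signs. At an end point of the arcs the
-- coefficient `1 - |h v|` kills the ambiguity of the label of `nb v`.
open Classical in
lemma arcMap_eq (hh : G.IsHeight l h) (U : ι → ℝ × ℝ) {nb : V → V} (hnb : ∀ v, G.Adj v (nb v))
    {b : V → ℝ} (hb0 : ∀ v, 0 ≤ b v) {x x' : V} (hx : G.Adj x x')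
    (hb : ∀ v, b v ≠ 0 → v = x ∨ v = x') :
    arcMap G l h U nb b = (b x + b x' - |b x * h x + b x' * h x'|) • U (l s(x, x')) := by
  have h1 : ∀ v w, G.Adj v w →
      ((1 - |h v|) * b v) • U (l s(v, nb v)) = ((1 - |h v|) * b v) • U (l s(v, w)) := by
    intro v w hvw
    by_cases hl : l s(v, nb v) = l s(v, w)
    · rw [hl]
    · rw [hh.abs_eq v _ _ (hnb v) hvw hl]; simp
  have habs : ∀ v, |h v * b v| = |h v| * b v := fun v => by rw [abs_mul, abs_of_nonneg (hb0 v)]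
  have hbz : ∀ v, v ≠ x → v ≠ x' → b v = 0 := by
    intro v h1 h2
    by_contra hc
    rcases hb v hc with h | h
    exacts [h1 h, h2 h]
  have hinner : ∀ v w, G.Adj v w → v = x ∧ w = x' ∨ v = x' ∧ w = x → (∑ w, if G.Adj v w then
      (|h v| * b v + |h w| * b w - |h v * b v + h w * b w|) • U (l s(v, w)) else 0) =
      (|h v| * b v + |h w| * b w - |h v * b v + h w * b w|) • U (l s(v, w)) := by
    intro v w hvw hvx
    rw [Fintype.sum_eq_single w, if_pos hvw]
    intro u hu
    split_ifs with hvu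
    · have : b u = 0 := by
        rcases hvx with ⟨rfl, rfl⟩ | ⟨rfl, rfl⟩
        · exact hbz u hvu.ne.symm hu
        · exact hbz u hu hvu.ne.symm
      simp [this, habs]
    · rfl
  unfold arcMap
  rw [sum_eq_of_support hx.ne hb _ fun v hv => by simp [hv],
    sum_eq_of_support hx.ne hb _ fun v hv => by
      refine Finset.sum_eq_zero fun w _ => ?_
      split_ifs
      · simp [hv, habs]
      · rfl,
    hinner x x' hx (Or.inl ⟨rfl, rfl⟩), hinner x' x hx.symm (Or.inr ⟨rfl, rfl⟩),
    h1 x x' hx, h1 x' x hx.symm, Sym2.eq_swap (a := x') (b := x)]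
  simp only [← add_smul, smul_smul]
  congr 1
  rw [add_comm (h x' * b x'), mul_comm (b x), mul_comm (b x')]
  ring

end SimpleGraph.IsHeight

/-- Normalising is a continuous bijection from a compact space to a Hausdorff one. -/
lemma nonempty_homeomorph_sphere_of_radial {X E : Type*} [TopologicalSpace X] [CompactSpace X]
    [NormedAddCommGroup E] [NormedSpace ℝ E] {Φ : X → E} (hΦ : Continuous Φ) (h0 : ∀ x, Φ x ≠ 0)
    (hinj : ∀ x y, ∀ t : ℝ, 0 ≤ t → Φ x = t • Φ y → x = y)
    (hsurj : ∀ w, w ≠ 0 → ∃ x, ∃ t : ℝ, 0 < t ∧ Φ x = t • w) :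
    Nonempty (X ≃ₜ Metric.sphere (0 : E) 1) := by
  have hmem : ∀ x, ‖Φ x‖⁻¹ • Φ x ∈ Metric.sphere (0 : E) 1 := fun x => by
    rw [mem_sphere_zero_iff_norm, norm_smul, norm_inv, norm_norm,
      inv_mul_cancel₀ (norm_ne_zero_iff.2 (h0 x))]
  let f : X → Metric.sphere (0 : E) 1 := fun x => ⟨‖Φ x‖⁻¹ • Φ x, hmem x⟩
  have hf : Continuous f :=
    ((hΦ.norm.inv₀ fun x => norm_ne_zero_iff.2 (h0 x)).smul hΦ).subtype_mk hmem
  have hbij : Function.Bijective f := by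
    constructor
    · intro x y hxy
      have h1 : ‖Φ x‖⁻¹ • Φ x = ‖Φ y‖⁻¹ • Φ y := congrArg Subtype.val hxy
      refine hinj x y (‖Φ x‖ * ‖Φ y‖⁻¹) (by positivity) ?_
      rw [mul_smul, ← h1, smul_smul, mul_inv_cancel₀ (norm_ne_zero_iff.2 (h0 x)), one_smul]
    · rintro ⟨w, hw⟩
      rw [mem_sphere_zero_iff_norm] at hw
      have hw0 : w ≠ 0 := by rintro rfl; simp at hw
      obtain ⟨x, t, ht, hxt⟩ := hsurj w hw0
      refine ⟨x, Subtype.ext ?_⟩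
      change ‖Φ x‖⁻¹ • Φ x = w
      rw [hxt, norm_smul, hw, mul_one, Real.norm_of_nonneg ht.le, smul_smul,
        inv_mul_cancel₀ ht.ne', one_smul]
  exact ⟨Continuous.homeoOfEquivCompactToT2 (f := Equiv.ofBijective f hbij) hf⟩

namespace FacetSystem.ArcModel
open SimpleGraph.IsHeight
variable {A B ι : Type*} [Fintype A] [Fintype B] {C : FacetSystem A B} {J : ι → ι → Prop}

/-- The map of the realization to Euclidean space whose radial projection is a homeomorphism onto
the sphere. -/
noncomputable def toEuclidean (m : C.ArcModel J) (U U' : ι → ℝ × ℝ) (na : A → A) (nb : B → B)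
    (b : A ⊕ B → ℝ) : EuclideanSpace ℝ (Fin 4) :=
  WithLp.toLp 2 ![
    (arcMap C.graph m.labA m.htA U na (fun x => b (.inl x)) +
      arcMap C.swap.graph m.labB m.htB U' nb (fun y => b (.inr y))).1,
    (arcMap C.graph m.labA m.htA U na (fun x => b (.inl x)) +
      arcMap C.swap.graph m.labB m.htB U' nb (fun y => b (.inr y))).2,
    ∑ x, b (.inl x) * m.htA x, ∑ y, b (.inr y) * m.htB y]

lemma continuous_toEuclidean (m : C.ArcModel J) (U U' : ι → ℝ × ℝ) (na : A → A) (nb : B → B) :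
    Continuous (m.toEuclidean U U' na nb) := by
  have h1 : Continuous fun b : A ⊕ B → ℝ => arcMap C.graph m.labA m.htA U na (fun x => b (.inl x)) :=
    (continuous_arcMap U na).comp (by fun_prop)
  have h2 : Continuous fun b : A ⊕ B → ℝ =>
      arcMap C.swap.graph m.labB m.htB U' nb (fun y => b (.inr y)) :=
    (continuous_arcMap U' nb).comp (by fun_prop)
  refine (PiLp.continuous_toLp 2 _).comp (continuous_pi fun i => ?_)
  fin_cases i
  · exact continuous_fst.comp (h1.add h2)
  · exact continuous_snd.comp (h1.add h2)
  · exact continuous_finsetSum _ fun v _ => by fun_prop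
  · exact continuous_finsetSum _ fun v _ => by fun_prop

lemma exists_fac_of_mem_realization [DecidableEq A] [DecidableEq B] {b : A ⊕ B → ℝ}
    (hb : b ∈ Realization C.simplices) : ∃ x x' y y', C.Fac x x' y y' ∧ (∀ v, 0 ≤ b v) ∧
      (∀ v, b (.inl v) ≠ 0 → v = x ∨ v = x') ∧ (∀ v, b (.inr v) ≠ 0 → v = y ∨ v = y') ∧
      b (.inl x) + b (.inl x') + (b (.inr y) + b (.inr y')) = 1 := by
  obtain ⟨_, ⟨x, x', y, y', hf, rfl⟩, h0, h1, h2⟩ := mem_realization.1 hb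
  have hA : ∀ v, b (.inl v) ≠ 0 → v = x ∨ v = x' := fun v hv => by simpa using h2 _ hv
  have hB : ∀ v, b (.inr v) ≠ 0 → v = y ∨ v = y' := fun v hv => by simpa using h2 _ hv
  refine ⟨x, x', y, y', hf, h0, hA, hB, ?_⟩
  rw [← h1, Fintype.sum_sum_type,
    sum_eq_of_support (C.neA hf) hA (fun v => b (.inl v)) fun _ h => h,
    sum_eq_of_support (C.neB hf) hB (fun v => b (.inr v)) fun _ h => h]

lemma toEuclidean_eq (m : C.ArcModel J) (U U' : ι → ℝ × ℝ) {na : A → A} {nb : B → B}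
    (hna : ∀ v, C.graph.Adj v (na v)) (hnb : ∀ v, C.swap.graph.Adj v (nb v)) {b : A ⊕ B → ℝ}
    (h0 : ∀ v, 0 ≤ b v) {x x' : A} {y y' : B} (hf : C.Fac x x' y y')
    (hA : ∀ v, b (.inl v) ≠ 0 → v = x ∨ v = x') (hB : ∀ v, b (.inr v) ≠ 0 → v = y ∨ v = y')
    {w : ℝ × ℝ} (hw : w = (b (.inl x) + b (.inl x') -
        |b (.inl x) * m.htA x + b (.inl x') * m.htA x'|) • U (m.labA s(x, x')) +
      (b (.inr y) + b (.inr y') -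
        |b (.inr y) * m.htB y + b (.inr y') * m.htB y'|) • U' (m.labB s(y, y'))) :
    m.toEuclidean U U' na nb b = WithLp.toLp 2 ![w.1, w.2,
      b (.inl x) * m.htA x + b (.inl x') * m.htA x',
      b (.inr y) * m.htB y + b (.inr y') * m.htB y'] := by
  have hx : C.graph.Adj x x' := ⟨y, y', hf⟩
  have hy : C.swap.graph.Adj y y' := ⟨x, x', hf⟩
  rw [toEuclidean, arcMap_eq m.isHeightA U hna (fun v => h0 _) hx hA,
    arcMap_eq m.isHeightB U' hnb (fun v => h0 _) hy hB, ← hw,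
    sum_eq_of_support hx.ne hA (fun v => b (.inl v) * m.htA v) fun v h => by simp [h],
    sum_eq_of_support hy.ne hB (fun v => b (.inr v) * m.htB v) fun v h => by simp [h]]

lemma eq_of_toEuclidean_eq_smul [DecidableEq A] [DecidableEq B] (m : C.ArcModel J)
    {U U' : ι → ℝ × ℝ} (hU : IsFan J U U') {na : A → A} {nb : B → B}
    (hna : ∀ v, C.graph.Adj v (na v)) (hnb : ∀ v, C.swap.graph.Adj v (nb v)) {b c : A ⊕ B → ℝ}
    (hb : b ∈ Realization C.simplices) (hc : c ∈ Realization C.simplices) {t : ℝ} (ht : 0 ≤ t)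
    (h : m.toEuclidean U U' na nb b = t • m.toEuclidean U U' na nb c) : b = c := by
  obtain ⟨x, x', y, y', hf, h0, hA, hB, h1⟩ := exists_fac_of_mem_realization hb
  obtain ⟨z, z', u, u', hg, k0, kA, kB, k1⟩ := exists_fac_of_mem_realization hc
  rw [m.toEuclidean_eq U U' hna hnb h0 hf hA hB rfl,
    m.toEuclidean_eq U U' hna hnb k0 hg kA kB rfl] at h
  have hx : C.graph.Adj x x' := ⟨y, y', hf⟩
  have hy : C.swap.graph.Adj y y' := ⟨x, x', hf⟩
  have hz : C.graph.Adj z z' := ⟨u, u', hg⟩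
  have hu : C.swap.graph.Adj u u' := ⟨z, z', hg⟩
  have e0 := congrArg (fun f : EuclideanSpace ℝ (Fin 4) => f 0) h
  have e1 := congrArg (fun f : EuclideanSpace ℝ (Fin 4) => f 1) h
  have e2 := congrArg (fun f : EuclideanSpace ℝ (Fin 4) => f 2) h
  have e3 := congrArg (fun f : EuclideanSpace ℝ (Fin 4) => f 3) h
  simp only [PiLp.smul_apply, Matrix.cons_val, smul_eq_mul] at e0 e1 e2 e3
  have pA := sub_nonneg.2 (m.isHeightA.abs_add_le (x := x) (x' := x') (h0 (.inl x)) (h0 (.inl x')))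
  have pB := sub_nonneg.2 (m.isHeightB.abs_add_le (x := y) (x' := y') (h0 (.inr y)) (h0 (.inr y')))
  have qA := sub_nonneg.2 (m.isHeightA.abs_add_le (x := z) (x' := z') (k0 (.inl z)) (k0 (.inl z')))
  have qB := sub_nonneg.2 (m.isHeightB.abs_add_le (x := u) (x' := u') (k0 (.inr u)) (k0 (.inr u')))
  obtain ⟨f1, f2, f3, f4⟩ := hU.unique _ _ _ _ _ _ _ _ ((m.fac_iff ..).1 hf).2.2
    ((m.fac_iff ..).1 hg).2.2 pA pB (mul_nonneg ht qA) (mul_nonneg ht qB) (by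
      rw [mul_smul, mul_smul, ← smul_add]
      exact Prod.ext e0 e1)
  have aA := congrArg abs e2
  have aB := congrArg abs e3
  rw [abs_mul, abs_of_nonneg ht] at aA aB
  -- The fan coefficient plus the absolute height is the mass on each side. The total mass is 1 for
  -- both points, so the scaling factor is 1.
  have ht1 : t = 1 := by
    have : b (.inl x) + b (.inl x') + (b (.inr y) + b (.inr y')) =
      t * (c (.inl z) + c (.inl z') + (c (.inr u) + c (.inr u'))) := by linarith
    rw [h1, k1] at this
    linarith
  subst ht1
  rw [one_mul] at f1 f2 aA aB e2 e3
  ext v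
  cases v with
  | inl v =>
    have := m.isHeightA.eq_of_mass_height hx hz (h0 (.inl x)) (h0 (.inl x')) (k0 (.inl z))
      (k0 (.inl z')) (by linarith) e2 f3 (Pi.single v 1)
    have sb := sum_eq_of_support hx.ne hA (fun w => b (.inl w) * (Pi.single v 1 : A → ℝ) w)
      fun w h => by simp [h]
    have sc := sum_eq_of_support hz.ne kA (fun w => c (.inl w) * (Pi.single v 1 : A → ℝ) w)
      fun w h => by simp [h]
    rw [← sb, ← sc] at this
    simpa [Pi.single_apply] using this
  | inr v =>
    have := m.isHeightB.eq_of_mass_height hy hu (h0 (.inr y)) (h0 (.inr y')) (k0 (.inr u))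
      (k0 (.inr u')) (by linarith) e3 f4 (Pi.single v 1)
    have sb := sum_eq_of_support hy.ne hB (fun w => b (.inr w) * (Pi.single v 1 : B → ℝ) w)
      fun w h => by simp [h]
    have sc := sum_eq_of_support hu.ne kB (fun w => c (.inr w) * (Pi.single v 1 : B → ℝ) w)
      fun w h => by simp [h]
    rw [← sb, ← sc] at this
    simpa [Pi.single_apply] using this

lemma exists_toEuclidean_eq_smul [DecidableEq A] [DecidableEq B] (m : C.ArcModel J)
    {U U' : ι → ℝ × ℝ} (hU : IsFan J U U') {na : A → A} {nb : B → B}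
    (hna : ∀ v, C.graph.Adj v (na v)) (hnb : ∀ v, C.swap.graph.Adj v (nb v))
    {w : EuclideanSpace ℝ (Fin 4)} (hw : w ≠ 0) :
    ∃ b ∈ Realization C.simplices, ∃ t : ℝ, 0 < t ∧ m.toEuclidean U U' na nb b = t • w := by
  obtain ⟨i, j, lA, lB, hij, hlA, hlB, hrep⟩ := hU.exists_rep (w 0, w 1)
  have hdiv : ∀ l s : ℝ, 0 ≤ l → |s / (l + |s|)| ≤ 1 ∧ (l + |s|) * (s / (l + |s|)) = s := by
    intro l s hl
    have hs := abs_nonneg s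
    rcases (add_nonneg hl hs).eq_or_lt with e | e
    · have : s = 0 := abs_eq_zero.1 (by linarith)
      simp [this]
    · refine ⟨?_, by field_simp⟩
      rw [abs_div, abs_of_pos e, div_le_one e]
      linarith
  obtain ⟨dA, dA'⟩ := hdiv lA (w 2) hlA
  obtain ⟨dB, dB'⟩ := hdiv lB (w 3) hlB
  obtain ⟨x, x', r, hx, hxi, hr0, hr1, hr⟩ := m.isHeightA.surj i _ dA
  obtain ⟨y, y', q, hy, hyj, hq0, hq1, hq⟩ := m.isHeightB.surj j _ dB
  have hf : C.Fac x x' y y' := (m.fac_iff ..).2 ⟨hx, hy, by rwa [hxi, hyj]⟩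
  -- The masses are forced: fan coefficient plus absolute height. The height within the arc is the
  -- quotient, and dividing by `T` normalises the total mass.
  set mA := lA + |w 2| with hmA
  set mB := lB + |w 3| with hmB
  have hmA0 : 0 ≤ mA := add_nonneg hlA (abs_nonneg _)
  have hmB0 : 0 ≤ mB := add_nonneg hlB (abs_nonneg _)
  have hT : 0 < mA + mB := by
    refine lt_of_le_of_ne (by linarith) fun e => hw ?_
    have a2 := abs_nonneg (w 2)
    have a3 := abs_nonneg (w 3)
    have e2 : w 2 = 0 := abs_eq_zero.1 (by linarith)
    have e3 : w 3 = 0 := abs_eq_zero.1 (by linarith)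
    have eA : lA = 0 := by linarith
    have eB : lB = 0 := by linarith
    rw [eA, eB] at hrep
    have e0 := congrArg Prod.fst hrep
    have e1 := congrArg Prod.snd hrep
    simp at e0 e1
    ext k
    fin_cases k
    exacts [e0, e1, e2, e3]
  set T := mA + mB with hTdef
  let b : A ⊕ B → ℝ := Sum.elim
    (Pi.single x (mA * (1 - r) / T) + Pi.single x' (mA * r / T))
    (Pi.single y (mB * (1 - q) / T) + Pi.single y' (mB * q / T))
  have bx : b (.inl x) = mA * (1 - r) / T := by simp [b, hx.ne]
  have bx' : b (.inl x') = mA * r / T := by simp [b, hx.ne.symm]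
  have by1 : b (.inr y) = mB * (1 - q) / T := by simp [b, hy.ne]
  have by2 : b (.inr y') = mB * q / T := by simp [b, hy.ne.symm]
  have h0 : ∀ v, 0 ≤ b v := by
    have r1 : 0 ≤ 1 - r := by linarith
    have q1 : 0 ≤ 1 - q := by linarith
    rintro (v | v) <;> simp only [b, Sum.elim_inl, Sum.elim_inr, Pi.add_apply] <;>
      refine add_nonneg ?_ ?_ <;> rw [Pi.single_apply] <;> split_ifs <;> positivity
  have hA : ∀ v, b (.inl v) ≠ 0 → v = x ∨ v = x' := by
    intro v hv
    by_contra! hc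
    exact hv (by simp [b, hc.1, hc.2])
  have hB : ∀ v, b (.inr v) ≠ 0 → v = y ∨ v = y' := by
    intro v hv
    by_contra! hc
    exact hv (by simp [b, hc.1, hc.2])
  have sA : b (.inl x) * m.htA x + b (.inl x') * m.htA x' = T⁻¹ * w 2 := by
    rw [bx, bx', ← dA', hr]; field_simp
  have sB : b (.inr y) * m.htB y + b (.inr y') * m.htB y' = T⁻¹ * w 3 := by
    rw [by1, by2, ← dB', hq]; field_simp
  have tA : b (.inl x) + b (.inl x') = T⁻¹ * mA := by rw [bx, bx']; field_simp; ring
  have tB : b (.inr y) + b (.inr y') = T⁻¹ * mB := by rw [by1, by2]; field_simp; ring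
  have hTi : 0 < T⁻¹ := inv_pos.2 hT
  refine ⟨b, mem_realization.2 ⟨_, ⟨x, x', y, y', hf, rfl⟩, h0, ?_, ?_⟩, T⁻¹, hTi, ?_⟩
  · rw [Fintype.sum_sum_type, sum_eq_of_support hx.ne hA (fun v => b (.inl v)) fun _ h => h,
      sum_eq_of_support hy.ne hB (fun v => b (.inr v)) fun _ h => h, tA, tB, ← mul_add,
      ← hTdef, inv_mul_cancel₀ hT.ne']
  · rintro (v | v) hv
    · simpa using hA v hv
    · simpa using hB v hv
  · rw [m.toEuclidean_eq U U' hna hnb h0 hf hA hB (w := T⁻¹ • (w 0, w 1)), sA, sB]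
    · ext k
      fin_cases k <;> simp
    · rw [hrep, sA, sB, tA, tB, hxi, hyj, abs_mul, abs_mul, abs_of_pos hTi, ← mul_sub, ← mul_sub,
        hmA, hmB, add_sub_cancel_right, add_sub_cancel_right, smul_add, smul_smul, smul_smul]

lemma toEuclidean_ne_zero [DecidableEq A] [DecidableEq B] (m : C.ArcModel J)
    {U U' : ι → ℝ × ℝ} (hU : IsFan J U U') {na : A → A} {nb : B → B}
    (hna : ∀ v, C.graph.Adj v (na v)) (hnb : ∀ v, C.swap.graph.Adj v (nb v)) {b : A ⊕ B → ℝ}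
    (hb : b ∈ Realization C.simplices) : m.toEuclidean U U' na nb b ≠ 0 := by
  intro hb2
  obtain ⟨x, x', y, y', hf, h0, hA, hB, h1⟩ := exists_fac_of_mem_realization hb
  rw [m.toEuclidean_eq U U' hna hnb h0 hf hA hB rfl] at hb2
  have e0 := congrArg (fun f : EuclideanSpace ℝ (Fin 4) => f 0) hb2
  have e1 := congrArg (fun f : EuclideanSpace ℝ (Fin 4) => f 1) hb2
  have e2 := congrArg (fun f : EuclideanSpace ℝ (Fin 4) => f 2) hb2
  have e3 := congrArg (fun f : EuclideanSpace ℝ (Fin 4) => f 3) hb2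
  simp only [PiLp.zero_apply, Matrix.cons_val] at e0 e1 e2 e3
  have pA := sub_nonneg.2
    (m.isHeightA.abs_add_le (x := x) (x' := x') (h0 (.inl x)) (h0 (.inl x')))
  have pB := sub_nonneg.2
    (m.isHeightB.abs_add_le (x := y) (x' := y') (h0 (.inr y)) (h0 (.inr y')))
  obtain ⟨f1, f2, -⟩ := hU.unique _ _ _ _ _ _ 0 0 ((m.fac_iff ..).1 hf).2.2
    ((m.fac_iff ..).1 hf).2.2 pA pB le_rfl le_rfl (by
      rw [zero_smul, zero_smul, add_zero]
      exact Prod.ext e0 e1)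
  rw [e2, abs_zero] at f1
  rw [e3, abs_zero] at f2
  linarith

theorem nonempty_homeomorph_sphere [DecidableEq A] [DecidableEq B] (m : C.ArcModel J)
    (hC : C.Normal) {U U' : ι → ℝ × ℝ} (hU : IsFan J U U') :
    Nonempty (Realization C.simplices ≃ₜ Metric.sphere (0 : EuclideanSpace ℝ (Fin 4)) 1) := by
  choose na hna using hC.left.cover
  choose nb hnb using hC.right.cover
  have : CompactSpace (Realization C.simplices) :=
    isCompact_iff_compactSpace.1 (isCompact_realization _)
  refine nonempty_homeomorph_sphere_of_radial
    (Φ := fun b : Realization C.simplices => m.toEuclidean U U' na nb b)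
    ((m.continuous_toEuclidean U U' na nb).comp continuous_subtype_val)
    (fun b => m.toEuclidean_ne_zero hU hna hnb b.2)
    (fun b c t ht h => Subtype.ext (m.eq_of_toEuclidean_eq_smul hU hna hnb b.2 c.2 ht h))
    fun w hw => ?_
  obtain ⟨b, hb, t, ht, hbt⟩ := m.exists_toEuclidean_eq_smul hU hna hnb hw
  exact ⟨⟨b, hb⟩, t, ht, hbt⟩

end FacetSystem.ArcModel

/-- Join of two circles in the first case, of two theta graphs restricted to unequal labels in the
second. -/
lemma FacetSystem.Normal.nonempty_homeomorph_sphere {A B : Type*} [Fintype A] [Fintype B]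
    [DecidableEq A] [DecidableEq B] {C : FacetSystem A B} (hC : C.Normal) (hA : C.NoRemovable)
    (hB : C.swap.NoRemovable) :
    Nonempty (Realization C.simplices ≃ₜ Metric.sphere (0 : EuclideanSpace ℝ (Fin 4)) 1) := by
  by_cases hall : ∀ x x' y y', C.graph.Adj x x' → C.swap.graph.Adj y y' → C.Fac x x' y y'
  · obtain ⟨m⟩ := hC.nonempty_arcModel_of_forall hall
    exact m.nonempty_homeomorph_sphere hC isFan_quadrants
  · obtain ⟨m⟩ := hC.nonempty_arcModel_of_not_forall hA hB hall
    exact m.nonempty_homeomorph_sphere hC isFan_hexagon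

/-! ### Coloured facets and their facet systems -/

/-- The facets of a balanced normal `3`-pseudomanifold: `vtx σ c` is the vertex of the facet `σ` of
colour `c`. -/
structure ColoredFacets (F V : Type*) where
  vtx : F → Fin 4 → V
  color_eq : ∀ {σ τ c d}, vtx σ c = vtx τ d → c = d
  injective : Function.Injective vtx
  exists_neighbor : ∀ σ c, ∃ τ, τ ≠ σ ∧ (∀ d, d ≠ c → vtx τ d = vtx σ d) ∧
    ∀ τ', τ' ≠ σ → (∀ d, d ≠ c → vtx τ' d = vtx σ d) → τ' = τ
  /-- The facets around a simplex are connected through their common triangles. -/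
  exists_chain : ∀ (S : Set (Fin 4)) (σ τ : F), (∀ d ∈ S, vtx τ d = vtx σ d) →
    Relation.ReflTransGen (fun s t => (∀ d ∈ S, vtx s d = vtx σ d) ∧ (∀ d ∈ S, vtx t d = vtx σ d) ∧
      ∃ c, ∀ d, d ≠ c → vtx s d = vtx t d) σ τ
  nonempty : Nonempty F

/-- The four colours are split into the pairs `a` and `b`. -/
structure IsColorSplit (a b : Bool → Fin 4) : Prop where
  injective_left : Function.Injective a
  injective_right : Function.Injective b
  ne : ∀ i j, a i ≠ b j
  cover : ∀ c, (∃ i, a i = c) ∨ ∃ j, b j = c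

lemma IsColorSplit.swap {a b : Bool → Fin 4} (h : IsColorSplit a b) : IsColorSplit b a :=
  ⟨h.2, h.1, fun i j => (h.3 j i).symm, fun c => (h.4 c).symm⟩

namespace ColoredFacets
variable {F V : Type*} (X : ColoredFacets F V)

/-- The vertices with a colour in `a`. -/
def Side (a : Bool → Fin 4) : Type _ := {v : V // ∃ σ i, X.vtx σ (a i) = v}

instance [Finite F] (a : Bool → Fin 4) : Finite (X.Side a) := by
  refine Finite.of_surjective (fun t : F × Bool => (⟨X.vtx t.1 (a t.2), t.1, t.2, rfl⟩ : X.Side a))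
    ?_
  rintro ⟨v, σ, i, h⟩
  exact ⟨(σ, i), Subtype.ext h⟩

variable {a b : Bool → Fin 4}

/-- The vertex of `σ` of colour `a i`. -/
def side (a : Bool → Fin 4) (σ : F) (i : Bool) : X.Side a := ⟨X.vtx σ (a i), σ, i, rfl⟩

variable {X}

lemma exists_side (x : X.Side a) : ∃ σ i, x = X.side a σ i := by
  obtain ⟨v, σ, i, h⟩ := x
  exact ⟨σ, i, Subtype.ext h.symm⟩

lemma side_eq_iff (ha : Function.Injective a) {σ τ : F} {i j : Bool} :
    X.side a σ i = X.side a τ j ↔ i = j ∧ X.vtx σ (a i) = X.vtx τ (a i) := by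
  constructor
  · intro h
    have h1 : X.vtx σ (a i) = X.vtx τ (a j) := congrArg Subtype.val h
    obtain rfl := ha (X.color_eq h1)
    exact ⟨rfl, h1⟩
  · rintro ⟨rfl, h⟩
    exact Subtype.ext h

lemma side_congr {σ τ : F} {i : Bool} (h : X.vtx σ (a i) = X.vtx τ (a i)) :
    X.side a σ i = X.side a τ i := Subtype.ext h

lemma eq_of_agree (h : IsColorSplit a b) {σ τ : F}
    (hA : ∀ i, X.vtx σ (a i) = X.vtx τ (a i)) (hB : ∀ i, X.vtx σ (b i) = X.vtx τ (b i)) :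
    σ = τ := by
  refine X.injective (funext fun c => ?_)
  rcases h.cover c with ⟨i, rfl⟩ | ⟨i, rfl⟩
  exacts [hA i, hB i]

lemma forall_bool_of {p : Bool → Prop} {i : Bool} (h : p i) (h' : p !i) : ∀ k, p k := by
  cases i <;> intro k <;> cases k <;> assumption

variable (X) in
/-- The facets, their vertices being grouped by the pairs of colours. -/
def system (h : IsColorSplit a b) : FacetSystem (X.Side a) (X.Side b) where
  Fac x x' y y' := ∃ σ i j, x = X.side a σ i ∧ x' = X.side a σ (!i) ∧
    y = X.side b σ j ∧ y' = X.side b σ (!j)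
  swapA := by
    rintro _ _ _ _ ⟨σ, i, j, rfl, rfl, rfl, rfl⟩
    exact ⟨σ, !i, j, rfl, by simp, rfl, rfl⟩
  swapB := by
    rintro _ _ _ _ ⟨σ, i, j, rfl, rfl, rfl, rfl⟩
    exact ⟨σ, i, !j, rfl, rfl, rfl, by simp⟩
  neA := by
    rintro _ _ _ _ ⟨σ, i, j, rfl, rfl, rfl, rfl⟩ e
    simpa using ((side_eq_iff h.injective_left).1 e).1
  neB := by
    rintro _ _ _ _ ⟨σ, i, j, rfl, rfl, rfl, rfl⟩ e
    simpa using ((side_eq_iff h.injective_right).1 e).1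

variable (h : IsColorSplit a b)

lemma system_swap : (X.system h).swap = X.system h.swap := by
  simp only [system, FacetSystem.swap, FacetSystem.mk.injEq]
  funext y y' x x'
  refine propext ⟨?_, ?_⟩
  · rintro ⟨σ, i, j, h1, h2, h3, h4⟩
    exact ⟨σ, j, i, h3, h4, h1, h2⟩
  · rintro ⟨σ, i, j, h1, h2, h3, h4⟩
    exact ⟨σ, j, i, h3, h4, h1, h2⟩

lemma fac_side (σ : F) (i j : Bool) :
    (X.system h).Fac (X.side a σ i) (X.side a σ !i) (X.side b σ j) (X.side b σ !j) :=
  ⟨σ, i, j, rfl, rfl, rfl, rfl⟩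

-- Along a chain of facets around the simplex with colours `S`, consecutive ones differ in at most
-- one colour and so share an A-vertex, while each facet contributes an edge of `G`.
include h in
lemma reachable_side (G : SimpleGraph (X.Side a)) (S : Set (Fin 4)) {σ τ : F}
    (hG : ∀ s, (∀ d ∈ S, X.vtx s d = X.vtx σ d) → ∀ i, G.Adj (X.side a s i) (X.side a s !i))
    (hτ : ∀ d ∈ S, X.vtx τ d = X.vtx σ d) (i j : Bool) :
    G.Reachable (X.side a σ i) (X.side a τ j) := by
  have hin : ∀ s, (∀ d ∈ S, X.vtx s d = X.vtx σ d) → ∀ i j,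
      G.Reachable (X.side a s i) (X.side a s j) := fun s hs i =>
    forall_bool_of (.refl _) (hG s hs i).reachable
  induction X.exists_chain S σ τ hτ generalizing j with
  | refl => exact hin σ (fun _ _ => rfl) i j
  | tail _ hst ih =>
    obtain ⟨h1, h2, c, hc⟩ := hst
    obtain ⟨k, hk⟩ : ∃ k, a k ≠ c := by
      by_contra! hcon
      exact Bool.false_ne_true (h.injective_left ((hcon _).trans (hcon _).symm))
    have := ih h1 k
    rw [side_congr (hc _ hk)] at this
    exact this.trans (hin _ h2 k j)

lemma halfNormal_system : (X.system h).HalfNormal where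
  cycles := by
    rintro _ _ _ ⟨_, σ, i, j, rfl, rfl, rfl, rfl⟩
    -- The second neighbour in the edge link comes from the facet across the triangle opposite to
    -- the first.
    obtain ⟨τ, hne, hτ, huniq⟩ := X.exists_neighbor σ (a !i)
    have hi : a i ≠ a !i := fun e => by simpa using h.injective_left e
    have hset : ((X.system h).edgeLink (X.side b σ j) (X.side b σ !j)).neighborSet (X.side a σ i) =
        {X.side a σ !i, X.side a τ !i} := by
      ext x
      constructor
      · rintro ⟨ρ, i', j', h1, rfl, h2, h3⟩
        obtain ⟨rfl, k1⟩ := (side_eq_iff h.injective_left).1 h1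
        obtain ⟨rfl, k2⟩ := (side_eq_iff h.injective_right).1 h2
        obtain ⟨-, k3⟩ := (side_eq_iff h.injective_right).1 h3
        by_cases hρ : ρ = σ
        · exact Or.inl (by rw [hρ])
        · refine Or.inr (Set.mem_singleton_iff.2 ?_)
          rw [huniq ρ hρ]
          intro d hd
          rcases h.cover d with ⟨k, rfl⟩ | ⟨k, rfl⟩
          · have : k = i := by
              cases k <;> cases i <;> first | rfl | exact absurd rfl hd
            rw [this, k1]
          · exact forall_bool_of (p := fun k => X.vtx ρ (b k) = X.vtx σ (b k)) k2.symm k3.symm k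
      · rintro (rfl | rfl)
        · exact fac_side h σ i j
        · refine ⟨τ, i, j, side_congr ?_, rfl, side_congr ?_, side_congr ?_⟩
          · exact (hτ _ hi).symm
          · exact (hτ _ (h.ne _ _).symm).symm
          · exact (hτ _ (h.ne _ _).symm).symm
    rw [hset, Set.ncard_pair]
    intro e
    refine hne (X.injective (funext fun d => ?_))
    by_cases hd : d = a !i
    · rw [hd]; exact ((side_eq_iff h.injective_left).1 e).2.symm
    · exact hτ d hd
  cover := by
    intro x
    obtain ⟨σ, i, rfl⟩ := exists_side x
    exact ⟨_, _, _, fac_side h σ i true⟩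
  connected := by
    obtain ⟨σ⟩ := X.nonempty
    have : Nonempty (X.Side a) := ⟨X.side a σ true⟩
    refine ⟨fun x x' => ?_⟩
    obtain ⟨σ, i, rfl⟩ := exists_side x
    obtain ⟨τ, j, rfl⟩ := exists_side x'
    exact reachable_side h (X.system h).graph ∅ (fun s _ i => ⟨_, _, fac_side h s i true⟩) (by simp) i j
  link_reachable := by
    rintro _ _ _ ⟨_, _, σ, i, j, rfl, rfl, rfl, rfl⟩ ⟨_, _, τ, i', j', rfl, rfl, h3, rfl⟩
    obtain ⟨rfl, k3⟩ := (side_eq_iff h.injective_right).1 h3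
    refine reachable_side h ((X.system h).link _) {b j} (fun s hs i => ⟨X.side b s !j, ?_⟩) ?_ i i'
    · rw [← side_congr (hs _ rfl)]
      exact fac_side h s i j
    · rintro _ rfl
      exact k3.symm
  edgeLink_reachable := by
    rintro _ _ _ _ ⟨_, σ, i, j, rfl, rfl, rfl, rfl⟩ ⟨_, τ, i', j', rfl, rfl, h3, h4⟩
    obtain ⟨rfl, k3⟩ := (side_eq_iff h.injective_right).1 h3
    obtain ⟨-, k4⟩ := (side_eq_iff h.injective_right).1 h4
    refine reachable_side h ((X.system h).edgeLink _ _) {b j, b !j} (fun s hs i => ?_) ?_ i i'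
    · rw [← side_congr (hs (b j) (by simp)), ← side_congr (hs (b !j) (by simp))]
      exact fac_side h s i j
    · rintro _ (rfl | rfl)
      exacts [k3.symm, k4.symm]
  dual_reachable := by
    rintro _ _ _ ⟨_, _, σ, i, j, rfl, rfl, rfl, rfl⟩ ⟨_, _, τ, i', j', rfl, rfl, h3, rfl⟩
    obtain ⟨rfl, k3⟩ := (side_eq_iff h.injective_right).1 h3
    have hτ : ∀ d ∈ ({b j} : Set (Fin 4)), X.vtx τ d = X.vtx σ d := by
      rintro _ rfl; exact k3.symm
    clear h3 k3
    induction X.exists_chain {b j} σ τ hτ with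
    | refl => exact .refl
    | @tail s t _ hst ih =>
      obtain ⟨h1, h2, c, hc⟩ := hst
      refine (ih h1).trans ?_
      -- If the chain changes the second B-vertex, the two facets share their A-edge; otherwise that
      -- B-vertex stays the same and nothing is to be done.
      by_cases e : b (!j) = c
      · refine .single ⟨X.side a s true, X.side a s !true, ?_, ?_⟩
        · rw [← side_congr (h1 _ rfl)]
          exact fac_side h s true j
        · rw [← side_congr (h2 _ rfl)]
          refine ⟨t, true, j, side_congr (hc _ ?_), side_congr (hc _ ?_), rfl, rfl⟩ <;>
          · rw [← e]; exact h.ne _ _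
      · rw [side_congr (hc _ e)]

lemma normal_system : (X.system h).Normal where
  left := halfNormal_system h
  right := by rw [system_swap]; exact halfNormal_system h.swap

/-- The factor 4 counts the two orders within each colour pair. -/
lemma ncard_fac_system [Finite F] : 4 * Nat.card F =
    {t : X.Side a × X.Side a × X.Side b × X.Side b |
      (X.system h).Fac t.1 t.2.1 t.2.2.1 t.2.2.2}.ncard := by
  let f : F × Bool × Bool → X.Side a × X.Side a × X.Side b × X.Side b := fun t =>
    (X.side a t.1 t.2.1, X.side a t.1 !t.2.1, X.side b t.1 t.2.2, X.side b t.1 !t.2.2)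
  have hf : Function.Injective f := by
    rintro ⟨σ, i, j⟩ ⟨τ, i', j'⟩ e
    simp only [f, Prod.mk.injEq] at e
    obtain ⟨e1, e2, e3, e4⟩ := e
    obtain ⟨rfl, k1⟩ := (side_eq_iff h.injective_left).1 e1
    obtain ⟨rfl, k3⟩ := (side_eq_iff h.injective_right).1 e3
    have k2 := ((side_eq_iff h.injective_left).1 e2).2
    have k4 := ((side_eq_iff h.injective_right).1 e4).2
    rw [eq_of_agree h (forall_bool_of (p := fun k => X.vtx σ (a k) = X.vtx τ (a k)) k1 k2)
      (forall_bool_of (p := fun k => X.vtx σ (b k) = X.vtx τ (b k)) k3 k4)]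
  have hset : {t : X.Side a × X.Side a × X.Side b × X.Side b |
      (X.system h).Fac t.1 t.2.1 t.2.2.1 t.2.2.2} = f '' Set.univ := by
    ext ⟨x, x', y, y'⟩
    constructor
    · rintro ⟨σ, i, j, h1, h2, h3, h4⟩
      exact ⟨(σ, i, j), trivial, by simp only [f] at *; rw [h1, h2, h3, h4]⟩
    · rintro ⟨⟨σ, i, j⟩, -, e⟩
      simp only [f, Prod.mk.injEq] at e
      obtain ⟨rfl, rfl, rfl, rfl⟩ := e
      exact fac_side h σ i j
  rw [hset, Set.ncard_image_of_injective _ hf, Set.ncard_univ, Nat.card_prod, Nat.card_prod]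
  simp
  ring

variable (X) in
/-- Facets are adjacent when they share a triangle. -/
def dual : SimpleGraph F where
  Adj σ τ := σ ≠ τ ∧ ∃ c, ∀ d, d ≠ c → X.vtx σ d = X.vtx τ d
  symm := ⟨fun _ _ ⟨h, c, hc⟩ => ⟨h.symm, c, fun d hd => (hc d hd).symm⟩⟩
  loopless := ⟨fun _ h => h.1 rfl⟩

variable (X) in
/-- The edges of the dual graph of colour `c` or `c'`. -/
def bicolored (c c' : Fin 4) : SimpleGraph F where
  Adj σ τ := σ ≠ τ ∧ ∃ e, (e = c ∨ e = c') ∧ ∀ d, d ≠ e → X.vtx σ d = X.vtx τ d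
  symm := ⟨fun _ _ ⟨h, c, hc, hc'⟩ => ⟨h.symm, c, hc, fun d hd => (hc' d hd).symm⟩⟩
  loopless := ⟨fun _ h => h.1 rfl⟩

lemma ncard_edgeSet_dual [Finite F] : X.dual.edgeSet.ncard = 2 * Nat.card F := by
  have := Fintype.ofFinite F
  have hdeg : ∀ σ, (X.dual.neighborSet σ).ncard = 4 := by
    intro σ
    choose f hne hf huniq using X.exists_neighbor σ
    have hinj : Function.Injective f := by
      intro c c' e
      by_contra hcc
      refine hne c (X.injective (funext fun d => ?_))
      by_cases hd : d = c
      · rw [e]; exact hf c' d (hd ▸ hcc)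
      · exact hf c d hd
    have : X.dual.neighborSet σ = f '' Set.univ := by
      ext τ
      constructor
      · rintro ⟨h1, c, hc⟩
        exact ⟨c, trivial, (huniq c τ h1.symm fun d hd => (hc d hd).symm).symm⟩
      · rintro ⟨c, -, rfl⟩
        exact ⟨(hne c).symm, c, fun d hd => (hf c d hd).symm⟩
    rw [this, Set.ncard_image_of_injective _ hinj, Set.ncard_univ]
    simp
  have := X.dual.sum_ncard_neighborSet
  simp only [hdeg, Finset.sum_const, Finset.card_univ, smul_eq_mul] at this
  rw [Nat.card_eq_fintype_card]
  omega

/-- Opposite positions of the cyclic order are paired, so that any two consecutive colours lie on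
different sides. -/
lemma isColorSplit_of_perm (ε : Equiv.Perm (Fin 4)) :
    IsColorSplit (fun k => ε (cond k 2 0)) (fun k => ε (cond k 3 1)) where
  injective_left := ε.injective.comp (by decide)
  injective_right := ε.injective.comp (by decide)
  ne i j e := by
    have h := ε.injective e
    clear e
    revert h; revert i j; decide
  cover c := by
    obtain ⟨d, rfl⟩ := ε.surjective c
    simp only [ε.injective.eq_iff]
    revert d; decide

lemma reachable_bicolored {c c' : Fin 4} {S : Set (Fin 4)} (hS : ∀ d, d ∈ S ∨ d = c ∨ d = c')
    {σ τ : F} (hτ : ∀ d ∈ S, X.vtx τ d = X.vtx σ d) : (X.bicolored c c').Reachable σ τ := by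
  induction X.exists_chain S σ τ hτ with
  | refl => exact .refl _
  | @tail s t _ hst ih =>
    obtain ⟨h1, h2, e, he⟩ := hst
    refine (ih h1).trans ?_
    by_cases hst : s = t
    · rw [hst]
    · refine SimpleGraph.Adj.reachable ⟨hst, e, (hS e).resolve_left fun heS => hst ?_, he⟩
      refine X.injective (funext fun d => ?_)
      by_cases hd : d = e
      · rw [hd, h1 e heS, h2 e heS]
      · exact he d hd

/-- The bi-coloured cycles are at most as many as the edges that join the two sides. -/
lemma sum_card_connectedComponent_le [Finite F] (ε : Equiv.Perm (Fin 4)) :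
    ∑ i : Fin 4, Nat.card (X.bicolored (ε i) (ε (i + 1))).ConnectedComponent ≤
      {t : X.Side (fun k => ε (cond k 2 0)) × X.Side (fun k => ε (cond k 3 1)) |
        ∃ x' y', (X.system (isColorSplit_of_perm ε)).Fac t.1 x' t.2 y'}.ncard := by
  have h := isColorSplit_of_perm ε
  -- The two colours other than those at positions `i` and `i + 1` are one on each side; `p` and `q`
  -- select them. Facets sharing the edge with these colours lie on one bi-coloured cycle, so the
  -- edge determines the cycle.
  let p : Fin 4 → Bool := ![true, false, false, true]
  let q : Fin 4 → Bool := ![true, true, false, false]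
  have hpq : ∀ i j, p i = p j → q i = q j → i = j := by decide
  have hcov : ∀ i d, (d = cond (p i) 2 0 ∨ d = cond (q i) 3 1) ∨ d = i ∨ d = i + 1 := by decide
  have : ∀ i, Finite (X.bicolored (ε i) (ε (i + 1))).ConnectedComponent := fun i => Quot.finite _
  rw [← Nat.card_sigma, ← Nat.card_coe_set_eq]
  refine Nat.card_le_card_of_injective (fun t => ⟨(X.side (fun k => ε (cond k 2 0)) t.2.out (p t.1),
    X.side (fun k => ε (cond k 3 1)) t.2.out (q t.1)),
    _, _, fac_side (isColorSplit_of_perm ε) t.2.out (p t.1) (q t.1)⟩) ?_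
  rintro ⟨i, c⟩ ⟨j, c'⟩ e
  simp only [Subtype.mk.injEq, Prod.mk.injEq, side_eq_iff h.injective_left,
    side_eq_iff h.injective_right] at e
  obtain ⟨⟨e1, e2⟩, e3, e4⟩ := e
  obtain rfl := hpq i j e1 e3
  have hr : (X.bicolored (ε i) (ε (i + 1))).Reachable c.out c'.out := by
    refine reachable_bicolored (S := {ε (cond (p i) 2 0), ε (cond (q i) 3 1)}) (fun d => ?_) ?_
    · obtain ⟨d, rfl⟩ := ε.surjective d
      simpa [ε.injective.eq_iff] using hcov i d
    · rintro _ (rfl | rfl)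
      exacts [e2.symm, e4.symm]
  have := SimpleGraph.ConnectedComponent.sound hr
  rw [← Quot.out_eq c, ← Quot.out_eq c']
  congr 1

end ColoredFacets

/-! ### From geometric complexes to coloured facets -/

section Complexes
variable {E : Type*} [AddCommGroup E] [Module ℝ E] {K : SimplicialComplex ℝ E} {κ : E → Fin 4}

lemma IsNormalPseudomanifold.exists_facet {d : ℕ} (hK : IsNormalPseudomanifold d K) {s : Finset E}
    (hs : s ∈ K.faces) : ∃ t ∈ K.facets, s ⊆ t := by
  obtain ⟨t, hst, ht⟩ := hK.finite.exists_le_maximal hs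
  exact ⟨t, ⟨ht.prop, fun u hu htu => le_antisymm htu (ht.2 hu htu)⟩, hst⟩

open Classical in
/-- In the star of a face of a normal pseudomanifold, facets are joined by chains of facets that
meet in simplices of codimension one. -/
lemma IsNormalPseudomanifold.exists_chain {d : ℕ} (hK : IsNormalPseudomanifold d K) (n : ℕ) :
    ∀ σ : Finset E, σ = ∅ ∨ σ ∈ K.faces → d ≤ σ.card + n →
    ∀ s ∈ K.facets, ∀ t ∈ K.facets, σ ⊆ s → σ ⊆ t →
    Relation.ReflTransGen (fun u v => u ∈ K.facets ∧ v ∈ K.facets ∧ σ ⊆ u ∧ σ ⊆ v ∧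
      d ≤ (u ∩ v).card) s t := by
  induction n with
  | zero =>
    intro σ _ hd s hs t ht hσs hσt
    exact .single ⟨hs, ht, hσs, hσt, hd.trans (Finset.card_le_card (Finset.subset_inter hσs hσt))⟩
  | succ n ih =>
    intro σ hσ hd s hs t ht hσs hσt
    rcases Nat.lt_or_ge σ.card d with hlt | hge
    swap
    · exact .single ⟨hs, ht, hσs, hσt,
        hge.trans (Finset.card_le_card (Finset.subset_inter hσs hσt))⟩
    -- The induction is on the codimension of `σ`: chains around the larger face `insert v σ` are
    -- chains around `σ`.
    have hstep : ∀ v ∉ σ, insert v σ ∈ K.faces → ∀ s ∈ K.facets, ∀ t ∈ K.facets,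
        insert v σ ⊆ s → insert v σ ⊆ t →
        Relation.ReflTransGen (fun u v => u ∈ K.facets ∧ v ∈ K.facets ∧ σ ⊆ u ∧ σ ⊆ v ∧
          d ≤ (u ∩ v).card) s t := by
      intro v hv hf s hs t ht h1 h2
      refine Relation.ReflTransGen.mono ?_ _ _ (ih (insert v σ) (Or.inr hf) ?_ s hs t ht h1 h2)
      · rintro a b ⟨ha, hb, ha', hb', hab⟩
        exact ⟨ha, hb, (Finset.subset_insert v σ).trans ha', (Finset.subset_insert v σ).trans hb',
          hab⟩
      · rw [Finset.card_insert_of_notMem hv]; omega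
    have hlink : ∀ s ∈ K.facets, σ ⊆ s → ∃ v : {v : E // {v} ∈ linkFaces K σ}, (v : E) ∈ s := by
      intro s hs hσs
      have : σ.card < s.card := by rw [hK.pure s hs]; omega
      obtain ⟨v, hvs, hvσ⟩ := Finset.exists_mem_notMem_of_card_lt_card this
      have hsub : {v} ∪ σ ⊆ s := Finset.union_subset (by simpa using hvs) hσs
      exact ⟨⟨v, K.down_closed hs.1 (by simpa using hvs) (by simp), by simpa using hvσ,
        K.down_closed hs.1 hsub (by simp)⟩, hvs⟩
    obtain ⟨v, hv⟩ := hlink s hs hσs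
    obtain ⟨w, hw⟩ := hlink t ht hσt
    obtain ⟨p⟩ := (hK.connected_link σ hσ hlt).preconnected v w
    have hins : ∀ u : {v : E // {v} ∈ linkFaces K σ}, (u : E) ∉ σ ∧ insert (u : E) σ ∈ K.faces :=
      fun u => ⟨by simpa using u.2.2.1, u.2.2.2⟩
    induction p generalizing s with
    | nil =>
      exact hstep _ (hins _).1 (hins _).2 s hs t ht (Finset.insert_subset hv hσs)
        (Finset.insert_subset hw hσt)
    | @cons u u' _ hadj p ih' =>
      -- A facet containing `σ` and an edge of its link passes from the star of one link vertex to
      -- that of the next.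
      obtain ⟨r, hr, hsub⟩ := hK.exists_facet hadj.2.2.2
      have hu : (u : E) ∈ r := hsub (by simp)
      have hu' : (u' : E) ∈ r := hsub (by simp)
      have hσr : σ ⊆ r := Finset.union_subset_right hsub
      exact (hstep _ (hins _).1 (hins _).2 s hs r hr (Finset.insert_subset hv hσs)
        (Finset.insert_subset hu hσr)).trans (ih' r hr hσr hu' hw)

lemma exists_vertex_of_color (hK : IsNormalPseudomanifold 3 K) (hκ : IsBalancedColoring 3 K κ)
    {σ : Finset E} (hσ : σ ∈ K.facets) (c : Fin 4) : ∃ v ∈ σ, κ v = c := by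
  have h1 : (σ.image κ).card = 4 := by
    rw [Finset.card_image_of_injOn (hκ σ hσ.1), hK.pure σ hσ]
  have h2 : σ.image κ = Finset.univ := Finset.eq_univ_of_card _ (by rw [h1]; rfl)
  have h3 : c ∈ σ.image κ := h2 ▸ Finset.mem_univ c
  simpa using h3

/-- The vertex of a given colour in a facet. -/
noncomputable def facetVertex (hK : IsNormalPseudomanifold 3 K) (hκ : IsBalancedColoring 3 K κ)
    (σ : {σ : Finset E // σ ∈ K.facets}) (c : Fin 4) : E :=
  (exists_vertex_of_color hK hκ σ.2 c).choose

variable (hK : IsNormalPseudomanifold 3 K) (hκ : IsBalancedColoring 3 K κ)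

lemma facetVertex_mem (σ : {σ : Finset E // σ ∈ K.facets}) (c : Fin 4) :
    facetVertex hK hκ σ c ∈ (σ : Finset E) :=
  (exists_vertex_of_color hK hκ σ.2 c).choose_spec.1

lemma color_facetVertex (σ : {σ : Finset E // σ ∈ K.facets}) (c : Fin 4) :
    κ (facetVertex hK hκ σ c) = c :=
  (exists_vertex_of_color hK hκ σ.2 c).choose_spec.2

lemma facetVertex_color {σ : {σ : Finset E // σ ∈ K.facets}} {v : E} (hv : v ∈ (σ : Finset E)) :
    facetVertex hK hκ σ (κ v) = v :=
  hκ σ σ.2.1 (facetVertex_mem hK hκ σ _) hv (color_facetVertex hK hκ σ _)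

lemma mem_facet_iff {σ : {σ : Finset E // σ ∈ K.facets}} {v : E} :
    v ∈ (σ : Finset E) ↔ facetVertex hK hκ σ (κ v) = v :=
  ⟨facetVertex_color hK hκ, fun h => h ▸ facetVertex_mem hK hκ σ _⟩

lemma facetVertex_mem_iff {σ τ : {σ : Finset E // σ ∈ K.facets}} {c : Fin 4} :
    facetVertex hK hκ σ c ∈ (τ : Finset E) ↔ facetVertex hK hκ σ c = facetVertex hK hκ τ c := by
  rw [mem_facet_iff hK hκ, color_facetVertex hK hκ, eq_comm]

lemma facetVertex_injective : Function.Injective (facetVertex hK hκ) := by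
  intro σ τ h
  ext v
  rw [mem_facet_iff hK hκ, mem_facet_iff hK hκ, h]

open Classical in
lemma image_color_inter (σ τ : {σ : Finset E // σ ∈ K.facets}) :
    ((σ : Finset E) ∩ τ).image κ =
      ({c | facetVertex hK hκ σ c = facetVertex hK hκ τ c} : Finset (Fin 4)) := by
  ext c
  simp only [Finset.mem_image, Finset.mem_inter, Finset.mem_filter, Finset.mem_univ, true_and]
  constructor
  · rintro ⟨v, ⟨h1, h2⟩, rfl⟩
    rw [facetVertex_color hK hκ h1, facetVertex_color hK hκ h2]
  · intro h
    exact ⟨_, ⟨facetVertex_mem hK hκ σ c, h ▸ facetVertex_mem hK hκ τ c⟩,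
      color_facetVertex hK hκ σ c⟩

open Classical in
include hκ in
lemma card_image_color_inter (σ τ : {σ : Finset E // σ ∈ K.facets}) :
    (((σ : Finset E) ∩ τ).image κ).card = ((σ : Finset E) ∩ τ).card :=
  Finset.card_image_of_injOn ((hκ σ σ.2.1).mono (by simp))

open Classical in
lemma exists_color_of_card_inter {σ τ : {σ : Finset E // σ ∈ K.facets}}
    (h : 3 ≤ ((σ : Finset E) ∩ τ).card) :
    ∃ c, ∀ d, d ≠ c → facetVertex hK hκ σ d = facetVertex hK hκ τ d := by
  rw [← card_image_color_inter hκ] at h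
  have h1 := Finset.card_compl (((σ : Finset E) ∩ τ).image κ)
  rw [Fintype.card_fin] at h1
  obtain ⟨c, hc⟩ := Finset.card_le_one_iff_subset_singleton.1
    (show ((((σ : Finset E) ∩ τ).image κ)ᶜ).card ≤ 1 by omega)
  refine ⟨c, fun d hd => ?_⟩
  have : d ∈ ((σ : Finset E) ∩ τ).image κ := by
    by_contra hcon
    exact hd (Finset.mem_singleton.1 (hc (Finset.mem_compl.2 hcon)))
  rw [image_color_inter hK hκ] at this
  simpa using this

open Classical in
lemma image_color_inter_of_agree {σ τ : {σ : Finset E // σ ∈ K.facets}} (hne : σ ≠ τ) {c : Fin 4}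
    (h : ∀ d, d ≠ c → facetVertex hK hκ σ d = facetVertex hK hκ τ d) :
    ((σ : Finset E) ∩ τ).image κ = {c}ᶜ := by
  rw [image_color_inter hK hκ]
  ext d
  simp only [Finset.mem_filter, Finset.mem_univ, true_and, Finset.mem_compl, Finset.mem_singleton]
  refine ⟨?_, h d⟩
  rintro hd rfl
  refine hne (facetVertex_injective hK hκ (funext fun e => ?_))
  by_cases he : e = d
  · rw [he, hd]
  · exact h e he

open Classical in
/-- The facets of a balanced normal pseudomanifold of dimension `3`. -/
noncomputable def coloredFacets : ColoredFacets {σ : Finset E // σ ∈ K.facets} E where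
  vtx := facetVertex hK hκ
  color_eq {σ τ c d} h := by rw [← color_facetVertex hK hκ σ c, h, color_facetVertex hK hκ]
  injective := facetVertex_injective hK hκ
  exists_neighbor σ c := by
    set ρ := (σ : Finset E).erase (facetVertex hK hκ σ c) with hρ
    have hcard : ρ.card = 3 := by
      rw [Finset.card_erase_of_mem (facetVertex_mem hK hκ σ c), hK.pure σ σ.2]
    have hρf : ρ ∈ K.faces := K.down_closed σ.2.1 (Finset.erase_subset _ _)
      (Finset.card_pos.1 (by omega))
    have hiff : ∀ τ : {σ : Finset E // σ ∈ K.facets}, ρ ⊆ τ ↔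
        ∀ d, d ≠ c → facetVertex hK hκ τ d = facetVertex hK hκ σ d := by
      intro τ
      constructor
      · intro h d hd
        refine ((facetVertex_mem_iff hK hκ).1 (h (Finset.mem_erase.2
          ⟨fun e => hd ?_, facetVertex_mem hK hκ σ d⟩))).symm
        rw [← color_facetVertex hK hκ σ d, e, color_facetVertex hK hκ]
      · intro h v hv
        obtain ⟨h1, h2⟩ := Finset.mem_erase.1 hv
        have hvc : κ v ≠ c := fun e => h1 (by rw [← e, facetVertex_color hK hκ h2])
        rw [mem_facet_iff hK hκ, h _ hvc, facetVertex_color hK hκ h2]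
    obtain ⟨s, t, hst, hset⟩ := Set.ncard_eq_two.1 (hK.two_facets ρ hρf hcard)
    have hmem : ∀ u, u ∈ K.facets ∧ ρ ⊆ u ↔ u = s ∨ u = t := fun u => by
      have : u ∈ {τ | τ ∈ K.facets ∧ ρ ⊆ τ} ↔ u ∈ ({s, t} : Set (Finset E)) := by rw [hset]
      simpa using this
    have hs := (hmem s).2 (Or.inl rfl)
    have ht := (hmem t).2 (Or.inr rfl)
    rcases (hmem σ).1 ⟨σ.2, Finset.erase_subset _ _⟩ with h | h
    · refine ⟨⟨t, ht.1⟩, fun e => hst (h ▸ (congrArg Subtype.val e).symm), (hiff _).1 ht.2,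
        fun τ hτ h' => Subtype.ext ?_⟩
      refine ((hmem τ).1 ⟨τ.2, (hiff τ).2 h'⟩).resolve_left fun e => hτ (Subtype.ext (e.trans h.symm))
    · refine ⟨⟨s, hs.1⟩, fun e => hst (h ▸ (congrArg Subtype.val e)), (hiff _).1 hs.2,
        fun τ hτ h' => Subtype.ext ?_⟩
      refine ((hmem τ).1 ⟨τ.2, (hiff τ).2 h'⟩).resolve_right
        fun e => hτ (Subtype.ext (e.trans h.symm))
  exists_chain S σ τ h := by
    set ρ := (σ : Finset E).filter (fun v => κ v ∈ S) with hρ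
    have hρf : ρ = ∅ ∨ ρ ∈ K.faces := by
      rcases ρ.eq_empty_or_nonempty with h | h
      · exact Or.inl h
      · exact Or.inr (K.down_closed σ.2.1 (Finset.filter_subset _ _) h)
    have hiff : ∀ τ : {σ : Finset E // σ ∈ K.facets}, ρ ⊆ τ ↔
        ∀ d ∈ S, facetVertex hK hκ τ d = facetVertex hK hκ σ d := by
      intro τ
      constructor
      · intro h d hd
        refine ((facetVertex_mem_iff hK hκ).1 (h (Finset.mem_filter.2
          ⟨facetVertex_mem hK hκ σ d, ?_⟩))).symm
        rwa [color_facetVertex hK hκ]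
      · intro h v hv
        obtain ⟨h1, h2⟩ := Finset.mem_filter.1 hv
        rw [mem_facet_iff hK hκ, h _ h2, facetVertex_color hK hκ h1]
    have key : ∀ s t : Finset E, Relation.ReflTransGen (fun u v => u ∈ K.facets ∧ v ∈ K.facets ∧
        ρ ⊆ u ∧ ρ ⊆ v ∧ 3 ≤ (u ∩ v).card) s t → ∀ (hs : s ∈ K.facets) (ht : t ∈ K.facets),
        Relation.ReflTransGen (fun s t : {σ : Finset E // σ ∈ K.facets} =>
          (∀ d ∈ S, facetVertex hK hκ s d = facetVertex hK hκ σ d) ∧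
          (∀ d ∈ S, facetVertex hK hκ t d = facetVertex hK hκ σ d) ∧
          ∃ c, ∀ d, d ≠ c → facetVertex hK hκ s d = facetVertex hK hκ t d) ⟨s, hs⟩ ⟨t, ht⟩ := by
      intro s t hst
      induction hst with
      | refl => exact fun _ _ => .refl
      | tail _ huv ih =>
        intro hs ht
        obtain ⟨hu, hv, h1, h2, h3⟩ := huv
        exact (ih hs hu).tail ⟨(hiff ⟨_, hu⟩).1 h1, (hiff ⟨_, hv⟩).1 h2,
          exists_color_of_card_inter hK hκ h3⟩
    exact key σ τ (hK.exists_chain 3 ρ hρf (by omega) σ σ.2 τ τ.2 (Finset.filter_subset _ _)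
      ((hiff τ).2 h)) σ.2 τ.2
  nonempty := by
    obtain ⟨v⟩ := (hK.connected_link ∅ (Or.inl rfl) (by simp)).nonempty
    obtain ⟨t, ht, -⟩ := hK.exists_facet v.2.1
    exact ⟨⟨t, ht⟩⟩

include hK in
lemma finite_facets : Finite {σ : Finset E // σ ∈ K.facets} :=
  (hK.finite.subset fun _ h => h.1).to_subtype

lemma dualGraph_eq : dualGraph 3 K = (coloredFacets hK hκ).dual := by
  classical
  ext σ τ
  constructor
  · rintro ⟨h1, h2⟩
    exact ⟨h1, exists_color_of_card_inter hK hκ (by convert h2.ge)⟩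
  · rintro ⟨h1, c, hc⟩
    refine ⟨h1, ?_⟩
    have := image_color_inter_of_agree hK hκ h1 hc
    rw [← card_image_color_inter hκ, this, Finset.card_compl]
    rfl

lemma bicolored_le (c c' : Fin 4) :
    (coloredFacets hK hκ).bicolored c c' ≤ bicoloredGraph 3 K κ c c' := by
  rintro σ τ ⟨h1, e, he, hc⟩
  refine ⟨?_, e, he, ?_⟩
  · rw [dualGraph_eq hK hκ]
    exact ⟨h1, e, hc⟩
  · exact image_color_inter_of_agree hK hκ h1 hc

/-- Extra edges only merge components. One inequality suffices, since only an upper bound for the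
Euler characteristic is needed. -/
lemma bicoloredCycleCount_le (c c' : Fin 4) : bicoloredCycleCount 3 K κ c c' ≤
    Nat.card ((coloredFacets hK hκ).bicolored c c').ConnectedComponent := by
  have := finite_facets hK
  have : Finite ((coloredFacets hK hκ).bicolored c c').ConnectedComponent := Quot.finite _
  exact Nat.card_le_card_of_surjective
    (SimpleGraph.ConnectedComponent.map (SimpleGraph.Hom.ofLE (bicolored_le hK hκ c c')))
    (SimpleGraph.ConnectedComponent.surjective_map_ofLE _)

end Complexes

/-! ### The genus bound and the theorem -/

lemma FacetSystem.ncard_swap {A B : Type*} (C : FacetSystem A B) :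
    {t : B × A | ∃ y' x', C.swap.Fac t.1 y' t.2 x'}.ncard =
      {t : A × B | ∃ x' y', C.Fac t.1 x' t.2 y'}.ncard := by
  rw [← Set.ncard_image_of_injective _ Prod.swap_injective]
  congr 1
  ext ⟨x, y⟩
  constructor
  · rintro ⟨⟨_, _⟩, ⟨y', x', h⟩, e⟩
    cases e
    exact ⟨x', y', h⟩
  · rintro ⟨x', y', h⟩
    exact ⟨(y, x), ⟨y', x', h⟩, rfl⟩

lemma ColoredFacets.edges_le {F V : Type*} [Finite F] (X : ColoredFacets F V)
    {a b : Bool → Fin 4} (h : IsColorSplit a b) :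
    2 * (X.system h).swap.graph.edgeSet.ncard +
      {t : X.Side a × X.Side b | ∃ x' y', (X.system h).Fac t.1 x' t.2 y'}.ncard ≤
    Nat.card F + 2 * Nat.card (X.Side b) := by
  have := Fintype.ofFinite (X.Side a)
  have := Fintype.ofFinite (X.Side b)
  rw [Nat.card_eq_fintype_card (α := X.Side b)]
  exact (normal_system h).edges_le (ncard_fac_system h)

section Complexes
variable {E : Type*} [AddCommGroup E] [Module ℝ E] {K : SimplicialComplex ℝ E} {κ : E → Fin 4}
  (hK : IsNormalPseudomanifold 3 K) (hκ : IsBalancedColoring 3 K κ)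

lemma nonempty_realization_system_homeomorph [TopologicalSpace E] [T2Space E] [ContinuousAdd E]
    [ContinuousSMul ℝ E] {a b : Bool → Fin 4} (h : IsColorSplit a b)
    [Fintype ((coloredFacets hK hκ).Side a)] [Fintype ((coloredFacets hK hκ).Side b)]
    [DecidableEq ((coloredFacets hK hκ).Side a)] [DecidableEq ((coloredFacets hK hκ).Side b)] :
    Nonempty (Realization ((coloredFacets hK hκ).system h).simplices ≃ₜ K.space) := by
  classical
  refine nonempty_realization_homeomorph_space K (pos := Sum.elim Subtype.val Subtype.val)
    (Function.Injective.sumElim Subtype.val_injective Subtype.val_injective ?_) ?_ ?_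
  · rintro ⟨_, σ, i, rfl⟩ ⟨_, τ, j, rfl⟩ e
    exact h.ne i j ((coloredFacets hK hκ).color_eq e)
  · rintro _ ⟨_, _, _, _, ⟨σ, i, j, rfl, rfl, rfl, rfl⟩, rfl⟩
    refine K.down_closed σ.2.1 (fun v hv => ?_) (by simp)
    simp only [Finset.image_insert, Finset.image_singleton, Finset.mem_insert,
      Finset.mem_singleton] at hv
    rcases hv with rfl | rfl | rfl | rfl <;> exact facetVertex_mem hK hκ σ _
  · intro t ht
    obtain ⟨s, hs, hts⟩ := hK.exists_facet ht
    refine ⟨_, ⟨_, _, _, _, ColoredFacets.fac_side h ⟨s, hs⟩ true true, rfl⟩, fun v hv => ?_⟩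
    have hv' := facetVertex_color hK hκ (σ := ⟨s, hs⟩) (hts hv)
    simp only [Finset.image_insert, Finset.image_singleton, Finset.mem_insert,
      Finset.mem_singleton]
    rw [← hv']
    rcases h.cover (κ v) with ⟨i, hi⟩ | ⟨i, hi⟩ <;> rw [← hi] <;> cases i
    exacts [Or.inr (Or.inl rfl), Or.inl rfl, Or.inr (Or.inr (Or.inr rfl)), Or.inr (Or.inr (Or.inl rfl))]

/-- The dual graph is 4-regular, so vertices minus edges is minus the number of facets, and the
cycles are bounded by the A-B edges. -/
lemma surfaceEulerChar_le (ε : Equiv.Perm (Fin 4)) : surfaceEulerChar 3 K κ ε ≤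
    ({t : (coloredFacets hK hκ).Side (fun k => ε (cond k 2 0)) ×
      (coloredFacets hK hκ).Side (fun k => ε (cond k 3 1)) | ∃ x' y',
      ((coloredFacets hK hκ).system (ColoredFacets.isColorSplit_of_perm ε)).Fac t.1 x' t.2 y'}.ncard
      : ℤ) - Nat.card {σ : Finset E // σ ∈ K.facets} := by
  have := finite_facets hK
  have h1 := (coloredFacets hK hκ).ncard_edgeSet_dual
  rw [← dualGraph_eq hK hκ] at h1
  have h2 := (Finset.sum_le_sum fun i (_ : i ∈ Finset.univ) =>
    bicoloredCycleCount_le hK hκ (ε i) (ε (i + 1))).trans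
    ((coloredFacets hK hκ).sum_card_connectedComponent_le ε)
  have h2' := (Nat.cast_le (α := ℤ)).2 h2
  push_cast at h2'
  unfold surfaceEulerChar
  rw [h1]
  push_cast
  linarith

/-- Both cycle ranks are bounded by the genus: the number of A-B edges cancels between the Euler
characteristic of the surface and the sum over the vertex links. -/
lemma edges_add_one_le_balancedGenusAt (ε : Equiv.Perm (Fin 4)) :
    ((((coloredFacets hK hκ).system
      (ColoredFacets.isColorSplit_of_perm ε)).swap.graph.edgeSet.ncard : ℝ) + 1 ≤
      balancedGenusAt 3 K κ ε +
        Nat.card ((coloredFacets hK hκ).Side (fun k => ε (cond k 3 1)))) ∧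
    ((((coloredFacets hK hκ).system
      (ColoredFacets.isColorSplit_of_perm ε)).graph.edgeSet.ncard : ℝ) + 1 ≤
      balancedGenusAt 3 K κ ε +
        Nat.card ((coloredFacets hK hκ).Side (fun k => ε (cond k 2 0)))) := by
  have := finite_facets hK
  have h := ColoredFacets.isColorSplit_of_perm ε
  have h1 := (coloredFacets hK hκ).edges_le h
  have h2 := (coloredFacets hK hκ).edges_le h.swap
  rw [← ColoredFacets.system_swap h, FacetSystem.ncard_swap] at h2
  have h3 : (surfaceEulerChar 3 K κ ε : ℝ) ≤ _ := Int.cast_le.2 (surfaceEulerChar_le hK hκ ε)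
  have h1' := (Nat.cast_le (α := ℝ)).2 h1
  have h2' := (Nat.cast_le (α := ℝ)).2 h2
  unfold balancedGenusAt
  push_cast at h1' h2' h3
  constructor
  · linarith
  · change 2 * ((((coloredFacets hK hκ).system h).graph.edgeSet.ncard : ℕ) : ℝ) + _ ≤ _ at h2'
    linarith

end Complexes

lemma FacetSystem.Normal.groupRank_add_three_le {A B : Type*} [Fintype A] [Fintype B]
    [DecidableEq A] [DecidableEq B] {C : FacetSystem A B} (hC : C.Normal) {M : Type*}
    [TopologicalSpace M] [PathConnectedSpace M] (e : Realization C.simplices ≃ₜ M) (x : M)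
    (hA : ¬ C.NoRemovable) {g : ℝ} (hg : (C.graph.edgeSet.ncard : ℝ) + 1 ≤ g + Nat.card A) :
    ((groupRank (FundamentalGroup M x) : ENNReal) : EReal) + 3 ≤ g := by
  obtain ⟨R, hRe, hR3, hR⟩ := not_not.1 hA
  have h1 := hC.groupRank_fundamentalGroup_le e x hRe hR
  rw [hR3] at h1
  -- The rank is finite by the bound itself, which allows the passage to real numbers.
  obtain ⟨r, hr⟩ : ∃ r : ℕ, groupRank (FundamentalGroup M x) = r := by
    refine ⟨_, (ENat.natCast_toNat fun htop => ?_).symm⟩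
    rw [htop] at h1
    refine absurd h1 (not_le.2 ?_)
    rw [top_add, top_add]
    exact_mod_cast ENat.natCast_lt_top (C.graph.edgeSet.ncard + 1)
  rw [hr] at h1 ⊢
  have h2 : r + 3 + Nat.card A ≤ C.graph.edgeSet.ncard + 1 := by exact_mod_cast h1
  have h3 : (r : ℝ) + 3 ≤ g := by
    have : ((r + 3 + Nat.card A : ℕ) : ℝ) ≤ ((C.graph.edgeSet.ncard + 1 : ℕ) : ℝ) :=
      Nat.cast_le.2 h2
    push_cast at this
    linarith
  have h4 : (((r : ℕ∞) : ENNReal) : EReal) + 3 = (((r : ℝ) + 3 : ℝ) : EReal) := by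
    push_cast
    rfl
  rw [h4]
  exact EReal.coe_le_coe_iff.2 h3

theorem theorem1p1 (M : Type*) [TopologicalSpace M] [T2Space M] [SecondCountableTopology M]
    [ChartedSpace (EuclideanSpace ℝ (Fin 3)) M] [CompactSpace M] [ConnectedSpace M]
    (hM : IsEmpty (M ≃ₜ Metric.sphere (0 : EuclideanSpace ℝ (Fin 4)) 1)) (x : M) :
    ((groupRank (FundamentalGroup M x) : ENNReal) : EReal) + 3 ≤ balancedGenus 3 M := by
  classical
  have := ChartedSpace.locallyPathConnectedSpace (EuclideanSpace ℝ (Fin 3)) M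
  have : PathConnectedSpace M := pathConnectedSpace_iff_connectedSpace.2 inferInstance
  refine le_iInf fun T => ?_
  -- A cyclic order attaining the minimum determines the colour split used from here on.
  obtain ⟨ε, -, hε⟩ := Finset.exists_mem_eq_inf' (Finset.univ_nonempty (α := Equiv.Perm (Fin 4)))
    (balancedGenusAt 3 T.complex T.color)
  rw [complexBalancedGenus, hε]
  have := finite_facets T.normal
  set X := coloredFacets T.normal T.balanced with hX
  have h := ColoredFacets.isColorSplit_of_perm ε
  have := Fintype.ofFinite (X.Side (fun k => ε (cond k 2 0)))
  have := Fintype.ofFinite (X.Side (fun k => ε (cond k 3 1)))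
  obtain ⟨e⟩ := nonempty_realization_system_homeomorph T.normal T.balanced h
  obtain ⟨e'⟩ := nonempty_realization_system_homeomorph T.normal T.balanced h.swap
  obtain ⟨hB, hA⟩ := edges_add_one_le_balancedGenusAt T.normal T.balanced ε
  by_cases nA : (X.system h).NoRemovable
  · by_cases nB : (X.system h).swap.NoRemovable
    · obtain ⟨f⟩ := (ColoredFacets.normal_system h).nonempty_homeomorph_sphere nA nB
      exact hM.elim ((T.homeo.symm.trans e.symm).trans f)
    · rw [ColoredFacets.system_swap] at nB
      rw [← hX, ColoredFacets.system_swap] at hB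
      exact (ColoredFacets.normal_system h.swap).groupRank_add_three_le (e'.trans T.homeo) x nB hB
  · exact (ColoredFacets.normal_system h).groupRank_add_three_le (e.trans T.homeo) x nA hA
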